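/- Let $m\ge 3$. For each $n\in\mathbb N$ let $m-1$ sequences $\{b^{(j)}_{k,n}\}_{k\ge 0}$, $j=0,\dots,m-2$, of real numbers be given, and assume there are continuous functions $b^{(j)}:[0,\infty)\to\mathbb R$ such that for every $s\ge 0$ \[ \lim_{k/n\to s} b^{(j)}_{k,n}=b^{(j)}(s),\qquad j=0,\dots,m-2, \] where $\lim_{k/n\to s}$ means that $k,n\to\infty$ with $k/n\to s$; assume $b^{(m-2)}(s)\ne 0$ for $s>0$. Let $P_{k,n}$ be the monic polynomials generated by \[ xP_{k,n}(x)=P_{k+1,n}(x)+b^{(0)}_{k,n}P_{k,n}(x)+b^{(1)}_{k,n}P_{k-1,n}(x)+\cdots+b^{(m-2)}_{k,n}P_{k+2-m,n}(x), \] with $P_{0,n}\equiv 1$ and $P_{-1,n}\equiv\cdots\equiv P_{-m+2,n}\equiv 0$. For $s>0$ put $A_s(z)=z+b^{(0)}(s)+b^{(1)}(s)z^{-1}+\cdots+b^{(m-2)}(s)z^{-m+2}$. For $x\in\mathbb C$ let $z_1(x,s),\dots,z_{m-1}(x,s)$ be the solutions of $A_s(z)=x$, counted with multiplicity and labelled so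 that $|z_1(x,s)|\ge\cdots\ge|z_{m-1}(x,s)|>0$, and put $\Gamma_1(s)=\{x\in\mathbb C: |z_1(x,s)|=|z_2(x,s)|\}$. Suppose that (a) the polynomials $P_{k,n}$ have real and simple zeros $x_1^{k,n}<\cdots<x_k^{k,n}$ with $x_j^{k+1,n}<x_j^{k,n}<x_{j+1}^{k+1,n}$ for $j=1,\dots,k$ and all $k,n$; (b) $\Gamma_1(s)\subset\mathbb R$ for every $s>0$. For $s>0$ let $\mu_1^s$ be the measure on $\Gamma_1(s)$ with \[ d\mu_1^s(x)=\frac1{2\pi i}\left(\frac{z_{1-}'(x,s)}{z_{1-}(x,s)}-\frac{z_{1+}'(x,s)}{z_{1+}(x,s)}\right)dx, \] where $'$ is the derivative with respect to $x$ and $\pm$ denote the boundary values on $\mathbb R$ from the upper ($+$) and lower ($-$) half plane. Then: 1. For every $s>0$, $\mu_1^s$ is a probability measure, and it is the weak limit as $n\to\infty$ of the normalized eigenvalue counting measures (on $\mathbb C$, with algebraic multiplicities) of the $n\times n$ Toeplitz matrices $T_n(A_s)$, which have entries $1$ on the superdiagonal, $b^{(i)}(s)$ at the positions $(j,j-i)$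 for $i=0,\dots,m-2$, and $0$ elsewhere. 2. For every $\xi>0$, $s\mapsto\mu_1^s$ is measurable on $(0,\xi]$ (up to a Lebesgue null set), $\frac1\xi\int_0^\xi\mu_1^s\,ds$ is a probability measure, and the normalized zero counting measures $\nu(P_{k,n})=\frac1k\sum_{j=1}^k\delta_{x_j^{k,n}}$ converge weakly: \[ \lim_{k/n\to\xi}\nu(P_{k,n})=\frac1\xi\int_0^\xi\mu_1^s\,ds. \] -/

import Mathlib

open Filter Topology MeasureTheory Polynomial
open scoped BoundedContinuousFunction

noncomputable section

/-- The filter of pairs `(k, n)` describing the limit `k / n → s`: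
both `k → ∞` and `n → ∞`, with `k / n → s`. -/
def ratioFilter (s : ℝ) : Filter (ℕ × ℕ) :=
  (atTop ×ˢ atTop) ⊓ comap (fun p : ℕ × ℕ => (p.1 : ℝ) / (p.2 : ℝ)) (𝓝 s)

/-- Weak convergence of measures: convergence of the integrals of all bounded continuous
functions. -/
def WeakLimit {ι E : Type*} [TopologicalSpace E] [MeasurableSpace E]
    (ν : ι → Measure E) (l : Filter ι) (μ : Measure E) : Prop :=
  ∀ f : E →ᵇ ℝ, Tendsto (fun i => ∫ x, f x ∂(ν i)) l (𝓝 (∫ x, f x ∂μ))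

/-- The normalized counting measure of a finite multiset of points (with multiplicities). -/
def normalizedCounting {E : Type*} [MeasurableSpace E] (S : Multiset E) : Measure E :=
  (S.card : ENNReal)⁻¹ • (S.map Measure.dirac).sum

/-- The symbol `A(z) = z + c₀ + c₁ z⁻¹ + ⋯ + c_{m-2} z^{-(m-2)}` (for `z ≠ 0`). -/
def symbolA (m : ℕ) (c : ℕ → ℝ) (z : ℂ) : ℂ :=
  z + ∑ j ∈ Finset.range (m - 1), (c j : ℂ) / z ^ j

/-- `z 1, …, z (m-1)` are all the solutions of `A(z) = x`, repeated according to multiplicity,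
and labelled so that `|z 1| ≥ |z 2| ≥ ⋯ ≥ |z (m-1)|`. -/
def IsOrderedSolutions (m : ℕ) (c : ℕ → ℝ) (x : ℂ) (z : ℕ → ℂ) : Prop :=
  (∀ w : ℂ, w ≠ 0 →
    w ^ (m - 2) * (symbolA m c w - x) = ∏ j ∈ Finset.Icc 1 (m - 1), (w - z j)) ∧
  AntitoneOn (fun j => ‖z j‖) (Set.Icc 1 (m - 1))

/-- The contour `Γ₁ = {x ∈ ℂ : |z₁(x)| = |z₂(x)|}`. -/
def Gamma1 (m : ℕ) (c : ℕ → ℝ) : Set ℂ :=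
  {x | ∃ z, IsOrderedSolutions m c x z ∧ ‖z 1‖ = ‖z 2‖}

/-- The solution `z₁(x)` of `A(z) = x` of largest absolute value.
It is uniquely determined for `x ∉ Γ₁`. -/
def z1 (m : ℕ) (c : ℕ → ℝ) (x : ℂ) : ℂ :=
  Classical.epsilon (IsOrderedSolutions m c x) 1

/-- Boundary value at the real point `x` of a function on `ℂ`, taken from the `+` side, which is
the upper half plane (the left side, when the real line is traversed from left to right). -/
def bvPlus (g : ℂ → ℂ) (x : ℝ) : ℂ := limUnder (𝓝[{w : ℂ | 0 < w.im}] (x : ℂ)) g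

/-- Boundary value at the real point `x` from the `-` side, the lower half plane. -/
def bvMinus (g : ℂ → ℂ) (x : ℝ) : ℂ := limUnder (𝓝[{w : ℂ | w.im < 0}] (x : ℂ)) g

/-- The density `(1 / 2πi) (z₁₋'(x) / z₁₋(x) - z₁₊'(x) / z₁₊(x))`. -/
def mu1Density (m : ℕ) (c : ℕ → ℝ) (x : ℝ) : ℂ :=
  1 / (2 * (Real.pi : ℂ) * Complex.I) *
    (bvMinus (deriv (z1 m c)) x / bvMinus (z1 m c) x -
      bvPlus (deriv (z1 m c)) x / bvPlus (z1 m c) x)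

/-- The measure `μ₁` on `Γ₁` with the above density with respect to the line element `dx`,
for a symbol with `Γ₁ ⊆ ℝ`. -/
def mu1 (m : ℕ) (c : ℕ → ℝ) : Measure ℝ :=
  (volume.restrict {x : ℝ | (x : ℂ) ∈ Gamma1 m c}).withDensity
    (fun x => ENNReal.ofReal (mu1Density m c x).re)

/-- The `n × n` Toeplitz matrix with symbol `A`: ones on the superdiagonal and `c i` on the
`i`-th diagonal below (and including) the main one, `i = 0, …, m - 2`. -/
def toeplitz (m : ℕ) (c : ℕ → ℝ) (n : ℕ) : Matrix (Fin n) (Fin n) ℂ :=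
  Matrix.of fun j k =>
    if (k : ℕ) = j + 1 then 1
    else if (k : ℕ) ≤ j ∧ (j : ℕ) - k ≤ m - 2 then (c ((j : ℕ) - k) : ℂ)
    else 0

/-- The average `(1 / ξ) ∫₀^ξ μ s ds` of a family of measures. -/
def averageMeasure (μ : ℝ → Measure ℝ) (ξ : ℝ) : Measure ℝ :=
  (ENNReal.ofReal ξ)⁻¹ • (volume.restrict (Set.Ioc 0 ξ)).bind μ

end

open scoped ComplexConjugate

/-! Both limits are identified through Stieltjes transforms, and the common answer is the
logarithmic derivative of the dominant solution z₁ of A(z) = x.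

The measure. Off Γ₁ the solution z₁ is simple and strictly dominant, hence holomorphic in x. As Γ₁
is real, z₁ is holomorphic on the upper half plane. There it is never real, because A takes real
values at real arguments, and it is close to x at infinity, so it maps the half plane into itself.
It extends continuously to the real line. Along the line the argument of -i z₁ decreases from π/2 to
-π/2, and its derivative is -π times the density of μ₁. The sign comes from dominance: the
continuation of z₁ below the axis is still a solution, so its modulus is at most that of z₁ at the
mirror point. Thus μ₁ is a probability measure whose distribution function is read off from this
argument. The imaginary part of log(-i z₁(x)) - ∫ log(-i(x - t)) dμ₁(t) vanishes on the line and at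
infinity; the maximum principle makes the function constant, and differentiation gives ∫ dμ₁(t)/(x -
t) = z₁'/z₁ = 1/(z₁ A'(z₁)) (`integral_inv_sub_mu1`).

The polynomials. Dividing the recurrence by P_k gives a fixed point equation for the ratios
P_k/P_{k+1}; differentiating it gives a linear one for the increments of P_k'/P_k. For large |x|
both are contractions, so the ratios tend to 1/z₁ and the increments to 1/(z₁ A'(z₁)) whenever k/n →
s (`tendsto_stepLogDeriv`). The a priori bounds this requires come from interlacing
(`interlacing_bounds`) or, for the characteristic polynomials of Toeplitz matrices, which satisfy
the same recurrence with constant coefficients, from growth in k (`toeplitzPoly_growth`). The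
Stieltjes transform of a zero counting measure is P_k'/(k P_k), the mean of these increments: a
Cesàro mean in the Toeplitz case, and in general an integral over s by dominated convergence
(`tendsto_average_of_tendsto_ratioFilter`).

Weak convergence. For probability measures on the line, convergence of Stieltjes transforms high in
the half plane suffices (`weakLimit_of_tendsto_stieltjes`). Toeplitz eigenvalues need not be real,
but their generating function ∏ 1/(1 - z_j t) shows that compact sets off Γ₁ are eventually free of
them (`eventually_eval_toeplitzPoly_ne_zero`), so they may be replaced by their real parts. -/

/-! ### Existence and elementary properties of ordered solutions -/

lemma prod_Icc_one_eq_prod_range (f : ℕ → ℂ) (n : ℕ) :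
    ∏ j ∈ Finset.Icc 1 n, f j = ∏ i ∈ Finset.range n, f (i + 1) := by
  induction n with
  | zero => simp
  | succ k ih => rw [Finset.prod_Icc_succ_top (by omega), ih, Finset.prod_range_succ]

/-- Every finite multiset can be enumerated with decreasing absolute values. -/
lemma exists_antitone_enumeration (S : Multiset ℂ) :
    ∃ z : ℕ → ℂ, AntitoneOn (fun j => ‖z j‖) (Set.Icc 1 S.card) ∧
      ∀ w : ℂ, (S.map fun a => w - a).prod = ∏ j ∈ Finset.Icc 1 S.card, (w - z j) := by
  classical
  let r : ℂ → ℂ → Prop := fun a b => ‖b‖ ≤ ‖a‖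
  have : Std.Total r := ⟨fun a b => le_total _ _⟩
  have : IsTrans ℂ r := ⟨fun a b c h1 h2 => le_trans h2 h1⟩
  set L := S.toList.insertionSort r with hL
  have hperm : (L : Multiset ℂ) = S := by
    rw [hL, Multiset.coe_eq_coe.2 (List.perm_insertionSort r _), Multiset.coe_toList]
  have hlen : L.length = S.card := by rw [← hperm]; rfl
  have hsort : L.Pairwise r := List.pairwise_insertionSort r _
  refine ⟨fun j => L.getD (j - 1) 0, ?_, fun w => ?_⟩
  · intro i hi j hj hij
    have h1 : i - 1 < L.length := by have := hi.1; have := hi.2; omega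
    have h2 : j - 1 < L.length := by have := hj.1; have := hj.2; omega
    simp only [List.getD_eq_getElem _ _ h1, List.getD_eq_getElem _ _ h2]
    rcases hij.eq_or_lt with rfl | hlt
    · exact le_rfl
    · exact List.pairwise_iff_getElem.1 hsort _ _ h1 h2 (by have := hi.1; omega)
  · rw [← hlen, ← hperm, Multiset.map_coe, Multiset.prod_coe, prod_Icc_one_eq_prod_range,
      Finset.prod_range, ← Fin.prod_univ_fun_getElem]
    refine Finset.prod_congr rfl fun i _ => ?_
    simp

/-- The polynomial `z ^ (m - 2) * (A z - x)`. -/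
noncomputable def symbolPoly (m : ℕ) (c : ℕ → ℝ) (x : ℂ) : ℂ[X] :=
  X ^ (m - 1) + (∑ j ∈ Finset.range (m - 1), C (c j : ℂ) * X ^ (m - 2 - j) - C x * X ^ (m - 2))

lemma eval_symbolPoly {m : ℕ} (hm : 3 ≤ m) (c : ℕ → ℝ) (x : ℂ) {w : ℂ} (hw : w ≠ 0) :
    (symbolPoly m c x).eval w = w ^ (m - 2) * (symbolA m c w - x) := by
  have h1 : m - 1 = (m - 2) + 1 := by omega
  simp only [symbolPoly, symbolA, eval_add, eval_sub, eval_mul, eval_pow, eval_X, eval_C,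
    eval_finsetSum]
  have : ∑ j ∈ Finset.range (m - 1), (c j : ℂ) * w ^ (m - 2 - j) =
      w ^ (m - 2) * ∑ j ∈ Finset.range (m - 1), (c j : ℂ) / w ^ j := by
    rw [Finset.mul_sum]
    refine Finset.sum_congr rfl fun j hj => ?_
    have hj' : j ≤ m - 2 := by have := Finset.mem_range.1 hj; omega
    rw [pow_sub₀ w hw hj']; field_simp
  rw [this, h1, pow_succ]; ring

lemma degree_symbolPoly_aux {m : ℕ} (hm : 3 ≤ m) (c : ℕ → ℝ) (x : ℂ) :
    (∑ j ∈ Finset.range (m - 1), C (c j : ℂ) * X ^ (m - 2 - j) - C x * X ^ (m - 2)).degree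
      < ((m - 1 : ℕ) : WithBot ℕ) := by
  have h : ((m - 2 : ℕ) : WithBot ℕ) < ((m - 1 : ℕ) : WithBot ℕ) := by
    exact_mod_cast (by omega : m - 2 < m - 1)
  refine (degree_sub_le _ _).trans_lt (max_lt ?_ ((degree_C_mul_X_pow_le _ _).trans_lt h))
  refine (degree_sum_le _ _).trans_lt ((Finset.sup_lt_iff (WithBot.bot_lt_coe _)).2 fun j _ => ?_)
  refine (degree_C_mul_X_pow_le _ _).trans_lt ?_
  exact_mod_cast (by omega : m - 2 - j < m - 1)

lemma monic_symbolPoly {m : ℕ} (hm : 3 ≤ m) (c : ℕ → ℝ) (x : ℂ) : (symbolPoly m c x).Monic :=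
  monic_X_pow_add (degree_symbolPoly_aux hm c x)

lemma natDegree_symbolPoly {m : ℕ} (hm : 3 ≤ m) (c : ℕ → ℝ) (x : ℂ) :
    (symbolPoly m c x).natDegree = m - 1 := by
  refine natDegree_eq_of_degree_eq_some ?_
  rw [symbolPoly, degree_add_eq_left_of_degree_lt, degree_X_pow]
  rw [degree_X_pow]; exact degree_symbolPoly_aux hm c x

lemma exists_isOrderedSolutions {m : ℕ} (hm : 3 ≤ m) (c : ℕ → ℝ) (x : ℂ) :
    ∃ z, IsOrderedSolutions m c x z := by
  obtain ⟨z, hz1, hz2⟩ := exists_antitone_enumeration (symbolPoly m c x).roots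
  have hsp := IsAlgClosed.splits (symbolPoly m c x)
  have hcard : (symbolPoly m c x).roots.card = m - 1 := by
    rw [← natDegree_symbolPoly hm c x]; exact hsp.natDegree_eq_card_roots.symm
  rw [hcard] at hz1 hz2
  refine ⟨z, fun w hw => ?_, hz1⟩
  rw [← eval_symbolPoly hm c x hw, ← hz2]
  conv_lhs => rw [hsp.eq_prod_roots_of_monic (monic_symbolPoly hm c x)]
  rw [eval_multiset_prod, Multiset.map_map]
  simp

lemma z1_spec {m : ℕ} (hm : 3 ≤ m) (c : ℕ → ℝ) (x : ℂ) :
    ∃ z, IsOrderedSolutions m c x z ∧ z 1 = z1 m c x :=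
  ⟨_, Classical.epsilon_spec (exists_isOrderedSolutions hm c x), rfl⟩

namespace IsOrderedSolutions

variable {m : ℕ} {c : ℕ → ℝ} {x : ℂ} {z : ℕ → ℂ}

/-- The defining identity is only available for w ≠ 0; two polynomials that agree at all positive
reals are equal, which also gives access to the value at 0. -/
lemma symbolPoly_eq (hm : 3 ≤ m) (h : IsOrderedSolutions m c x z) :
    symbolPoly m c x = ∏ j ∈ Finset.Icc 1 (m - 1), (X - C (z j)) := by
  refine eq_of_infinite_eval_eq _ _ ((Set.Ioi_infinite (0:ℝ)).image
    (f := fun t : ℝ => (t : ℂ)) Complex.ofReal_injective.injOn |>.mono ?_)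
  rintro _ ⟨t, ht, rfl⟩
  have ht' : (t : ℂ) ≠ 0 := by exact_mod_cast (ne_of_gt ht)
  simp only [Set.mem_ofPred_eq]
  rw [eval_symbolPoly hm c x ht', h.1 _ ht', eval_prod]
  simp

lemma ne_zero (hm : 3 ≤ m) (hc : c (m - 2) ≠ 0) (h : IsOrderedSolutions m c x z) {j : ℕ}
    (hj : j ∈ Finset.Icc 1 (m - 1)) : z j ≠ 0 := by
  intro h0
  have h1 : (symbolPoly m c x).eval 0 = 0 := by
    rw [h.symbolPoly_eq hm, eval_prod]
    exact Finset.prod_eq_zero hj (by simp [h0])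
  have h2 : (symbolPoly m c x).eval 0 = c (m - 2) := by
    simp only [symbolPoly, eval_add, eval_sub, eval_mul, eval_pow, eval_X, eval_C, eval_finsetSum]
    rw [Finset.sum_eq_single (m - 2)]
    · rw [zero_pow (by omega : m - 1 ≠ 0), zero_pow (by omega : m - 2 ≠ 0)]; simp
    · intro i hi hne
      have := Finset.mem_range.1 hi
      rw [zero_pow (by omega : m - 2 - i ≠ 0), mul_zero]
    · intro hi; exact absurd (Finset.mem_range.2 (by omega)) hi
  rw [h2] at h1
  exact hc (by exact_mod_cast h1)

lemma symbolA_eq_iff (h : IsOrderedSolutions m c x z) {w : ℂ} (hw : w ≠ 0) :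
    symbolA m c w = x ↔ ∃ j ∈ Finset.Icc 1 (m - 1), w = z j := by
  have h1 := h.1 w hw
  constructor
  · intro h2
    rw [h2, sub_self, mul_zero] at h1
    obtain ⟨j, hj, h3⟩ := Finset.prod_eq_zero_iff.1 h1.symm
    exact ⟨j, hj, sub_eq_zero.1 h3⟩
  · rintro ⟨j, hj, h3⟩
    rw [Finset.prod_eq_zero hj (sub_eq_zero.2 h3)] at h1
    exact sub_eq_zero.1 ((mul_eq_zero.1 h1).resolve_left (pow_ne_zero _ hw))

lemma norm_le (h : IsOrderedSolutions m c x z) {j : ℕ} (hj : j ∈ Finset.Icc 1 (m - 1)) :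
    ‖z j‖ ≤ ‖z 1‖ := by
  have := Finset.mem_Icc.1 hj
  exact h.2 ⟨le_rfl, by omega⟩ ⟨this.1, this.2⟩ this.1

lemma symbolA_eq (hm : 3 ≤ m) (hc : c (m - 2) ≠ 0) (h : IsOrderedSolutions m c x z) {j : ℕ}
    (hj : j ∈ Finset.Icc 1 (m - 1)) : symbolA m c (z j) = x :=
  (h.symbolA_eq_iff (h.ne_zero hm hc hj)).2 ⟨j, hj, rfl⟩

end IsOrderedSolutions

/-! ### Continuity and differentiability of the dominant solution off Γ₁ -/

section Roots

variable {m : ℕ} {c : ℕ → ℝ} {x : ℂ}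

lemma z1_ne_zero (hm : 3 ≤ m) (hc : c (m - 2) ≠ 0) (x : ℂ) : z1 m c x ≠ 0 := by
  obtain ⟨z, hz, h1⟩ := z1_spec hm c x
  rw [← h1]; exact hz.ne_zero hm hc (Finset.mem_Icc.2 ⟨le_rfl, by omega⟩)

lemma symbolA_z1 (hm : 3 ≤ m) (hc : c (m - 2) ≠ 0) (x : ℂ) : symbolA m c (z1 m c x) = x := by
  obtain ⟨z, hz, h1⟩ := z1_spec hm c x
  rw [← h1]; exact hz.symbolA_eq hm hc (Finset.mem_Icc.2 ⟨le_rfl, by omega⟩)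

lemma norm_le_norm_z1 (hm : 3 ≤ m) {w : ℂ} (hw : w ≠ 0) (h : symbolA m c w = x) :
    ‖w‖ ≤ ‖z1 m c x‖ := by
  obtain ⟨z, hz, h1⟩ := z1_spec hm c x
  obtain ⟨j, hj, rfl⟩ := (hz.symbolA_eq_iff hw).1 h
  rw [← h1]; exact hz.norm_le hj

lemma norm_lt_of_notMem_Gamma1 (hm : 3 ≤ m) (hx : x ∉ Gamma1 m c) {z : ℕ → ℂ}
    (hz : IsOrderedSolutions m c x z) : ‖z 2‖ < ‖z 1‖ := by
  refine lt_of_le_of_ne (hz.norm_le (Finset.mem_Icc.2 ⟨by omega, by omega⟩)) fun h => ?_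
  exact hx ⟨z, hz, h.symm⟩

lemma eq_z1_of_notMem_Gamma1 (hm : 3 ≤ m) (hx : x ∉ Gamma1 m c) {w : ℂ}
    (hw : w ≠ 0) (h : symbolA m c w = x) (hn : ‖z1 m c x‖ ≤ ‖w‖) : w = z1 m c x := by
  obtain ⟨z, hz, h1⟩ := z1_spec hm c x
  obtain ⟨j, hj, rfl⟩ := (hz.symbolA_eq_iff hw).1 h
  have hj' := Finset.mem_Icc.1 hj
  rcases eq_or_lt_of_le hj'.1 with h2 | h2
  · rw [← h2, h1]
  · exfalso
    have h3 : ‖z j‖ ≤ ‖z 2‖ := hz.2 ⟨by omega, by omega⟩ ⟨hj'.1, hj'.2⟩ h2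
    have := norm_lt_of_notMem_Gamma1 hm hx hz
    rw [h1] at this
    linarith

lemma IsOrderedSolutions.eq_z1 (hm : 3 ≤ m) (hc : c (m - 2) ≠ 0) (hx : x ∉ Gamma1 m c) {z : ℕ → ℂ}
    (hz : IsOrderedSolutions m c x z) : z 1 = z1 m c x := by
  have h1 : 1 ∈ Finset.Icc 1 (m - 1) := Finset.mem_Icc.2 ⟨le_rfl, by omega⟩
  refine eq_z1_of_notMem_Gamma1 hm hx (hz.ne_zero hm hc h1) (hz.symbolA_eq hm hc h1) ?_
  obtain ⟨j, hj, h2⟩ := (hz.symbolA_eq_iff (z1_ne_zero hm hc x)).1 (symbolA_z1 hm hc x)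
  rw [h2]; exact hz.norm_le hj

/-- An a priori bound for the solutions of `A w = x`. -/
lemma norm_le_of_symbolA_eq {w : ℂ} (h : symbolA m c w = x) :
    ‖w‖ ≤ 1 + ∑ j ∈ Finset.range (m - 1), |c j| + ‖x‖ := by
  have hs : 0 ≤ ∑ j ∈ Finset.range (m - 1), |c j| := Finset.sum_nonneg fun _ _ => abs_nonneg _
  rcases le_or_gt ‖w‖ 1 with h1 | h1
  · have := norm_nonneg x; linarith
  · have h2 : w = x - ∑ j ∈ Finset.range (m - 1), (c j : ℂ) / w ^ j := by
      rw [← h, symbolA]; ring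
    have h3 : ‖∑ j ∈ Finset.range (m - 1), (c j : ℂ) / w ^ j‖
        ≤ ∑ j ∈ Finset.range (m - 1), |c j| := by
      refine norm_sum_le_of_le _ fun j _ => ?_
      rw [norm_div, norm_pow, Complex.norm_real, Real.norm_eq_abs]
      exact div_le_self (abs_nonneg _) (one_le_pow₀ h1.le)
    calc ‖w‖ = ‖x - ∑ j ∈ Finset.range (m - 1), (c j : ℂ) / w ^ j‖ := by rw [← h2]
      _ ≤ ‖x‖ + ∑ j ∈ Finset.range (m - 1), |c j| := (norm_sub_le _ _).trans (by linarith)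
      _ ≤ _ := by linarith

lemma IsOrderedSolutions.norm_le_bound (hm : 3 ≤ m) (hc : c (m - 2) ≠ 0) {z : ℕ → ℂ}
    (hz : IsOrderedSolutions m c x z) {j : ℕ} (hj : j ∈ Finset.Icc 1 (m - 1)) :
    ‖z j‖ ≤ 1 + ∑ j ∈ Finset.range (m - 1), |c j| + ‖x‖ :=
  norm_le_of_symbolA_eq (hz.symbolA_eq hm hc hj)

/-- Ordered solutions are stable under limits, also with respect to the coefficients. -/
lemma isOrderedSolutions_of_tendsto {ι : Type*} {l : Filter ι} [l.NeBot] {C : ι → ℕ → ℝ}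
    {ξ : ι → ℂ} {ζ : ι → ℕ → ℂ} {z : ℕ → ℂ}
    (hC : ∀ j < m - 1, Tendsto (fun i => C i j) l (𝓝 (c j))) (hξ : Tendsto ξ l (𝓝 x))
    (hζ : ∀ j ∈ Finset.Icc 1 (m - 1), Tendsto (fun i => ζ i j) l (𝓝 (z j)))
    (h : ∀ᶠ i in l, IsOrderedSolutions m (C i) (ξ i) (ζ i)) : IsOrderedSolutions m c x z := by
  refine ⟨fun w hw => ?_, fun j hj k hk hjk => ?_⟩
  · have h1 : Tendsto (fun i => w ^ (m - 2) * (symbolA m (C i) w - ξ i)) l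
        (𝓝 (w ^ (m - 2) * (symbolA m c w - x))) := by
      refine Tendsto.const_mul _ (Tendsto.sub (Tendsto.const_add _ ?_) hξ)
      refine tendsto_finsetSum _ fun j hj => ?_
      exact ((Complex.continuous_ofReal.tendsto _).comp (hC j (Finset.mem_range.1 hj))).div_const _
    have h2 : Tendsto (fun i => ∏ j ∈ Finset.Icc 1 (m - 1), (w - ζ i j)) l
        (𝓝 (∏ j ∈ Finset.Icc 1 (m - 1), (w - z j))) :=
      tendsto_finsetProd _ fun j hj => (hζ j hj).const_sub _
    refine tendsto_nhds_unique (h1.congr' ?_) h2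
    filter_upwards [h] with i hi using hi.1 w hw
  · refine le_of_tendsto_of_tendsto (hζ k (Finset.mem_Icc.2 hk)).norm
      (hζ j (Finset.mem_Icc.2 hj)).norm ?_
    filter_upwards [h] with i hi using hi.2 hj hk hjk

/-- Along an ultrafilter, ordered solutions of convergent data converge to ordered solutions. -/
lemma exists_tendsto_isOrderedSolutions (hm : 3 ≤ m) {ι : Type*} {l : Ultrafilter ι}
    {C : ι → ℕ → ℝ} {ξ : ι → ℂ} {ζ : ι → ℕ → ℂ}
    (hC : ∀ j < m - 1, Tendsto (fun i => C i j) l (𝓝 (c j))) (hξ : Tendsto ξ l (𝓝 x))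
    (hC0 : ∀ᶠ i in (l : Filter ι), C i (m - 2) ≠ 0)
    (h : ∀ᶠ i in (l : Filter ι), IsOrderedSolutions m (C i) (ξ i) (ζ i)) :
    ∃ z, IsOrderedSolutions m c x z ∧
      ∀ j ∈ Finset.Icc 1 (m - 1), Tendsto (fun i => ζ i j) l (𝓝 (z j)) := by
  have hb : Tendsto (fun i => 1 + ∑ j ∈ Finset.range (m - 1), |C i j| + ‖ξ i‖) l
      (𝓝 (1 + ∑ j ∈ Finset.range (m - 1), |c j| + ‖x‖)) :=
    ((tendsto_finsetSum _ fun j hj => (hC j (Finset.mem_range.1 hj)).abs).const_add _).add hξ.norm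
  have hb' := hb.eventually_le_const (lt_add_one _)
  have key : ∀ j, ∃ y, j ∈ Finset.Icc 1 (m - 1) → Tendsto (fun i => ζ i j) l (𝓝 y) := by
    intro j
    by_cases hj : j ∈ Finset.Icc 1 (m - 1)
    · have : ∀ᶠ i in (l : Filter ι), ζ i j ∈ Metric.closedBall (0 : ℂ)
          (1 + ∑ j ∈ Finset.range (m - 1), |c j| + ‖x‖ + 1) := by
        filter_upwards [hb', h, hC0] with i h1 h2 h3
        rw [mem_closedBall_zero_iff]
        exact (h2.norm_le_bound hm h3 hj).trans h1
      obtain ⟨y, _, hy⟩ := (isCompact_closedBall (0 : ℂ) _).ultrafilter_le_nhds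
        (l.map fun i => ζ i j) (le_principal_iff.2 this)
      exact ⟨y, fun _ => hy⟩
    · exact ⟨0, fun h => absurd h hj⟩
  choose z hz using key
  exact ⟨z, isOrderedSolutions_of_tendsto hC hξ hz h, hz⟩

/-- The dominant solution depends continuously on the data outside `Γ₁`. -/
lemma tendsto_z1 (hm : 3 ≤ m) (hc : c (m - 2) ≠ 0) (hx : x ∉ Gamma1 m c) {ι : Type*}
    {l : Filter ι} {C : ι → ℕ → ℝ} {ξ : ι → ℂ}
    (hC : ∀ j < m - 1, Tendsto (fun i => C i j) l (𝓝 (c j))) (hξ : Tendsto ξ l (𝓝 x)) :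
    Tendsto (fun i => z1 m (C i) (ξ i)) l (𝓝 (z1 m c x)) := by
  -- Ultrafilters replace the passage to subsequences: along each of them all solutions converge at
  -- once, and off Γ₁ the first limit can only be `z1`.
  rw [tendsto_iff_ultrafilter]
  intro g hg
  choose ζ hζ hζ1 using fun i => z1_spec hm (C i) (ξ i)
  obtain ⟨z, hz, hz'⟩ := exists_tendsto_isOrderedSolutions (l := g) hm
    (fun j hj => (hC j hj).mono_left hg) (hξ.mono_left hg)
    (((hC (m - 2) (by omega)).mono_left hg).eventually_ne hc) (Eventually.of_forall hζ)
  rw [← hz.eq_z1 hm hc hx]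
  simp only [← hζ1]
  exact hz' 1 (Finset.mem_Icc.2 ⟨le_rfl, by omega⟩)

/-- Limits of ordered solutions are ordered solutions, and the equality of the two largest moduli
passes to the limit. -/
lemma isClosed_Gamma1 (hm : 3 ≤ m) (hc : c (m - 2) ≠ 0) : IsClosed (Gamma1 m c) := by
  rw [isClosed_iff_ultrafilter]
  intro x g hg hmem
  have : ∀ y : ℂ, ∃ z, y ∈ Gamma1 m c → IsOrderedSolutions m c y z ∧ ‖z 1‖ = ‖z 2‖ := by
    intro y
    by_cases hy : y ∈ Gamma1 m c
    · obtain ⟨z, hz⟩ := hy; exact ⟨z, fun _ => hz⟩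
    · exact ⟨0, fun h => absurd h hy⟩
  choose ζ hζ using this
  obtain ⟨z, hz, hz'⟩ := exists_tendsto_isOrderedSolutions (l := g) (ξ := id) (ζ := ζ)
    (C := fun _ => c) hm
    (fun j hj => tendsto_const_nhds) hg (Eventually.of_forall fun _ => hc)
    (by filter_upwards [hmem] with y hy using (hζ y hy).1)
  refine ⟨z, hz, ?_⟩
  refine tendsto_nhds_unique (hz' 1 (Finset.mem_Icc.2 ⟨le_rfl, by omega⟩)).norm ?_
  refine (hz' 2 (Finset.mem_Icc.2 ⟨by omega, by omega⟩)).norm.congr' ?_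
  filter_upwards [hmem] with y hy using (hζ y hy).2.symm

/-- On compact sets away from `Γ₁` the second solution is uniformly dominated by the first. -/
lemma exists_uniform_ratio (hm : 3 ≤ m) (hc : c (m - 2) ≠ 0) {K : Set ℂ} (hK : IsCompact K)
    (hd : ∀ x ∈ K, x ∉ Gamma1 m c) :
    ∃ θ : ℝ, 0 ≤ θ ∧ θ < 1 ∧ ∀ x ∈ K, ∀ z, IsOrderedSolutions m c x z → ‖z 2‖ ≤ θ * ‖z 1‖ := by
  by_contra! hcon
  -- If these constants all fail, a limit point of the counterexamples in `K` has equal top moduli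
  -- and so lies on Γ₁.
  have h1 : ∀ n : ℕ, (0 : ℝ) ≤ 1 - 1 / (n + 1) ∧ (1 : ℝ) - 1 / (n + 1) < 1 := fun n => by
    have : (0 : ℝ) < 1 / (n + 1) := by positivity
    have h2 : (1 : ℝ) / (n + 1) ≤ 1 := by
      rw [div_le_one (by positivity)]; have := (Nat.cast_nonneg n : (0 : ℝ) ≤ n); linarith
    constructor <;> linarith
  choose ξ hξ ζ hζ hlt using fun n : ℕ => hcon _ (h1 n).1 (h1 n).2
  let g : Ultrafilter ℕ := Ultrafilter.of atTop
  obtain ⟨x, hxK, hx⟩ := hK.ultrafilter_le_nhds (g.map ξ)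
    (le_principal_iff.2 (Eventually.of_forall hξ : ∀ᶠ n in (g : Filter ℕ), ξ n ∈ K))
  obtain ⟨z, hz, hz'⟩ := exists_tendsto_isOrderedSolutions (l := g) (ξ := ξ) (ζ := ζ)
    (C := fun _ => c) hm
    (fun j hj => tendsto_const_nhds) hx (Eventually.of_forall fun _ => hc) (Eventually.of_forall hζ)
  have h3 := norm_lt_of_notMem_Gamma1 hm (hd x hxK) hz
  have h4 : Tendsto (fun n : ℕ => (1 - 1 / ((n : ℝ) + 1)) * ‖ζ n 1‖) g (𝓝 ((1 - 0) * ‖z 1‖)) :=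
    ((tendsto_one_div_add_atTop_nhds_zero_nat.const_sub 1).mono_left (Ultrafilter.of_le _)).mul
      (hz' 1 (Finset.mem_Icc.2 ⟨le_rfl, by omega⟩)).norm
  have h5 := le_of_tendsto_of_tendsto h4 (hz' 2 (Finset.mem_Icc.2 ⟨by omega, by omega⟩)).norm
    (Eventually.of_forall fun n => (hlt n).le)
  linarith

lemma symbolA_conj (w : ℂ) : symbolA m c (conj w) = conj (symbolA m c w) := by
  simp [symbolA]

lemma IsOrderedSolutions.conj {z : ℕ → ℂ} (hz : IsOrderedSolutions m c x z) :
    IsOrderedSolutions m c (conj x) (fun j => conj (z j)) := by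
  refine ⟨fun w hw => ?_, fun i hi j hj hij => by simpa using hz.2 hi hj hij⟩
  have h := congrArg conj (hz.1 (conj w) (by simpa using hw))
  simpa [symbolA_conj] using h

lemma conj_notMem_Gamma1 (hx : x ∉ Gamma1 m c) : conj x ∉ Gamma1 m c := by
  rintro ⟨z, hz, h⟩
  exact hx ⟨_, by simpa using hz.conj, by simpa using h⟩

lemma z1_conj (hm : 3 ≤ m) (hc : c (m - 2) ≠ 0) (hx : x ∉ Gamma1 m c) :
    z1 m c (conj x) = conj (z1 m c x) := by
  obtain ⟨z, hz, h1⟩ := z1_spec hm c x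
  rw [← h1, ← hz.conj.eq_z1 hm hc (conj_notMem_Gamma1 hx)]

/-- The derivative of the symbol. -/
noncomputable def symbolDeriv (m : ℕ) (c : ℕ → ℝ) (w : ℂ) : ℂ :=
  1 - ∑ j ∈ Finset.range (m - 1), (c j : ℂ) * j / w ^ (j + 1)

lemma hasStrictDerivAt_symbolA {w : ℂ} (hw : w ≠ 0) :
    HasStrictDerivAt (symbolA m c) (symbolDeriv m c w) w := by
  have h : ∀ j ∈ Finset.range (m - 1), HasStrictDerivAt (fun w : ℂ => (c j : ℂ) / w ^ j)
      (-((c j : ℂ) * j / w ^ (j + 1))) w := by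
    intro j _
    have h1 := ((hasStrictDerivAt_inv (pow_ne_zero j hw)).comp w
      (hasStrictDerivAt_pow j w)).const_mul (c j : ℂ)
    have h2 : HasStrictDerivAt (fun w : ℂ => (c j : ℂ) * (w ^ j)⁻¹)
        ((c j : ℂ) * (-((w ^ j) ^ 2)⁻¹ * (j * w ^ (j - 1)))) w := h1
    simp only [div_eq_mul_inv]
    refine h2.congr_deriv ?_
    rcases j with _ | j
    · simp
    · simp only [Nat.add_sub_cancel]; field_simp; ring
  have h2 := (hasStrictDerivAt_id w).add (HasStrictDerivAt.fun_sum h)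
  refine h2.congr_deriv ?_
  rw [symbolDeriv, Finset.sum_neg_distrib]; ring

lemma symbolDeriv_conj (w : ℂ) : symbolDeriv m c (conj w) = conj (symbolDeriv m c w) := by
  simp [symbolDeriv]

lemma continuousAt_symbolDeriv {w : ℂ} (hw : w ≠ 0) : ContinuousAt (symbolDeriv m c) w := by
  unfold symbolDeriv
  refine ContinuousAt.sub continuousAt_const (tendsto_finsetSum _ fun j _ => ?_)
  exact ContinuousAt.div continuousAt_const (by fun_prop) (pow_ne_zero _ hw)

/-- Both sides of the factorization are differentiated at a point where A(w) - x and the factor w -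
z₁ vanish. Consequently A'(z₁) = 0 forces z₁ to be a repeated solution, which is impossible off Γ₁.
-/
lemma IsOrderedSolutions.symbolDeriv_mul (hm : 3 ≤ m) (hc : c (m - 2) ≠ 0) {z : ℕ → ℂ}
    (hz : IsOrderedSolutions m c x z) :
    z 1 ^ (m - 2) * symbolDeriv m c (z 1) = ∏ j ∈ Finset.Icc 2 (m - 1), (z 1 - z j) := by
  have h1 : 1 ∈ Finset.Icc 1 (m - 1) := Finset.mem_Icc.2 ⟨le_rfl, by omega⟩
  have h0 := hz.ne_zero hm hc h1
  have hs := hz.symbolA_eq hm hc h1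
  have hd1 : HasDerivAt (fun w => w ^ (m - 2) * (symbolA m c w - x))
      (z 1 ^ (m - 2) * symbolDeriv m c (z 1)) (z 1) := by
    have := (hasDerivAt_pow (m - 2) (z 1)).mul
      ((hasStrictDerivAt_symbolA (m := m) (c := c) h0).hasDerivAt.sub_const x)
    simpa [hs] using! this
  have hd2 : HasDerivAt (fun w => (w - z 1) * ∏ j ∈ Finset.Icc 2 (m - 1), (w - z j))
      (∏ j ∈ Finset.Icc 2 (m - 1), (z 1 - z j)) (z 1) := by
    have hd : DifferentiableAt ℂ (fun w => ∏ j ∈ Finset.Icc 2 (m - 1), (w - z j)) (z 1) := by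
      fun_prop
    have := ((hasDerivAt_id (z 1)).sub_const (z 1)).mul hd.hasDerivAt
    simpa using! this
  refine hd1.unique (hd2.congr_of_eventuallyEq ?_)
  filter_upwards [isOpen_ne.mem_nhds h0] with w hw
  rw [hz.1 w hw, ← Finset.mul_prod_erase _ _ h1]
  congr 2
  ext j; simp only [Finset.mem_erase, Finset.mem_Icc]; omega

lemma symbolDeriv_z1_ne_zero (hm : 3 ≤ m) (hc : c (m - 2) ≠ 0) (hx : x ∉ Gamma1 m c) :
    symbolDeriv m c (z1 m c x) ≠ 0 := by
  obtain ⟨z, hz, h1⟩ := z1_spec hm c x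
  intro h
  have h2 := hz.symbolDeriv_mul hm hc
  rw [h1, h, mul_zero, ← h1] at h2
  obtain ⟨j, hj, h3⟩ := Finset.prod_eq_zero_iff.1 h2.symm
  have hj' := Finset.mem_Icc.1 hj
  have h4 : ‖z j‖ ≤ ‖z 2‖ := hz.2 ⟨by omega, by omega⟩ ⟨by omega, hj'.2⟩ hj'.1
  have h5 := norm_lt_of_notMem_Gamma1 hm hx hz
  rw [sub_eq_zero.1 h3] at h5
  linarith

/-- A right inverse of the symbol that is continuous at x is differentiable there once A' does not
vanish at its value. -/
lemma hasDerivAt_z1 (hm : 3 ≤ m) (hc : c (m - 2) ≠ 0) (hx : x ∉ Gamma1 m c) :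
    HasDerivAt (z1 m c) (symbolDeriv m c (z1 m c x))⁻¹ x :=
  HasDerivAt.of_local_left_inverse
    (tendsto_z1 hm hc hx (C := fun _ => c) (fun _ _ => tendsto_const_nhds) tendsto_id)
    (hasStrictDerivAt_symbolA (z1_ne_zero hm hc x)).hasDerivAt
    (symbolDeriv_z1_ne_zero hm hc hx) (Eventually.of_forall fun y => symbolA_z1 hm hc y)

end Roots

/-! ### The dominant solution for large x -/

lemma norm_pow_sub_pow_le_of_norm_le_one {a b : ℂ} (ha : ‖a‖ ≤ 1) (hb : ‖b‖ ≤ 1) (j : ℕ) :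
    ‖a ^ j - b ^ j‖ ≤ j * ‖a - b‖ := by
  induction j with
  | zero => simp
  | succ k ih =>
    have h : a ^ (k + 1) - b ^ (k + 1) = (a ^ k - b ^ k) * a + b ^ k * (a - b) := by ring
    rw [h]
    have h1 : ‖(a ^ k - b ^ k) * a‖ ≤ k * ‖a - b‖ := by
      rw [norm_mul]
      exact (mul_le_of_le_one_right (norm_nonneg _) ha).trans ih
    have h2 : ‖b ^ k * (a - b)‖ ≤ ‖a - b‖ := by
      rw [norm_mul, norm_pow]
      exact mul_le_of_le_one_left (norm_nonneg _) (pow_le_one₀ (norm_nonneg _) hb)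
    push_cast
    linarith [norm_add_le ((a ^ k - b ^ k) * a) (b ^ k * (a - b))]

section LargeArgument

variable {m : ℕ} {c : ℕ → ℝ} {x : ℂ} {B ρ : ℝ}

lemma sum_range_pred_le (hB0 : 0 ≤ B) {f : ℕ → ℝ} (hf : ∀ j < m - 1, f j ≤ B) :
    ∑ j ∈ Finset.range (m - 1), f j ≤ m * B := by
  refine (Finset.sum_le_card_nsmul _ _ B fun j hj => hf j (Finset.mem_range.1 hj)).trans ?_
  rw [Finset.card_range, nsmul_eq_mul]
  exact mul_le_mul_of_nonneg_right (by exact_mod_cast Nat.sub_le _ _) hB0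

lemma norm_sum_div_pow_le (hB0 : 0 ≤ B) (hB : ∀ j < m - 1, |c j| ≤ B) {w : ℂ} (hw : 1 ≤ ‖w‖) :
    ‖∑ j ∈ Finset.range (m - 1), (c j : ℂ) / w ^ j‖ ≤ m * B := by
  refine (norm_sum_le _ _).trans (sum_range_pred_le hB0 fun j hj => ?_)
  rw [norm_div, norm_pow, Complex.norm_real, Real.norm_eq_abs]
  exact (div_le_self (abs_nonneg _) (one_le_pow₀ hw)).trans (hB j hj)

/-- Where both arguments have modulus at least ρ, the map w ↦ A(w) - w is Lipschitz with constant
m²B/ρ ≤ 1/2, so A is injective there. -/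
lemma eq_of_symbolA_eq_of_large (hB0 : 0 ≤ B) (hB : ∀ j < m - 1, |c j| ≤ B) (hρ1 : 1 ≤ ρ)
    (hρ : 2 * B * m ^ 2 ≤ ρ) {v w : ℂ} (hv : ρ ≤ ‖v‖) (hw : ρ ≤ ‖w‖)
    (h : symbolA m c v = symbolA m c w) : v = w := by
  have hρ0 : 0 < ρ := by linarith
  have hv0 : v ≠ 0 := norm_pos_iff.1 (by linarith)
  have hw0 : w ≠ 0 := norm_pos_iff.1 (by linarith)
  have hinv : ∀ u : ℂ, ρ ≤ ‖u‖ → ‖u⁻¹‖ ≤ ρ⁻¹ := fun u hu => by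
    rw [norm_inv]; exact inv_anti₀ hρ0 hu
  have hle1 : ρ⁻¹ ≤ 1 := inv_le_one_of_one_le₀ hρ1
  have hd : ‖w⁻¹ - v⁻¹‖ ≤ ρ⁻¹ * ‖v - w‖ := by
    have : w⁻¹ - v⁻¹ = w⁻¹ * v⁻¹ * (v - w) := by field_simp
    rw [this, norm_mul, norm_mul]
    refine mul_le_mul_of_nonneg_right ?_ (norm_nonneg _)
    calc ‖w⁻¹‖ * ‖v⁻¹‖ ≤ ρ⁻¹ * 1 := mul_le_mul (hinv w hw) ((hinv v hv).trans hle1)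
          (norm_nonneg _) (by positivity)
      _ = ρ⁻¹ := mul_one _
  have h1 : v - w = ∑ j ∈ Finset.range (m - 1), (c j : ℂ) * ((w⁻¹) ^ j - (v⁻¹) ^ j) := by
    simp only [symbolA, div_eq_mul_inv, ← inv_pow] at h
    simp only [mul_sub, Finset.sum_sub_distrib]
    linear_combination h
  have h2 : ‖v - w‖ ≤ m * (B * (m * (ρ⁻¹ * ‖v - w‖))) := by
    conv_lhs => rw [h1]
    refine (norm_sum_le _ _).trans (sum_range_pred_le (by positivity) fun j hj => ?_)
    rw [norm_mul, Complex.norm_real, Real.norm_eq_abs]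
    refine mul_le_mul (hB j hj) ?_ (norm_nonneg _) hB0
    refine (norm_pow_sub_pow_le_of_norm_le_one ((hinv w hw).trans hle1)
      ((hinv v hv).trans hle1) j).trans ?_
    refine mul_le_mul ?_ hd (norm_nonneg _) (by positivity)
    exact_mod_cast (by omega : j ≤ m)
  have h3 : 2 * ‖v - w‖ ≤ ‖v - w‖ := by
    calc 2 * ‖v - w‖ ≤ 2 * (m * (B * (m * (ρ⁻¹ * ‖v - w‖)))) := by linarith
      _ = (2 * B * m ^ 2) * ρ⁻¹ * ‖v - w‖ := by ring
      _ ≤ ρ * ρ⁻¹ * ‖v - w‖ := by gcongr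
      _ = ‖v - w‖ := by rw [mul_inv_cancel₀ hρ0.ne', one_mul]
  have h4 : ‖v - w‖ = 0 := le_antisymm (by linarith) (norm_nonneg _)
  exact sub_eq_zero.1 (norm_eq_zero.1 h4)

lemma symbolDeriv_ne_zero_of_large (hB0 : 0 ≤ B) (hB : ∀ j < m - 1, |c j| ≤ B) (hρ1 : 1 ≤ ρ)
    (hρ : 2 * B * m ^ 2 ≤ ρ) {w : ℂ} (hw : ρ ≤ ‖w‖) : symbolDeriv m c w ≠ 0 := by
  have hρ0 : 0 < ρ := by linarith
  intro h
  have h1 : (1 : ℂ) = ∑ j ∈ Finset.range (m - 1), (c j : ℂ) * j / w ^ (j + 1) := by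
    rw [symbolDeriv] at h; linear_combination h
  have h2 : (1 : ℝ) ≤ m * (B * m * ρ⁻¹) := by
    calc (1 : ℝ) = ‖(1 : ℂ)‖ := by simp
      _ = ‖∑ j ∈ Finset.range (m - 1), (c j : ℂ) * j / w ^ (j + 1)‖ := by rw [h1]
      _ ≤ _ := by
        refine (norm_sum_le _ _).trans (sum_range_pred_le (by positivity) fun j hj => ?_)
        rw [norm_div, norm_mul, norm_pow, Complex.norm_real, Real.norm_eq_abs, Complex.norm_natCast,
          div_eq_mul_inv]
        refine mul_le_mul (mul_le_mul (hB j hj) ?_ (by positivity) hB0) ?_ (by positivity)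
          (by positivity)
        · exact_mod_cast (by omega : j ≤ m)
        · refine inv_anti₀ hρ0 (hw.trans ?_)
          exact le_self_pow₀ (hρ1.trans hw) (by omega)
  have h3 : (2 : ℝ) ≤ 1 := by
    calc (2 : ℝ) ≤ 2 * (m * (B * m * ρ⁻¹)) := by linarith
      _ = (2 * B * m ^ 2) * ρ⁻¹ := by ring
      _ ≤ ρ * ρ⁻¹ := by gcongr
      _ = 1 := mul_inv_cancel₀ hρ0.ne'
  linarith

/-- Outside the disc of this radius, the equation `A z = x` has exactly one solution of
absolute value at least `ρ`. -/
noncomputable def dominanceRadius (m : ℕ) (B ρ : ℝ) : ℝ := (2 * ρ) ^ (m - 1) + ρ + m * B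

/-- Were all solutions smaller than ρ, the factorization at w = ρ would bound |A(ρ) - x| by
(2ρ)^(m-1), while |A(ρ)| ≤ ρ + mB. This is the origin of `dominanceRadius`. -/
lemma le_norm_z1_of_large (hm : 3 ≤ m) (hB0 : 0 ≤ B) (hB : ∀ j < m - 1, |c j| ≤ B) (hρ1 : 1 ≤ ρ)
    (hx : dominanceRadius m B ρ < ‖x‖) : ρ ≤ ‖z1 m c x‖ := by
  by_contra! hlt
  obtain ⟨z, hz, h1⟩ := z1_spec hm c x
  have hρ0 : (ρ : ℂ) ≠ 0 := by exact_mod_cast (by linarith : ρ ≠ 0)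
  have hn : ‖(ρ : ℂ)‖ = ρ := by rw [Complex.norm_real, Real.norm_eq_abs, abs_of_nonneg (by linarith)]
  have h2 := congrArg norm (hz.1 ρ hρ0)
  rw [norm_mul, norm_pow, hn, norm_prod] at h2
  have h3 : ∏ j ∈ Finset.Icc 1 (m - 1), ‖(ρ : ℂ) - z j‖ ≤ (2 * ρ) ^ (m - 1) := by
    refine (Finset.prod_le_prod (g := fun _ => 2 * ρ) (fun _ _ => norm_nonneg _)
      fun j hj => ?_).trans (by simp)
    refine (norm_sub_le _ _).trans ?_
    have := hz.norm_le hj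
    rw [hn]; rw [h1] at this; linarith
  have h4 : ‖symbolA m c ρ - x‖ ≤ (2 * ρ) ^ (m - 1) := by
    refine le_trans ?_ (h2.trans_le h3)
    exact le_mul_of_one_le_left (norm_nonneg _) (one_le_pow₀ hρ1)
  have h5 : ‖symbolA m c ρ‖ ≤ ρ + m * B := by
    refine (norm_add_le _ _).trans ?_
    rw [hn]
    have := norm_sum_div_pow_le hB0 hB (w := ρ) (by rw [hn]; exact hρ1)
    linarith
  have h6 := norm_sub_norm_le x (symbolA m c ρ)
  rw [norm_sub_rev] at h6
  rw [dominanceRadius] at hx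
  linarith

/-- Two solutions of equal largest modulus would both lie where A is injective, hence coincide; a
double solution contradicts A' ≠ 0 there. -/
lemma notMem_Gamma1_of_large (hm : 3 ≤ m) (hc : c (m - 2) ≠ 0) (hB0 : 0 ≤ B)
    (hB : ∀ j < m - 1, |c j| ≤ B)
    (hρ1 : 1 ≤ ρ) (hρ : 2 * B * m ^ 2 ≤ ρ) (hx : dominanceRadius m B ρ < ‖x‖) :
    x ∉ Gamma1 m c := by
  rintro ⟨z, hz, h12⟩
  have h1 : 1 ∈ Finset.Icc 1 (m - 1) := Finset.mem_Icc.2 ⟨le_rfl, by omega⟩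
  have h2 : 2 ∈ Finset.Icc 1 (m - 1) := Finset.mem_Icc.2 ⟨by omega, by omega⟩
  have hle : ρ ≤ ‖z 1‖ := by
    refine (le_norm_z1_of_large hm hB0 hB hρ1 hx).trans ?_
    obtain ⟨j, hj, h⟩ := (hz.symbolA_eq_iff (z1_ne_zero hm hc x)).1 (symbolA_z1 hm hc x)
    rw [h]; exact hz.norm_le hj
  have heq : z 1 = z 2 := eq_of_symbolA_eq_of_large hB0 hB hρ1 hρ hle (h12 ▸ hle)
    ((hz.symbolA_eq hm hc h1).trans (hz.symbolA_eq hm hc h2).symm)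
  have h3 := hz.symbolDeriv_mul hm hc
  rw [Finset.prod_eq_zero (i := 2) (Finset.mem_Icc.2 ⟨le_rfl, by omega⟩) (sub_eq_zero.2 heq)] at h3
  rcases mul_eq_zero.1 h3 with h4 | h4
  · exact hz.ne_zero hm hc h1 (pow_eq_zero_iff (by omega) |>.1 h4)
  · exact symbolDeriv_ne_zero_of_large hB0 hB hρ1 hρ hle h4

lemma norm_z1_sub_le (hm : 3 ≤ m) (hc : c (m - 2) ≠ 0) (hB0 : 0 ≤ B)
    (hB : ∀ j < m - 1, |c j| ≤ B) (h : 1 ≤ ‖z1 m c x‖) : ‖z1 m c x - x‖ ≤ m * B := by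
  have h1 : z1 m c x - x = -∑ j ∈ Finset.range (m - 1), (c j : ℂ) / z1 m c x ^ j := by
    have h0 := symbolA_z1 hm hc x
    rw [symbolA] at h0
    linear_combination h0
  rw [h1, norm_neg]
  exact norm_sum_div_pow_le hB0 hB h

lemma exists_coeff_bound (m : ℕ) (c : ℕ → ℝ) :
    ∃ B ρ : ℝ, 0 ≤ B ∧ (∀ j < m - 1, |c j| ≤ B) ∧ 1 ≤ ρ ∧ 2 * B * m ^ 2 ≤ ρ := by
  refine ⟨∑ j ∈ Finset.range (m - 1), |c j|, 1 + 2 * (∑ j ∈ Finset.range (m - 1), |c j|) * m ^ 2,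
    Finset.sum_nonneg fun _ _ => abs_nonneg _, fun j hj => ?_, ?_, by linarith⟩
  · exact Finset.single_le_sum (f := fun j => |c j|) (fun _ _ => abs_nonneg _)
      (Finset.mem_range.2 hj)
  · have : 0 ≤ ∑ j ∈ Finset.range (m - 1), |c j| := Finset.sum_nonneg fun _ _ => abs_nonneg _
    have := mul_nonneg this (sq_nonneg (m : ℝ))
    linarith

/-- Outside a large disc, the dominant solution is unique and close to `x`. -/
lemma exists_radius (hm : 3 ≤ m) (hc : c (m - 2) ≠ 0) :
    ∃ R D : ℝ, 0 < R ∧ 0 ≤ D ∧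
      ∀ x : ℂ, R < ‖x‖ → x ∉ Gamma1 m c ∧ ‖z1 m c x - x‖ ≤ D := by
  obtain ⟨B, ρ, hB0, hB, hρ1, hρ⟩ := exists_coeff_bound m c
  refine ⟨dominanceRadius m B ρ, m * B, ?_, by positivity, fun x hx =>
    ⟨notMem_Gamma1_of_large hm hc hB0 hB hρ1 hρ hx, norm_z1_sub_le hm hc hB0 hB
      (hρ1.trans (le_norm_z1_of_large hm hB0 hB hρ1 hx))⟩⟩
  have : 0 < (2 * ρ) ^ (m - 1) := by positivity
  have : 0 ≤ m * B := by positivity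
  unfold dominanceRadius; linarith

end LargeArgument

/-- The function w A'(w) is itself a symbol, with coefficients -j c_j, so its zeros are roots of a
monic polynomial. -/
lemma finite_setOf_symbolDeriv_eq_zero {m : ℕ} (hm : 3 ≤ m) (c : ℕ → ℝ) :
    {w : ℂ | w ≠ 0 ∧ symbolDeriv m c w = 0}.Finite := by
  have h := (monic_symbolPoly hm (fun j => -(j * c j)) 0).ne_zero
  refine (symbolPoly m (fun j => -(j * c j)) 0).rootSet_finite ℂ |>.subset ?_
  rintro w ⟨hw, h0⟩
  rw [mem_rootSet]
  refine ⟨h, ?_⟩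
  have h1 : symbolA m (fun j => -(j * c j)) w = w * symbolDeriv m c w := by
    rw [symbolA, symbolDeriv, mul_sub, mul_one, Finset.mul_sum, sub_eq_add_neg,
      ← Finset.sum_neg_distrib]
    congr 1
    refine Finset.sum_congr rfl fun j _ => ?_
    push_cast
    field_simp
    ring
  rw [coe_aeval_eq_eval, eval_symbolPoly hm _ _ hw, h1, h0]
  simp

/-! ### The dominant solution on the closed upper half plane -/

/-- The open upper half plane as a subset of `ℂ`. -/
def upperHalf : Set ℂ := {w | 0 < w.im}

/-- The closed upper half plane as a subset of `ℂ`. -/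
def closedUpperHalf : Set ℂ := {w | 0 ≤ w.im}

lemma isOpen_upperHalf : IsOpen upperHalf := isOpen_lt continuous_const Complex.continuous_im

lemma convex_upperHalf : Convex ℝ upperHalf := convex_halfSpace_im_gt 0

lemma upperHalf_subset : upperHalf ⊆ closedUpperHalf :=
  fun w (h : 0 < w.im) => show 0 ≤ w.im from h.le

lemma ofReal_mem_closedUpperHalf (t : ℝ) : (t : ℂ) ∈ closedUpperHalf := by
  simp [closedUpperHalf]

lemma closedUpperHalf_subset_closure : closedUpperHalf ⊆ closure upperHalf := by
  rw [show closure upperHalf = {w : ℂ | 0 ≤ w.im} from Complex.closure_setOfPred_lt_im 0]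
  exact subset_rfl

section HalfPlane

variable {m : ℕ} {c : ℕ → ℝ}

lemma symbolA_ofReal_im (r : ℝ) : (symbolA m c r).im = 0 := by
  have h := symbolA_conj (m := m) (c := c) (r : ℂ)
  rw [Complex.conj_ofReal] at h
  exact Complex.conj_eq_iff_im.1 h.symm

lemma notMem_Gamma1_of_im_ne_zero (hΓ : ∀ w ∈ Gamma1 m c, w.im = 0) {x : ℂ} (hx : x.im ≠ 0) :
    x ∉ Gamma1 m c := fun h => hx (hΓ x h)

lemma notMem_Gamma1_of_mem_upperHalf (hΓ : ∀ w ∈ Gamma1 m c, w.im = 0) {x : ℂ}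
    (hx : x ∈ upperHalf) : x ∉ Gamma1 m c := notMem_Gamma1_of_im_ne_zero hΓ (ne_of_gt hx)

lemma continuousOn_z1 (hm : 3 ≤ m) (hc : c (m - 2) ≠ 0) (hΓ : ∀ w ∈ Gamma1 m c, w.im = 0) :
    ContinuousOn (z1 m c) upperHalf := fun _ hx =>
  (hasDerivAt_z1 hm hc (notMem_Gamma1_of_mem_upperHalf hΓ hx)).continuousAt.continuousWithinAt

/-- The dominant solution maps the upper half plane to itself. -/
lemma z1_mem_upperHalf (hm : 3 ≤ m) (hc : c (m - 2) ≠ 0) (hΓ : ∀ w ∈ Gamma1 m c, w.im = 0)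
    {x : ℂ} (hx : x ∈ upperHalf) : z1 m c x ∈ upperHalf := by
  by_contra hneg
  have hneg' : (z1 m c x).im ≤ 0 := not_lt.1 hneg
  obtain ⟨R, D, hR, hD, hlarge⟩ := exists_radius hm hc
  -- A comparison point so high that |z₁(y) - y| ≤ D forces a positive imaginary part.
  set y : ℂ := ((R + D + 1 : ℝ) : ℂ) * Complex.I with hy
  have hyim : y.im = R + D + 1 := by simp [hy]
  have hyH : y ∈ upperHalf := by
    change 0 < y.im; rw [hyim]; linarith
  have hyn : R < ‖y‖ := by
    refine lt_of_lt_of_le ?_ (Complex.abs_im_le_norm y)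
    rw [hyim, abs_of_pos (by linarith)]; linarith
  have hpos : 0 ≤ (z1 m c y).im := by
    have h1 := Complex.abs_im_le_norm (z1 m c y - y)
    have h2 := (hlarge y hyn).2
    rw [Complex.sub_im, hyim] at h1
    have := (abs_le.1 (h1.trans h2)).1
    linarith
  -- The half plane is connected, so otherwise z₁ would be real at some w, and then w = A(z₁(w))
  -- would be real too.
  obtain ⟨w, hw, hw0⟩ := convex_upperHalf.isPreconnected.intermediate_value hx hyH
    (Complex.continuous_im.comp_continuousOn (continuousOn_z1 hm hc hΓ)) ⟨hneg', hpos⟩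
  have h3 : z1 m c w = ((z1 m c w).re : ℂ) := Complex.ext (by simp) (by simpa using hw0)
  have h4 := symbolA_z1 hm hc w
  rw [h3] at h4
  have h5 := symbolA_ofReal_im (m := m) (c := c) (z1 m c w).re
  rw [h4] at h5
  exact (ne_of_gt hw) h5

/-- The dominant solution has a limit at each point of the closed upper half plane. -/
lemma exists_tendsto_z1 (hm : 3 ≤ m) (hc : c (m - 2) ≠ 0) (hΓ : ∀ w ∈ Gamma1 m c, w.im = 0)
    {x : ℂ} (hx : x ∈ closedUpperHalf) :
    ∃ z, IsOrderedSolutions m c x z ∧ Tendsto (z1 m c) (𝓝[upperHalf] x) (𝓝 (z 1)) := by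
  classical
  choose ζ hζ hζ1 using fun y => z1_spec hm c y
  have h1mem : 1 ∈ Finset.Icc 1 (m - 1) := Finset.mem_Icc.2 ⟨le_rfl, by omega⟩
  have hlim : ∀ g : Ultrafilter ℂ, ↑g ≤ 𝓝[upperHalf] x →
      ∃ z, IsOrderedSolutions m c x z ∧ Tendsto (z1 m c) g (𝓝 (z 1)) := by
    intro g hg
    obtain ⟨z, hz, hz'⟩ := exists_tendsto_isOrderedSolutions (l := g) (ξ := id) (ζ := ζ)
      (C := fun _ => c) hm (fun j hj => tendsto_const_nhds) (hg.trans nhdsWithin_le_nhds)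
      (Eventually.of_forall fun _ => hc) (Eventually.of_forall hζ)
    refine ⟨z, hz, ?_⟩
    have := hz' 1 h1mem
    simpa only [hζ1] using this
  set F : Set ℂ := {w | w ≠ 0 ∧ symbolA m c w = x} with hF
  have hFfin : F.Finite := by
    refine ((Finset.Icc 1 (m - 1)).image (ζ x)).finite_toSet.subset ?_
    rintro w ⟨hw0, hw⟩
    obtain ⟨j, hj, rfl⟩ := ((hζ x).symbolA_eq_iff hw0).1 hw
    exact Finset.mem_coe.2 (Finset.mem_image_of_mem _ hj)
  have hmemF : ∀ z, IsOrderedSolutions m c x z → z 1 ∈ F := fun z hz =>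
    ⟨hz.ne_zero hm hc h1mem, hz.symbolA_eq hm hc h1mem⟩
  -- Every cluster value of z₁ at x is one of finitely many solutions. Near x the values of z₁ lie
  -- in disjoint neighbourhoods of these, and the image of a half disc is connected, so a single
  -- neighbourhood contains them all.
  obtain ⟨U, hU, hdisj⟩ := hFfin.t2_separation
  have hev : ∀ᶠ y in 𝓝[upperHalf] x, z1 m c y ∈ ⋃ a ∈ F, U a := by
    refine mem_iff_ultrafilter.2 fun g hg => ?_
    obtain ⟨z, hz, hz'⟩ := hlim g hg
    refine hz' (((hU (z 1)).2.mem_nhds (hU (z 1)).1) |> fun h => mem_of_superset h ?_)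
    exact Set.subset_biUnion_of_mem (hmemF z hz)
  obtain ⟨ε, hε, hball⟩ := Metric.mem_nhdsWithin_iff.1 hev
  have hconn : IsPreconnected (z1 m c '' (Metric.ball x ε ∩ upperHalf)) :=
    ((convex_ball x ε).inter convex_upperHalf).isPreconnected.image _
      ((continuousOn_z1 hm hc hΓ).mono Set.inter_subset_right)
  have hxcl : x ∈ closure upperHalf := closedUpperHalf_subset_closure hx
  obtain ⟨y, hyU, hyb⟩ := Metric.mem_closure_iff.1 hxcl ε hε
  have hyS : y ∈ Metric.ball x ε ∩ upperHalf := ⟨by rwa [Metric.mem_ball, dist_comm], hyU⟩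
  obtain ⟨a, haF, ha⟩ := Set.mem_iUnion₂.1 (hball hyS)
  have hsub : z1 m c '' (Metric.ball x ε ∩ upperHalf) ⊆ U a := by
    refine hconn.subset_left_of_subset_union (hU a).2
      (v := ⋃ b ∈ F \ {a}, U b) (isOpen_biUnion fun b _ => (hU b).2) ?_ ?_
      ⟨_, Set.mem_image_of_mem _ hyS, ha⟩
    · rw [Set.disjoint_iUnion₂_right]
      exact fun b hb => hdisj haF hb.1 (fun h => hb.2 h.symm)
    · rintro _ ⟨w, hw, rfl⟩
      obtain ⟨b, hb, hwb⟩ := Set.mem_iUnion₂.1 (hball hw)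
      by_cases hba : b = a
      · left; rwa [← hba]
      · right; exact Set.mem_biUnion (show b ∈ F \ {a} from ⟨hb, hba⟩) hwb
  have hneb : (𝓝[upperHalf] x).NeBot := mem_closure_iff_nhdsWithin_neBot.1 hxcl
  have hident : ∀ g : Ultrafilter ℂ, ↑g ≤ 𝓝[upperHalf] x → ∀ z, IsOrderedSolutions m c x z →
      Tendsto (z1 m c) g (𝓝 (z 1)) → z 1 = a := by
    intro g hg z hz hz'
    by_contra hne
    have h1 : ∀ᶠ y in (g : Filter ℂ), z1 m c y ∈ U (z 1) :=
      hz' ((hU (z 1)).2.mem_nhds (hU (z 1)).1)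
    have h2 : ∀ᶠ y in (g : Filter ℂ), z1 m c y ∈ U a := by
      have : Metric.ball x ε ∩ upperHalf ∈ 𝓝[upperHalf] x :=
        Metric.mem_nhdsWithin_iff.2 ⟨ε, hε, subset_rfl⟩
      filter_upwards [hg this] with y hy using hsub (Set.mem_image_of_mem _ hy)
    obtain ⟨y, hy1, hy2⟩ := (h1.and h2).exists
    exact Set.disjoint_left.1 (hdisj (hmemF z hz) haF hne) hy1 hy2
  obtain ⟨z, hz, hz'⟩ := hlim (Ultrafilter.of (𝓝[upperHalf] x)) (Ultrafilter.of_le _)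
  have hza := hident _ (Ultrafilter.of_le _) z hz hz'
  refine ⟨z, hz, tendsto_iff_ultrafilter _ _ _ |>.2 fun g hg => ?_⟩
  obtain ⟨z', hz1, hz2⟩ := hlim g hg
  rw [hza, ← hident g hg z' hz1 hz2]
  exact hz2

/-- The continuous extension of the dominant solution to the closed upper half plane. -/
noncomputable def z1Ext (m : ℕ) (c : ℕ → ℝ) : ℂ → ℂ := extendFrom upperHalf (z1 m c)

lemma tendsto_z1Ext (hm : 3 ≤ m) (hc : c (m - 2) ≠ 0) (hΓ : ∀ w ∈ Gamma1 m c, w.im = 0)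
    {x : ℂ} (hx : x ∈ closedUpperHalf) :
    Tendsto (z1 m c) (𝓝[upperHalf] x) (𝓝 (z1Ext m c x)) := by
  obtain ⟨z, -, hz⟩ := exists_tendsto_z1 hm hc hΓ hx
  exact tendsto_extendFrom ⟨_, hz⟩

lemma exists_ordered_z1Ext (hm : 3 ≤ m) (hc : c (m - 2) ≠ 0) (hΓ : ∀ w ∈ Gamma1 m c, w.im = 0)
    {x : ℂ} (hx : x ∈ closedUpperHalf) :
    ∃ z, IsOrderedSolutions m c x z ∧ z 1 = z1Ext m c x := by
  obtain ⟨z, hz, hz'⟩ := exists_tendsto_z1 hm hc hΓ hx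
  have : (𝓝[upperHalf] x).NeBot :=
    mem_closure_iff_nhdsWithin_neBot.1 (closedUpperHalf_subset_closure hx)
  exact ⟨z, hz, tendsto_nhds_unique hz' (tendsto_z1Ext hm hc hΓ hx)⟩

lemma continuousOn_z1Ext (hm : 3 ≤ m) (hc : c (m - 2) ≠ 0) (hΓ : ∀ w ∈ Gamma1 m c, w.im = 0) :
    ContinuousOn (z1Ext m c) closedUpperHalf :=
  continuousOn_extendFrom closedUpperHalf_subset_closure fun _ hx =>
    ⟨_, tendsto_z1Ext hm hc hΓ hx⟩

/-- The extension agrees with the dominant solution off `Γ₁`. -/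
lemma z1Ext_eq_z1 (hm : 3 ≤ m) (hc : c (m - 2) ≠ 0) (hΓ : ∀ w ∈ Gamma1 m c, w.im = 0)
    {x : ℂ} (hx : x ∈ closedUpperHalf) (hx' : x ∉ Gamma1 m c) : z1Ext m c x = z1 m c x := by
  obtain ⟨z, hz, h⟩ := exists_ordered_z1Ext hm hc hΓ hx
  rw [← h, hz.eq_z1 hm hc hx']

lemma z1Ext_of_mem_upperHalf (hm : 3 ≤ m) (hc : c (m - 2) ≠ 0)
    (hΓ : ∀ w ∈ Gamma1 m c, w.im = 0) {x : ℂ} (hx : x ∈ upperHalf) : z1Ext m c x = z1 m c x :=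
  z1Ext_eq_z1 hm hc hΓ (upperHalf_subset hx) (notMem_Gamma1_of_mem_upperHalf hΓ hx)

lemma z1Ext_ne_zero (hm : 3 ≤ m) (hc : c (m - 2) ≠ 0) (hΓ : ∀ w ∈ Gamma1 m c, w.im = 0)
    {x : ℂ} (hx : x ∈ closedUpperHalf) : z1Ext m c x ≠ 0 := by
  obtain ⟨z, hz, h⟩ := exists_ordered_z1Ext hm hc hΓ hx
  rw [← h]; exact hz.ne_zero hm hc (Finset.mem_Icc.2 ⟨le_rfl, by omega⟩)

lemma symbolA_z1Ext (hm : 3 ≤ m) (hc : c (m - 2) ≠ 0) (hΓ : ∀ w ∈ Gamma1 m c, w.im = 0)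
    {x : ℂ} (hx : x ∈ closedUpperHalf) : symbolA m c (z1Ext m c x) = x := by
  obtain ⟨z, hz, h⟩ := exists_ordered_z1Ext hm hc hΓ hx
  rw [← h]; exact hz.symbolA_eq hm hc (Finset.mem_Icc.2 ⟨le_rfl, by omega⟩)

lemma z1Ext_mem_closedUpperHalf (hm : 3 ≤ m) (hc : c (m - 2) ≠ 0)
    (hΓ : ∀ w ∈ Gamma1 m c, w.im = 0) {x : ℂ} (hx : x ∈ closedUpperHalf) :
    z1Ext m c x ∈ closedUpperHalf := by
  have : (𝓝[upperHalf] x).NeBot :=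
    mem_closure_iff_nhdsWithin_neBot.1 (closedUpperHalf_subset_closure hx)
  refine ge_of_tendsto ((Complex.continuous_im.tendsto _).comp (tendsto_z1Ext hm hc hΓ hx)) ?_
  filter_upwards [self_mem_nhdsWithin] with y hy using (z1_mem_upperHalf hm hc hΓ hy).le

/-- Near a point that is not a branch point, the extension of the dominant solution is given by
a holomorphic inverse of the symbol. -/
lemma exists_local_branch (hm : 3 ≤ m) (hc : c (m - 2) ≠ 0) (hΓ : ∀ w ∈ Gamma1 m c, w.im = 0)
    {x : ℂ} (hx : x ∈ closedUpperHalf) (hd : symbolDeriv m c (z1Ext m c x) ≠ 0) :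
    ∃ g : ℂ → ℂ, HasStrictDerivAt g (symbolDeriv m c (z1Ext m c x))⁻¹ x ∧
      (∀ᶠ y in 𝓝 x, symbolA m c (g y) = y) ∧
      (∀ᶠ y in 𝓝[closedUpperHalf] x, g y = z1Ext m c y) := by
  set a := z1Ext m c x with ha
  have hA : symbolA m c a = x := symbolA_z1Ext hm hc hΓ hx
  have hs := hasStrictDerivAt_symbolA (m := m) (c := c) (z1Ext_ne_zero hm hc hΓ hx)
  have hs' := hs.hasStrictFDerivAt_equiv hd
  refine ⟨hs.localInverse _ _ _ hd, ?_, ?_, ?_⟩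
  · have := hs.to_localInverse hd
    rwa [hA] at this
  · have := hs'.eventually_right_inverse
    rwa [hA] at this
  · have h1 := hs'.eventually_left_inverse
    have h2 : Tendsto (z1Ext m c) (𝓝[closedUpperHalf] x) (𝓝 a) := continuousOn_z1Ext hm hc hΓ x hx
    filter_upwards [h2.eventually h1, self_mem_nhdsWithin] with y hy hyH
    rw [symbolA_z1Ext hm hc hΓ hyH] at hy
    exact hy

end HalfPlane

/-! ### The density of μ₁ through boundary values from above -/

section Density

variable {m : ℕ} {c : ℕ → ℝ}

/-- The logarithmic derivative `z₁' / z₁`, extended continuously to real points that are not branch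
points. -/
noncomputable def logDerivExt (m : ℕ) (c : ℕ → ℝ) (x : ℂ) : ℂ :=
  (symbolDeriv m c (z1Ext m c x))⁻¹ / z1Ext m c x

/-- The density of `μ₁` expressed through boundary values from the upper half plane. -/
noncomputable def realDensity (m : ℕ) (c : ℕ → ℝ) (t : ℝ) : ℝ :=
  -(logDerivExt m c t).im / Real.pi

lemma nonneg_of_hasDerivAt_of_nonneg_right {h : ℝ → ℝ} {h' : ℝ} (hd : HasDerivAt h h' 0)
    (h0 : h 0 = 0) (hpos : ∀ᶠ y in 𝓝[>] (0 : ℝ), 0 ≤ h y) : 0 ≤ h' := by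
  have h1 := (hasDerivAt_iff_tendsto_slope.1 hd).mono_left
    (nhdsWithin_mono 0 (fun y (hy : 0 < y) => (ne_of_gt hy : y ≠ 0)) : 𝓝[>] (0 : ℝ) ≤ 𝓝[≠] 0)
  refine ge_of_tendsto h1 ?_
  filter_upwards [hpos, self_mem_nhdsWithin] with y hy hy0
  rw [slope_def_field, h0, sub_zero, sub_zero]
  exact div_nonneg hy (le_of_lt hy0)

/-- A holomorphic function that is larger in modulus above the real axis than below has
nonpositive imaginary part of the logarithmic derivative. -/
lemma im_div_nonpos_of_norm_le {g : ℂ → ℂ} {g' : ℂ} {t : ℝ} (hg : HasDerivAt g g' t)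
    (h : ∀ᶠ y : ℝ in 𝓝[>] (0 : ℝ), ‖g (t - y * Complex.I)‖ ≤ ‖g (t + y * Complex.I)‖) :
    (g' / g t).im ≤ 0 := by
  -- The choices σ = 1 and σ = -1 give the upward and the downward vertical derivative of |g|².
  have key : ∀ σ : ℝ, HasDerivAt (fun y : ℝ => ‖g (t + σ * y * Complex.I)‖ ^ 2)
      (2 * (inner ℝ (g t) (g' * (σ * Complex.I)))) 0 := by
    intro σ
    have h1 : HasDerivAt (fun y : ℝ => (t : ℂ) + σ * y * Complex.I) (σ * Complex.I) 0 := by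
      have := (((Complex.ofRealCLM.hasDerivAt (x := (0:ℝ))).const_mul (σ : ℂ)).mul_const
        Complex.I).const_add (t : ℂ)
      simpa using this
    have h2 : HasDerivAt (fun y : ℝ => g (t + σ * y * Complex.I)) (g' * (σ * Complex.I)) 0 := by
      have hg0 : HasDerivAt g g' ((t : ℂ) + σ * (0 : ℝ) * Complex.I) := by simpa using hg
      exact hg0.comp (0 : ℝ) h1
    have := h2.norm_sq
    simpa using this
  have hd := (key 1).sub (key (-1))
  have h3 := nonneg_of_hasDerivAt_of_nonneg_right hd (by simp) (by
    filter_upwards [h] with y hy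
    have h4 : ‖g (t + (-1 : ℝ) * y * Complex.I)‖ ≤ ‖g (t + (1 : ℝ) * y * Complex.I)‖ := by
      convert hy using 3 <;> push_cast <;> ring
    simp only [Pi.sub_apply, sub_nonneg]
    gcongr)
  have h5 : (g' / g t).im = (g'.im * (g t).re - g'.re * (g t).im) / Complex.normSq (g t) := by
    rw [Complex.div_im]; ring
  rw [h5]
  refine div_nonpos_of_nonpos_of_nonneg ?_ (Complex.normSq_nonneg _)
  simp only [Complex.inner] at h3
  simp at h3
  nlinarith [h3]

/-- The local holomorphic branch equals z₁ above the axis. Below it, the branch is some solution,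
bounded in modulus by the dominant one, whose modulus is the same at the mirror point by conjugation
symmetry. -/
lemma logDerivExt_im_nonpos (hm : 3 ≤ m) (hc : c (m - 2) ≠ 0) (hΓ : ∀ w ∈ Gamma1 m c, w.im = 0)
    {t : ℝ} (hd : symbolDeriv m c (z1Ext m c t) ≠ 0) : (logDerivExt m c t).im ≤ 0 := by
  obtain ⟨g, hg, hA, hgz⟩ := exists_local_branch hm hc hΓ (ofReal_mem_closedUpperHalf t) hd
  have hgt : g t = z1Ext m c t := hgz.self_of_nhdsWithin (ofReal_mem_closedUpperHalf t)
  have hne : ∀ᶠ y in 𝓝 (t : ℂ), g y ≠ 0 := hg.hasDerivAt.continuousAt.eventually_ne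
    (by rw [hgt]; exact z1Ext_ne_zero hm hc hΓ (ofReal_mem_closedUpperHalf t))
  rw [logDerivExt, ← hgt]
  rw [← hgt] at hg
  refine im_div_nonpos_of_norm_le hg.hasDerivAt ?_
  have hlow : Tendsto (fun y : ℝ => (t : ℂ) - y * Complex.I) (𝓝[>] 0) (𝓝 t) := by
    have : Continuous fun y : ℝ => (t : ℂ) - y * Complex.I := by fun_prop
    simpa using (this.tendsto 0).mono_left nhdsWithin_le_nhds
  have hup : Tendsto (fun y : ℝ => (t : ℂ) + y * Complex.I) (𝓝[>] 0) (𝓝[closedUpperHalf] t) := by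
    refine tendsto_nhdsWithin_iff.2 ⟨?_, ?_⟩
    · have : Continuous fun y : ℝ => (t : ℂ) + y * Complex.I := by fun_prop
      simpa using (this.tendsto 0).mono_left nhdsWithin_le_nhds
    · filter_upwards [self_mem_nhdsWithin] with y hy
      have : (0 : ℝ) < y := hy
      simp [closedUpperHalf, this.le]
  filter_upwards [hlow.eventually hA, hlow.eventually hne, hup.eventually hgz,
    self_mem_nhdsWithin] with y h1 h2 h3 hy
  have hy' : (0 : ℝ) < y := hy
  have hmem : (t : ℂ) + y * Complex.I ∈ upperHalf := by simp [upperHalf, hy']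
  rw [h3, z1Ext_of_mem_upperHalf hm hc hΓ hmem]
  refine (norm_le_norm_z1 hm h2 h1).trans_eq ?_
  have h4 : (t : ℂ) - y * Complex.I = conj ((t : ℂ) + y * Complex.I) := by
    simp [sub_eq_add_neg]
  rw [h4, z1_conj hm hc (notMem_Gamma1_of_mem_upperHalf hΓ hmem), Complex.norm_conj]

/-- The real branch points form a finite set. -/
lemma finite_branchPoints (hm : 3 ≤ m) (hc : c (m - 2) ≠ 0) (hΓ : ∀ w ∈ Gamma1 m c, w.im = 0) :
    {t : ℝ | symbolDeriv m c (z1Ext m c t) = 0}.Finite := by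
  refine (((finite_setOf_symbolDeriv_eq_zero hm c).image (symbolA m c)).preimage
    (f := fun t : ℝ => (t : ℂ)) Complex.ofReal_injective.injOn).subset ?_
  intro t ht
  exact ⟨_, ⟨z1Ext_ne_zero hm hc hΓ (ofReal_mem_closedUpperHalf t), ht⟩,
    symbolA_z1Ext hm hc hΓ (ofReal_mem_closedUpperHalf t)⟩

lemma hasDerivAt_z1Ext_ofReal (hm : 3 ≤ m) (hc : c (m - 2) ≠ 0)
    (hΓ : ∀ w ∈ Gamma1 m c, w.im = 0) {t : ℝ} (hd : symbolDeriv m c (z1Ext m c t) ≠ 0) :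
    HasDerivAt (fun t : ℝ => z1Ext m c t) (symbolDeriv m c (z1Ext m c t))⁻¹ t := by
  obtain ⟨g, hg, -, hgz⟩ := exists_local_branch hm hc hΓ (ofReal_mem_closedUpperHalf t) hd
  refine hg.hasDerivAt.comp_ofReal.congr_of_eventuallyEq ?_
  have h1 : Tendsto (fun s : ℝ => (s : ℂ)) (𝓝 t) (𝓝[closedUpperHalf] t) :=
    tendsto_nhdsWithin_iff.2 ⟨Complex.continuous_ofReal.tendsto t,
      Eventually.of_forall ofReal_mem_closedUpperHalf⟩
  filter_upwards [h1.eventually hgz] with s hs using hs.symm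

/-- Off `Γ₁` the extension is real at real points. -/
lemma z1Ext_ofReal_im_of_notMem (hm : 3 ≤ m) (hc : c (m - 2) ≠ 0)
    (hΓ : ∀ w ∈ Gamma1 m c, w.im = 0) {t : ℝ} (ht : (t : ℂ) ∉ Gamma1 m c) :
    conj (z1Ext m c t) = z1Ext m c t := by
  rw [z1Ext_eq_z1 hm hc hΓ (ofReal_mem_closedUpperHalf t) ht, ← z1_conj hm hc ht,
    Complex.conj_ofReal]

lemma realDensity_of_notMem (hm : 3 ≤ m) (hc : c (m - 2) ≠ 0)
    (hΓ : ∀ w ∈ Gamma1 m c, w.im = 0) {t : ℝ} (ht : (t : ℂ) ∉ Gamma1 m c) :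
    realDensity m c t = 0 := by
  have h := z1Ext_ofReal_im_of_notMem hm hc hΓ ht
  have h2 : conj (logDerivExt m c t) = logDerivExt m c t := by
    rw [logDerivExt, map_div₀, map_inv₀, ← symbolDeriv_conj, h]
  rw [realDensity, Complex.conj_eq_iff_im.1 h2]; simp

/-- The density in the definition of `μ₁` in terms of the values from the upper half plane. -/
lemma mu1Density_re (hm : 3 ≤ m) (hc : c (m - 2) ≠ 0) (hΓ : ∀ w ∈ Gamma1 m c, w.im = 0)
    {t : ℝ} (hd : symbolDeriv m c (z1Ext m c t) ≠ 0) :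
    (mu1Density m c t).re = realDensity m c t := by
  have htc := ofReal_mem_closedUpperHalf t
  have hz0 := z1Ext_ne_zero hm hc hΓ htc
  have hneb : (𝓝[{w : ℂ | 0 < w.im}] (t : ℂ)).NeBot :=
    mem_closure_iff_nhdsWithin_neBot.1 (closedUpperHalf_subset_closure htc)
  have hT : Tendsto (z1 m c) (𝓝[{w : ℂ | 0 < w.im}] (t : ℂ)) (𝓝 (z1Ext m c t)) :=
    tendsto_z1Ext hm hc hΓ htc
  have hT' : Tendsto (deriv (z1 m c)) (𝓝[{w : ℂ | 0 < w.im}] (t : ℂ))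
      (𝓝 (symbolDeriv m c (z1Ext m c t))⁻¹) := by
    refine (((continuousAt_symbolDeriv hz0).tendsto.comp hT).inv₀ hd).congr' ?_
    filter_upwards [self_mem_nhdsWithin] with y hy
    exact ((hasDerivAt_z1 hm hc (notMem_Gamma1_of_mem_upperHalf hΓ hy)).deriv).symm
  have hconj : Tendsto (fun w : ℂ => conj w) (𝓝[{w : ℂ | w.im < 0}] (t : ℂ))
      (𝓝[{w : ℂ | 0 < w.im}] (t : ℂ)) := by
    refine tendsto_nhdsWithin_iff.2 ⟨?_, ?_⟩
    · simpa using (Complex.continuous_conj.tendsto (t : ℂ)).mono_left nhdsWithin_le_nhds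
    · filter_upwards [self_mem_nhdsWithin] with y hy
      have : y.im < 0 := hy
      simpa using this
  have hneb' : (𝓝[{w : ℂ | w.im < 0}] (t : ℂ)).NeBot := by
    refine mem_closure_iff_nhdsWithin_neBot.1 ?_
    rw [Complex.closure_setOfPred_im_lt]; simp
  -- Conjugation symmetry makes the boundary values from below the conjugates of those from above,
  -- so the density is -1/π times an imaginary part.
  have hlow : ∀ y : ℂ, y.im < 0 → z1 m c y = conj (z1 m c (conj y)) ∧
      deriv (z1 m c) y = conj (deriv (z1 m c) (conj y)) := by
    intro y hy
    have h1 : y ∉ Gamma1 m c := notMem_Gamma1_of_im_ne_zero hΓ hy.ne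
    have h2 : z1 m c (conj y) = conj (z1 m c y) := z1_conj hm hc h1
    refine ⟨by rw [h2, Complex.conj_conj], ?_⟩
    rw [(hasDerivAt_z1 hm hc h1).deriv, (hasDerivAt_z1 hm hc (conj_notMem_Gamma1 h1)).deriv, h2,
      symbolDeriv_conj, map_inv₀, Complex.conj_conj]
  have hL : Tendsto (z1 m c) (𝓝[{w : ℂ | w.im < 0}] (t : ℂ)) (𝓝 (conj (z1Ext m c t))) := by
    refine ((Complex.continuous_conj.tendsto _).comp (hT.comp hconj)).congr' ?_
    filter_upwards [self_mem_nhdsWithin] with y hy using (hlow y hy).1.symm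
  have hL' : Tendsto (deriv (z1 m c)) (𝓝[{w : ℂ | w.im < 0}] (t : ℂ))
      (𝓝 (conj (symbolDeriv m c (z1Ext m c t))⁻¹)) := by
    refine ((Complex.continuous_conj.tendsto _).comp (hT'.comp hconj)).congr' ?_
    filter_upwards [self_mem_nhdsWithin] with y hy using (hlow y hy).2.symm
  rw [mu1Density, bvPlus, bvPlus, bvMinus, bvMinus, hT.limUnder_eq, hT'.limUnder_eq,
    hL.limUnder_eq, hL'.limUnder_eq, ← map_div₀, realDensity, logDerivExt]
  set q := (symbolDeriv m c (z1Ext m c t))⁻¹ / z1Ext m c t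
  have h1 : conj q - q = ((-2 * q.im : ℝ) : ℂ) * Complex.I := by
    apply Complex.ext <;> simp; ring
  have hπ : (Real.pi : ℂ) ≠ 0 := by exact_mod_cast Real.pi_ne_zero
  have h2 : 1 / (2 * (Real.pi : ℂ) * Complex.I) * (((-2 * q.im : ℝ) : ℂ) * Complex.I) =
      ((-q.im / Real.pi : ℝ) : ℂ) := by
    push_cast
    field_simp
  rw [h1, h2, Complex.ofReal_re]

/-- The restriction to Γ₁ can be dropped because z₁ is real at real points off Γ₁, so the density
vanishes there; the finitely many branch points are a null set. -/
lemma mu1_eq_withDensity (hm : 3 ≤ m) (hc : c (m - 2) ≠ 0) (hΓ : ∀ w ∈ Gamma1 m c, w.im = 0) :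
    mu1 m c = volume.withDensity fun t => ENNReal.ofReal (realDensity m c t) := by
  have hms : MeasurableSet {x : ℝ | (x : ℂ) ∈ Gamma1 m c} :=
    ((isClosed_Gamma1 hm hc).preimage Complex.continuous_ofReal).measurableSet
  rw [mu1, ← withDensity_indicator hms]
  refine withDensity_congr_ae ?_
  have hfin : ∀ᵐ t : ℝ, t ∉ {t : ℝ | symbolDeriv m c (z1Ext m c t) = 0} :=
    measure_eq_zero_iff_ae_notMem.1 ((finite_branchPoints hm hc hΓ).measure_zero _)
  filter_upwards [hfin] with t ht
  by_cases hmem : (t : ℂ) ∈ Gamma1 m c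
  · rw [Set.indicator_of_mem (by exact hmem), mu1Density_re hm hc hΓ ht]
  · rw [Set.indicator_of_notMem (by exact hmem), realDensity_of_notMem hm hc hΓ hmem,
      ENNReal.ofReal_zero]

end Density

/-! ### Maximum principle and arguments on the half plane -/

lemma isClosed_closedUpperHalf : IsClosed closedUpperHalf :=
  isClosed_le continuous_const Complex.continuous_im

/-- A holomorphic function on the upper half plane whose imaginary part has boundary values zero
is constant. -/
lemma deriv_eq_zero_of_im_boundary_zero {f : ℂ → ℂ} {U : ℂ → ℝ}
    (hf : DifferentiableOn ℂ f upperHalf) (hU : ContinuousOn U closedUpperHalf)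
    (hfU : ∀ x ∈ upperHalf, (f x).im = U x) (h0 : ∀ t : ℝ, U t = 0)
    (hinf : Tendsto U (cocompact ℂ ⊓ 𝓟 closedUpperHalf) (𝓝 0)) {x : ℂ} (hx : x ∈ upperHalf) :
    deriv f x = 0 := by
  wlog hpos : 0 ≤ U x generalizing f U
  · have := this (f := fun x => -f x) (U := fun x => -U x) hf.fun_neg hU.fun_neg
      (fun x hx => by simp [hfU x hx]) (fun t => by simp [h0 t])
      (by simpa using hinf.neg) (by linarith)
    simpa [deriv.fun_neg] using this
  -- A positive value of U forces an interior maximum, since U is zero on the line and tends to zero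
  -- at infinity. If U has no positive value, then x itself is a maximum because 0 ≤ U x.
  have hmax : ∃ y ∈ upperHalf, IsMaxOn U upperHalf y := by
    by_cases hex : ∃ x₀ ∈ upperHalf, 0 < U x₀
    · obtain ⟨x₀, hx₀, hx₀U⟩ := hex
      obtain ⟨y, hy, hymax⟩ := hU.exists_isMaxOn' isClosed_closedUpperHalf (upperHalf_subset hx₀)
        (hinf.eventually_le_const hx₀U)
      have hyU : 0 < U y := hx₀U.trans_le (hymax (upperHalf_subset hx₀))
      refine ⟨y, ?_, hymax.on_subset upperHalf_subset⟩
      refine lt_of_le_of_ne (show 0 ≤ y.im from hy) fun him => ?_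
      have : y = ((y.re : ℝ) : ℂ) := Complex.ext (by simp) (by simpa using him.symm)
      rw [this, h0] at hyU
      exact lt_irrefl _ hyU
    · push Not at hex
      exact ⟨x, hx, fun y hy => (hex y hy).trans hpos⟩
  obtain ⟨y, hy, hymax⟩ := hmax
  -- The modulus of exp(-i f) is exp(Im f), so the maximum modulus principle applies.
  have hF : DifferentiableOn ℂ (fun w => Complex.exp (-Complex.I * f w)) upperHalf :=
    (hf.const_mul _).cexp
  have hnorm : ∀ w ∈ upperHalf, ‖Complex.exp (-Complex.I * f w)‖ = Real.exp (U w) := by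
    intro w hw
    rw [Complex.norm_exp, ← hfU w hw]; simp
  have hconst := Complex.eqOn_of_isPreconnected_of_isMaxOn_norm convex_upperHalf.isPreconnected
    isOpen_upperHalf hF hy (fun w hw => by
      simp only [Set.mem_ofPred_eq, Function.comp_apply, hnorm w hw, hnorm y hy]
      exact Real.exp_le_exp.2 (hymax hw))
  have hfd : HasDerivAt f (deriv f x) x :=
    (hf.differentiableAt (isOpen_upperHalf.mem_nhds hx)).hasDerivAt
  have h1 := (hfd.const_mul (-Complex.I)).cexp
  have h2 : HasDerivAt (fun w => Complex.exp (-Complex.I * f w)) 0 x := by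
    refine (hasDerivAt_const x (Complex.exp (-Complex.I * f y))).congr_of_eventuallyEq ?_
    filter_upwards [isOpen_upperHalf.mem_nhds hx] with w hw using hconst hw
  have h3 := h1.unique h2
  simpa using h3

/-- Rotation by -i keeps the cut of the principal argument away from both real half-lines, so
arguments stay continuous up to the boundary. -/
lemma neg_I_mul_mem_slitPlane {w : ℂ} (hw : w ∈ closedUpperHalf) (h0 : w ≠ 0) :
    -Complex.I * w ∈ Complex.slitPlane := by
  have hw' : 0 ≤ w.im := hw
  rcases hw'.eq_or_lt with h | h
  · right
    have : w.re ≠ 0 := fun hre => h0 (Complex.ext hre h.symm)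
    simpa using this
  · left; simpa using h

lemma abs_arg_neg_I_mul_le {w : ℂ} (hw : w ∈ closedUpperHalf) :
    |Complex.arg (-Complex.I * w)| ≤ Real.pi / 2 := by
  rw [Complex.abs_arg_le_pi_div_two_iff]
  have hw' : 0 ≤ w.im := hw
  simpa using hw'

/-- With w = (1 + u)v and |u| ≤ 1/2 one has |arg(1 + u)| ≤ 3|u|/2 ≤ 3/4; added to an argument of
size at most π/2 this does not wrap around. -/
lemma abs_arg_sub_arg_le {v w : ℂ} (hv : v ∈ closedUpperHalf)
    (hv0 : v ≠ 0) (h : ‖w - v‖ ≤ ‖v‖ / 2) :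
    |Complex.arg (-Complex.I * w) - Complex.arg (-Complex.I * v)| ≤ 3 / 2 * (‖w - v‖ / ‖v‖) := by
  have hvn : 0 < ‖v‖ := norm_pos_iff.2 hv0
  set u : ℂ := (w - v) / v with hu
  have hun : ‖u‖ = ‖w - v‖ / ‖v‖ := norm_div _ _
  have hu2 : ‖u‖ ≤ 1 / 2 := by rw [hun, div_le_iff₀ hvn]; linarith
  have hlog := Complex.norm_log_one_add_half_le_self hu2
  have harg : |Complex.arg (1 + u)| ≤ 3 / 2 * ‖u‖ := by
    rw [← Complex.log_im]; exact (Complex.abs_im_le_norm _).trans hlog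
  have h1u : 1 + u ≠ 0 := by
    intro h0
    have : u = -1 := by linear_combination h0
    rw [this] at hu2; norm_num at hu2
  have hw : -Complex.I * w = (1 + u) * (-Complex.I * v) := by
    rw [hu]; field_simp; ring
  have hb := abs_le.1 (abs_arg_neg_I_mul_le hv)
  have ha := abs_le.1 harg
  have hpi := Real.pi_gt_three
  rw [hw, Complex.arg_mul h1u (mul_ne_zero (neg_ne_zero.2 Complex.I_ne_zero) hv0)
    ⟨by linarith, by linarith⟩, add_sub_cancel_right, ← hun]
  exact harg

lemma arg_neg_I_mul_of_pos {r : ℝ} (hr : 0 < r) :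
    Complex.arg (-Complex.I * (r : ℂ)) = -(Real.pi / 2) :=
  Complex.arg_eq_neg_pi_div_two_iff.2 (by simp [hr])

lemma arg_neg_I_mul_of_neg {r : ℝ} (hr : r < 0) :
    Complex.arg (-Complex.I * (r : ℂ)) = Real.pi / 2 :=
  Complex.arg_eq_pi_div_two_iff.2 (by simp [hr])

/-! ### The argument of z₁ as distribution function of μ₁ -/

section Angle

variable {m : ℕ} {c : ℕ → ℝ}

/-- The argument of `z₁`, shifted by `π / 2`, on the closed upper half plane. -/
noncomputable def angle (m : ℕ) (c : ℕ → ℝ) (x : ℂ) : ℝ := Complex.arg (-Complex.I * z1Ext m c x)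

lemma continuousOn_angle (hm : 3 ≤ m) (hc : c (m - 2) ≠ 0) (hΓ : ∀ w ∈ Gamma1 m c, w.im = 0) :
    ContinuousOn (angle m c) closedUpperHalf := by
  intro x hx
  have h := Complex.continuousAt_arg (neg_I_mul_mem_slitPlane
    (z1Ext_mem_closedUpperHalf hm hc hΓ hx) (z1Ext_ne_zero hm hc hΓ hx))
  exact ContinuousAt.comp_continuousWithinAt (f := fun y => -Complex.I * z1Ext m c y) h
    (continuousWithinAt_const.mul (continuousOn_z1Ext hm hc hΓ x hx))

lemma continuous_angle_ofReal (hm : 3 ≤ m) (hc : c (m - 2) ≠ 0)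
    (hΓ : ∀ w ∈ Gamma1 m c, w.im = 0) : Continuous fun t : ℝ => angle m c t :=
  (continuousOn_angle hm hc hΓ).comp_continuous Complex.continuous_ofReal
    ofReal_mem_closedUpperHalf

lemma hasDerivAt_angle (hm : 3 ≤ m) (hc : c (m - 2) ≠ 0) (hΓ : ∀ w ∈ Gamma1 m c, w.im = 0)
    {t : ℝ} (hd : symbolDeriv m c (z1Ext m c t) ≠ 0) :
    HasDerivAt (fun t : ℝ => angle m c t) (-(Real.pi * realDensity m c t)) t := by
  have htc := ofReal_mem_closedUpperHalf t
  have h1 := ((hasDerivAt_z1Ext_ofReal hm hc hΓ hd).const_mul (-Complex.I)).clog_real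
    (neg_I_mul_mem_slitPlane (z1Ext_mem_closedUpperHalf hm hc hΓ htc) (z1Ext_ne_zero hm hc hΓ htc))
  have h2 := Complex.imCLM.hasFDerivAt.comp_hasDerivAt t h1
  have h3 : (fun t : ℝ => angle m c t) =
      Complex.imCLM ∘ fun t : ℝ => Complex.log (-Complex.I * z1Ext m c t) := by
    funext s; simp [angle, Complex.log_im]
  rw [h3]
  refine h2.congr_deriv ?_
  have h4 : -Complex.I * (symbolDeriv m c (z1Ext m c t))⁻¹ / (-Complex.I * z1Ext m c t) =
      logDerivExt m c t := by
    rw [logDerivExt, mul_div_mul_left _ _ (neg_ne_zero.2 Complex.I_ne_zero)]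
  rw [h4, realDensity]
  simp only [Complex.imCLM_apply]
  field_simp

lemma realDensity_nonneg (hm : 3 ≤ m) (hc : c (m - 2) ≠ 0) (hΓ : ∀ w ∈ Gamma1 m c, w.im = 0)
    {t : ℝ} (hd : symbolDeriv m c (z1Ext m c t) ≠ 0) : 0 ≤ realDensity m c t :=
  div_nonneg (neg_nonneg.2 (logDerivExt_im_nonpos hm hc hΓ hd)) Real.pi_nonneg

lemma ae_realDensity_nonneg (hm : 3 ≤ m) (hc : c (m - 2) ≠ 0)
    (hΓ : ∀ w ∈ Gamma1 m c, w.im = 0) : ∀ᵐ t : ℝ, 0 ≤ realDensity m c t := by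
  have hfin : ∀ᵐ t : ℝ, t ∉ {t : ℝ | symbolDeriv m c (z1Ext m c t) = 0} :=
    measure_eq_zero_iff_ae_notMem.1 ((finite_branchPoints hm hc hΓ).measure_zero _)
  filter_upwards [hfin] with t ht using realDensity_nonneg hm hc hΓ ht

/-- The density may blow up at a branch point, but on either side it is the nonnegative derivative
of a function continuous up to that point, which bounds its integral. -/
lemma locallyIntegrable_realDensity (hm : 3 ≤ m) (hc : c (m - 2) ≠ 0)
    (hΓ : ∀ w ∈ Gamma1 m c, w.im = 0) : LocallyIntegrable (realDensity m c) := by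
  intro t
  have hev : ∀ᶠ s : ℝ in 𝓝[≠] t, symbolDeriv m c (z1Ext m c s) ≠ 0 := by
    have h1 : ({s : ℝ | symbolDeriv m c (z1Ext m c s) = 0} \ {t}).Finite :=
      (finite_branchPoints hm hc hΓ).subset Set.sdiff_subset
    have h2 : ∀ᶠ s in 𝓝 t, s ∉ {s : ℝ | symbolDeriv m c (z1Ext m c s) = 0} \ {t} :=
      h1.isClosed.isOpen_compl.mem_nhds fun h => h.2 rfl
    filter_upwards [mem_nhdsWithin_of_mem_nhds h2, self_mem_nhdsWithin] with s hs hst h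
    exact hs ⟨h, hst⟩
  obtain ⟨δ, hδ, hball⟩ := Metric.mem_nhdsWithin_iff.1 hev
  have hgood : ∀ s : ℝ, |s - t| < δ → s ≠ t →
      HasDerivAt (fun u : ℝ => -angle m c u) (Real.pi * realDensity m c s) s ∧
      0 ≤ Real.pi * realDensity m c s := by
    intro s hs hst
    have hd := hball ⟨by rwa [Metric.mem_ball, Real.dist_eq], hst⟩
    exact ⟨by simpa using! (hasDerivAt_angle hm hc hΓ hd).neg,
      mul_nonneg Real.pi_nonneg (realDensity_nonneg hm hc hΓ hd)⟩
  have hcont : Continuous fun u : ℝ => -angle m c u := (continuous_angle_ofReal hm hc hΓ).neg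
  have hl : IntegrableOn (fun s => Real.pi * realDensity m c s) (Set.Ioc (t - δ) t) :=
    intervalIntegral.integrableOn_deriv_of_nonneg hcont.continuousOn
      (fun s hs => (hgood s (by rw [abs_lt]; constructor <;> linarith [hs.1, hs.2]) hs.2.ne).1)
      (fun s hs => (hgood s (by rw [abs_lt]; constructor <;> linarith [hs.1, hs.2]) hs.2.ne).2)
  have hr : IntegrableOn (fun s => Real.pi * realDensity m c s) (Set.Ioc t (t + δ)) :=
    intervalIntegral.integrableOn_deriv_of_nonneg hcont.continuousOn
      (fun s hs => (hgood s (by rw [abs_lt]; constructor <;> linarith [hs.1, hs.2]) hs.1.ne').1)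
      (fun s hs => (hgood s (by rw [abs_lt]; constructor <;> linarith [hs.1, hs.2]) hs.1.ne').2)
  refine ⟨Set.Ioc (t - δ) (t + δ), Ioc_mem_nhds (by linarith) (by linarith), ?_⟩
  rw [← Set.Ioc_union_Ioc_eq_Ioc (b := t) (by linarith) (by linarith)]
  have h := (hl.union hr).const_mul Real.pi⁻¹
  refine h.congr (Eventually.of_forall fun s => ?_)
  simp only []
  rw [inv_mul_cancel_left₀ Real.pi_ne_zero]

lemma mu1_Ioc (hm : 3 ≤ m) (hc : c (m - 2) ≠ 0) (hΓ : ∀ w ∈ Gamma1 m c, w.im = 0) {a b : ℝ}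
    (hab : a ≤ b) :
    mu1 m c (Set.Ioc a b) = ENNReal.ofReal ((angle m c a - angle m c b) / Real.pi) := by
  have hint : IntervalIntegrable (realDensity m c) volume a b :=
    ((locallyIntegrable_realDensity hm hc hΓ).integrableOn_isCompact isCompact_uIcc
      ).intervalIntegrable
  have hftc := integral_eq_of_hasDerivAt_off_countable_of_le (fun t : ℝ => angle m c t)
    (fun t => -(Real.pi * realDensity m c t)) hab (finite_branchPoints hm hc hΓ).countable
    (continuous_angle_ofReal hm hc hΓ).continuousOn
    (fun t ht => hasDerivAt_angle hm hc hΓ ht.2) (hint.const_mul _).neg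
  rw [intervalIntegral.integral_neg, intervalIntegral.integral_const_mul] at hftc
  have hval : ∫ t in a..b, realDensity m c t = (angle m c a - angle m c b) / Real.pi := by
    rw [eq_div_iff Real.pi_ne_zero]; linarith
  rw [mu1_eq_withDensity hm hc hΓ, withDensity_apply _ measurableSet_Ioc, ← hval,
    intervalIntegral.integral_of_le hab, ofReal_integral_eq_lintegral_ofReal]
  · exact (intervalIntegrable_iff_integrableOn_Ioc_of_le hab).1 hint
  · exact ae_restrict_of_ae (ae_realDensity_nonneg hm hc hΓ)

/-- For real t with |t| large, z₁ is real and within D of t, so it has the sign of t. -/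
lemma exists_angle_radius (hm : 3 ≤ m) (hc : c (m - 2) ≠ 0) (hΓ : ∀ w ∈ Gamma1 m c, w.im = 0) :
    ∃ N D : ℝ, 0 < N ∧ 0 ≤ D ∧ (∀ x : ℂ, N ≤ ‖x‖ → x ∉ Gamma1 m c) ∧
      (∀ x ∈ closedUpperHalf, N ≤ ‖x‖ → ‖z1Ext m c x - x‖ ≤ D) ∧
      (∀ t : ℝ, N ≤ t → angle m c t = -(Real.pi / 2)) ∧
      (∀ t : ℝ, t ≤ -N → angle m c t = Real.pi / 2) := by
  obtain ⟨R, D, hR, hD, h⟩ := exists_radius hm hc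
  have hext : ∀ x ∈ closedUpperHalf, R + D + 1 ≤ ‖x‖ → ‖z1Ext m c x - x‖ ≤ D := by
    intro x hx hxn
    obtain ⟨h1, h2⟩ := h x (by linarith)
    rwa [z1Ext_eq_z1 hm hc hΓ hx h1]
  have hreal : ∀ t : ℝ, R + D + 1 ≤ |t| → ∃ r : ℝ, z1Ext m c t = r ∧ |r - t| ≤ D := by
    intro t ht
    have hn : ‖(t : ℂ)‖ = |t| := by rw [Complex.norm_real, Real.norm_eq_abs]
    have h1 := (h t (by rw [hn]; linarith)).1
    obtain ⟨r, hr⟩ := Complex.conj_eq_iff_real.1 (z1Ext_ofReal_im_of_notMem hm hc hΓ h1)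
    refine ⟨r, hr, ?_⟩
    have h2 := hext t (ofReal_mem_closedUpperHalf t) (by rw [hn]; exact ht)
    rw [hr, ← Complex.ofReal_sub, Complex.norm_real, Real.norm_eq_abs] at h2
    exact h2
  refine ⟨R + D + 1, D, by linarith, hD, fun x hx => (h x (by linarith)).1, hext,
    fun t ht => ?_, fun t ht => ?_⟩
  · obtain ⟨r, hr, hrt⟩ := hreal t (ht.trans (le_abs_self t))
    rw [angle, hr, arg_neg_I_mul_of_pos]
    linarith [(abs_le.1 hrt).1]
  · obtain ⟨r, hr, hrt⟩ := hreal t (by linarith [neg_abs_le t])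
    rw [angle, hr, arg_neg_I_mul_of_neg]
    linarith [(abs_le.1 hrt).2]

lemma mu1_compl_eq_zero (hm : 3 ≤ m) (hc : c (m - 2) ≠ 0) (hΓ : ∀ w ∈ Gamma1 m c, w.im = 0)
    {N : ℝ} (hN : ∀ x : ℂ, N ≤ ‖x‖ → x ∉ Gamma1 m c) : mu1 m c (Set.Ioc (-N) N)ᶜ = 0 := by
  rw [mu1_eq_withDensity hm hc hΓ, withDensity_apply _ measurableSet_Ioc.compl,
    setLIntegral_congr_fun (g := fun _ => 0) measurableSet_Ioc.compl]
  · simp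
  · intro t ht
    have hn : N ≤ ‖(t : ℂ)‖ := by
      rw [Complex.norm_real, Real.norm_eq_abs]
      by_contra! hlt
      have := abs_lt.1 hlt
      exact ht ⟨this.1, this.2.le⟩
    simp only [realDensity_of_notMem hm hc hΓ (hN _ hn), ENNReal.ofReal_zero]

lemma mu1_Ioi (hm : 3 ≤ m) (hc : c (m - 2) ≠ 0) (hΓ : ∀ w ∈ Gamma1 m c, w.im = 0) (a : ℝ) :
    mu1 m c (Set.Ioi a) = ENNReal.ofReal ((angle m c a + Real.pi / 2) / Real.pi) := by
  obtain ⟨N, D, hN0, -, hN, -, hNr, -⟩ := exists_angle_radius hm hc hΓ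
  set M := max N |a|
  have hM : ∀ x : ℂ, M ≤ ‖x‖ → x ∉ Gamma1 m c := fun x hx => hN x ((le_max_left _ _).trans hx)
  have haM : |a| ≤ M := le_max_right _ _
  have h1 : mu1 m c (Set.Ioi M) = 0 := measure_mono_null
    (fun t ht => Set.mem_compl fun hmem : t ∈ Set.Ioc (-M) M => absurd hmem.2 (not_le.2 ht)) (mu1_compl_eq_zero hm hc hΓ hM)
  have haM' : a ≤ M := (le_abs_self a).trans haM
  rw [← Set.Ioc_union_Ioi_eq_Ioi haM', measure_union (Set.Ioc_disjoint_Ioi le_rfl) measurableSet_Ioi,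
    h1, add_zero, mu1_Ioc hm hc hΓ haM', hNr M (le_max_left _ _), sub_neg_eq_add]

/-- The total drop of the angle across the line is exactly π. -/
lemma isProbabilityMeasure_mu1 (hm : 3 ≤ m) (hc : c (m - 2) ≠ 0)
    (hΓ : ∀ w ∈ Gamma1 m c, w.im = 0) : IsProbabilityMeasure (mu1 m c) := by
  obtain ⟨N, D, hN0, -, hN, -, hNr, hNl⟩ := exists_angle_radius hm hc hΓ
  constructor
  rw [← measure_add_measure_compl (measurableSet_Ioc (a := -N) (b := N)),
    mu1_compl_eq_zero hm hc hΓ hN, mu1_Ioc hm hc hΓ (by linarith), hNr N le_rfl, hNl (-N) le_rfl]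
  rw [show Real.pi / 2 - -(Real.pi / 2) = Real.pi by ring, div_self Real.pi_ne_zero]
  simp

end Angle

/-! ### The Stieltjes transform of μ₁ -/

section Stieltjes

variable {m : ℕ} {c : ℕ → ℝ}

lemma ofReal_sub_mem_upperHalf {x : ℂ} (hx : x ∈ upperHalf) (t : ℝ) : x - t ∈ upperHalf := by
  have : 0 < x.im := hx
  simpa [upperHalf] using this

lemma ofReal_sub_mem_closedUpperHalf {x : ℂ} (hx : x ∈ closedUpperHalf) (t : ℝ) :
    x - t ∈ closedUpperHalf := by
  have : 0 ≤ x.im := hx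
  simpa [closedUpperHalf] using this

lemma ne_zero_of_mem_upperHalf {x : ℂ} (hx : x ∈ upperHalf) : x ≠ 0 := by
  rintro rfl
  simp [upperHalf] at hx

lemma norm_inv_sub_le {x : ℂ} (hx : x ∈ upperHalf) (t : ℝ) : ‖(x - t)⁻¹‖ ≤ x.im⁻¹ := by
  have h : 0 < x.im := hx
  rw [norm_inv]
  refine inv_anti₀ h ?_
  have := Complex.abs_im_le_norm (x - t)
  simp only [Complex.sub_im, Complex.ofReal_im, sub_zero, abs_of_pos h] at this
  exact this

variable {μ : Measure ℝ}

lemma measurable_arg_sub (x : ℂ) :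
    Measurable fun t : ℝ => Complex.arg (-Complex.I * (x - t)) := by
  refine Complex.measurable_arg.comp (Continuous.measurable ?_)
  fun_prop

lemma integrable_arg_sub [IsProbabilityMeasure μ] {x : ℂ} (hx : x ∈ closedUpperHalf) :
    Integrable (fun t : ℝ => Complex.arg (-Complex.I * (x - t))) μ :=
  Integrable.of_bound (measurable_arg_sub x).aestronglyMeasurable (Real.pi / 2)
    (Eventually.of_forall fun t =>
      abs_arg_neg_I_mul_le (ofReal_sub_mem_closedUpperHalf hx t))

/-- At a real point the integrand jumps from -π/2 for t < a to π/2 for t > a, so the integral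
records the mass to the right of a; having no atoms makes t = a irrelevant. -/
lemma integral_arg_sub_ofReal [IsProbabilityMeasure μ] [NullSingletonClass μ] (a : ℝ) :
    ∫ t : ℝ, Complex.arg (-Complex.I * ((a : ℂ) - t)) ∂μ =
      Real.pi * μ.real (Set.Ioi a) - Real.pi / 2 := by
  have h1 : ∀ᵐ t : ℝ ∂μ, t ≠ a := by
    rw [ae_iff]; simp
  have h2 : ∀ᵐ t : ℝ ∂μ, Complex.arg (-Complex.I * ((a : ℂ) - t)) =
      (Set.Ioi a).indicator (fun _ => Real.pi) t - Real.pi / 2 := by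
    filter_upwards [h1] with t ht
    rcases lt_or_gt_of_ne ht with h | h
    · rw [Set.indicator_of_notMem (by simpa using h.le), ← Complex.ofReal_sub,
        arg_neg_I_mul_of_pos (by linarith)]; ring
    · rw [Set.indicator_of_mem (by simpa using h), ← Complex.ofReal_sub,
        arg_neg_I_mul_of_neg (by linarith)]; ring
  rw [integral_congr_ae h2, integral_sub ((integrable_const _).indicator measurableSet_Ioi)
    (integrable_const _), integral_indicator measurableSet_Ioi]
  simp [mul_comm]

lemma continuousOn_integral_arg_sub [IsProbabilityMeasure μ] [NullSingletonClass μ] :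
    ContinuousOn (fun x : ℂ => ∫ t : ℝ, Complex.arg (-Complex.I * (x - t)) ∂μ)
      closedUpperHalf := by
  intro x hx
  refine continuousWithinAt_of_dominated (bound := fun _ => Real.pi / 2)
    (Eventually.of_forall fun y => (measurable_arg_sub y).aestronglyMeasurable) ?_
    (integrable_const _) ?_
  · filter_upwards [self_mem_nhdsWithin] with y hy
    exact Eventually.of_forall fun t =>
      abs_arg_neg_I_mul_le (ofReal_sub_mem_closedUpperHalf hy t)
  · have h1 : ∀ᵐ t ∂μ, t ≠ x.re := by
      rw [ae_iff]; simp
    filter_upwards [h1] with t ht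
    have h0 : x - t ≠ 0 := fun h => ht (by
      have := congrArg Complex.re h
      simp at this; linarith)
    exact ContinuousAt.comp_continuousWithinAt (f := fun y : ℂ => -Complex.I * (y - t))
      (Complex.continuousAt_arg (neg_I_mul_mem_slitPlane
        (ofReal_sub_mem_closedUpperHalf hx t) h0))
      (by fun_prop : Continuous fun y : ℂ => -Complex.I * (y - t)).continuousWithinAt

lemma ae_mem_of_measure_compl {N : ℝ} (h : μ (Set.Ioc (-N) N)ᶜ = 0) : ∀ᵐ t ∂μ, |t| ≤ N := by
  filter_upwards [measure_eq_zero_iff_ae_notMem.1 h] with t ht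
  have := Set.notMem_compl_iff.1 ht
  exact abs_le.2 ⟨this.1.le, this.2⟩

lemma integrable_log_sub [IsProbabilityMeasure μ] {N : ℝ} (hN : μ (Set.Ioc (-N) N)ᶜ = 0) {x : ℂ}
    (hx : x ∈ upperHalf) : Integrable (fun t : ℝ => Complex.log (-Complex.I * (x - t))) μ := by
  have hcont : Continuous fun t : ℝ => Complex.log (-Complex.I * (x - t)) := by
    refine continuous_iff_continuousAt.2 fun t => ?_
    refine ContinuousAt.clog (by fun_prop) ?_
    have h := ofReal_sub_mem_upperHalf hx t
    exact neg_I_mul_mem_slitPlane (upperHalf_subset h) (ne_zero_of_mem_upperHalf h)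
  obtain ⟨C, hC⟩ := (isCompact_Icc (a := -N) (b := N)).exists_bound_of_continuousOn
    hcont.continuousOn
  refine Integrable.of_bound hcont.aestronglyMeasurable C ?_
  filter_upwards [ae_mem_of_measure_compl hN] with t ht using hC t (abs_le.1 ht)

lemma hasDerivAt_integral_log_sub [IsProbabilityMeasure μ] {N : ℝ}
    (hN : μ (Set.Ioc (-N) N)ᶜ = 0) {x : ℂ} (hx : x ∈ upperHalf) :
    HasDerivAt (fun x : ℂ => ∫ t : ℝ, Complex.log (-Complex.I * (x - t)) ∂μ)
      (∫ t : ℝ, (x - t)⁻¹ ∂μ) x := by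
  have hx0 : 0 < x.im := hx
  set s : Set ℂ := {w | x.im / 2 < w.im} with hs
  have hso : IsOpen s := isOpen_lt continuous_const Complex.continuous_im
  have hsU : s ⊆ upperHalf := fun w (hw : x.im / 2 < w.im) => show 0 < w.im by linarith
  have hsn : s ∈ 𝓝 x := hso.mem_nhds (show x.im / 2 < x.im by linarith)
  refine (hasDerivAt_integral_of_dominated_loc_of_deriv_le (F' := fun x (t : ℝ) => (x - t)⁻¹)
    (bound := fun _ => (x.im / 2)⁻¹) hsn ?_ (integrable_log_sub hN hx) ?_ ?_
    (integrable_const _) ?_).2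
  · filter_upwards [hsn] with w hw using (integrable_log_sub hN (hsU hw)).aestronglyMeasurable
  · refine Continuous.aestronglyMeasurable ?_
    refine Continuous.inv₀ (by fun_prop) fun t =>
      ne_zero_of_mem_upperHalf (ofReal_sub_mem_upperHalf hx t)
  · refine Eventually.of_forall fun t w hw => (norm_inv_sub_le (hsU hw) t).trans ?_
    exact inv_anti₀ (by linarith) (le_of_lt hw)
  · refine Eventually.of_forall fun t w hw => ?_
    have hmem := ofReal_sub_mem_upperHalf (hsU hw) t
    have h0 := ne_zero_of_mem_upperHalf hmem
    have := (((hasDerivAt_id w).sub_const (t : ℂ)).const_mul (-Complex.I)).clog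
      (neg_I_mul_mem_slitPlane (upperHalf_subset hmem) h0)
    refine this.congr_deriv ?_
    simp only [id]
    field_simp

lemma nullSingletonClass_mu1 (hm : 3 ≤ m) (hc : c (m - 2) ≠ 0) (hΓ : ∀ w ∈ Gamma1 m c, w.im = 0) :
    NullSingletonClass (mu1 m c) := by
  rw [mu1_eq_withDensity hm hc hΓ]
  exact ⟨fun x => withDensity_absolutelyContinuous _ _ (measure_singleton x)⟩

/-- The Stieltjes transform of `μ₁` is the logarithmic derivative of the dominant solution. -/
theorem integral_inv_sub_mu1 (hm : 3 ≤ m) (hc : c (m - 2) ≠ 0)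
    (hΓ : ∀ w ∈ Gamma1 m c, w.im = 0) {x : ℂ} (hx : x ∈ upperHalf) :
    ∫ t : ℝ, (x - t)⁻¹ ∂(mu1 m c) = (symbolDeriv m c (z1 m c x))⁻¹ / z1 m c x := by
  have hprob := isProbabilityMeasure_mu1 hm hc hΓ
  have hna := nullSingletonClass_mu1 hm hc hΓ
  obtain ⟨N, D, hN0, hD, hN, hND, -, -⟩ := exists_angle_radius hm hc hΓ
  have hNc := mu1_compl_eq_zero hm hc hΓ hN
  set μ := mu1 m c with hμ
  have hzd : ∀ w ∈ upperHalf, HasDerivAt (fun w => Complex.log (-Complex.I * z1 m c w))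
      ((symbolDeriv m c (z1 m c w))⁻¹ / z1 m c w) w := by
    intro w hw
    have hmem := z1_mem_upperHalf hm hc hΓ hw
    have := ((hasDerivAt_z1 hm hc (notMem_Gamma1_of_mem_upperHalf hΓ hw)).const_mul
      (-Complex.I)).clog (neg_I_mul_mem_slitPlane (upperHalf_subset hmem)
        (ne_zero_of_mem_upperHalf hmem))
    refine this.congr_deriv ?_
    rw [mul_div_mul_left _ _ (neg_ne_zero.2 Complex.I_ne_zero)]
  have hfd : ∀ w ∈ upperHalf, HasDerivAt (fun w : ℂ => Complex.log (-Complex.I * z1 m c w) -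
      ∫ t : ℝ, Complex.log (-Complex.I * (w - t)) ∂μ)
      ((symbolDeriv m c (z1 m c w))⁻¹ / z1 m c w - ∫ t : ℝ, (w - t)⁻¹ ∂μ) w := fun w hw =>
    (hzd w hw).sub (hasDerivAt_integral_log_sub hNc hw)
  -- The boundary values cancel because the angle gives the tail masses of μ₁. At infinity both
  -- z₁(w) and w - t stay at bounded distance from w, so their arguments differ by O(1/|w|).
  have key := deriv_eq_zero_of_im_boundary_zero
    (U := fun w => angle m c w - ∫ t : ℝ, Complex.arg (-Complex.I * (w - t)) ∂μ)
    (fun w hw => (hfd w hw).differentiableAt.differentiableWithinAt)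
    ((continuousOn_angle hm hc hΓ).sub continuousOn_integral_arg_sub) ?_ ?_ ?_ hx
  · rw [(hfd x hx).deriv] at key
    exact (sub_eq_zero.1 key).symm
  · intro w hw
    rw [Complex.sub_im, Complex.log_im, angle, z1Ext_of_mem_upperHalf hm hc hΓ hw]
    congr 1
    have h : ∫ t : ℝ, (Complex.log (-Complex.I * (w - t))).im ∂μ =
        (∫ t : ℝ, Complex.log (-Complex.I * (w - t)) ∂μ).im :=
      integral_im (integrable_log_sub hNc hw)
    simp only [Complex.log_im] at h
    exact h.symm
  · intro a
    have hle : -(Real.pi / 2) ≤ angle m c a := (abs_le.1 (abs_arg_neg_I_mul_le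
      (z1Ext_mem_closedUpperHalf hm hc hΓ (ofReal_mem_closedUpperHalf a)))).1
    rw [integral_arg_sub_ofReal, Measure.real, mu1_Ioi hm hc hΓ, ENNReal.toReal_ofReal
      (div_nonneg (by linarith) Real.pi_nonneg), mul_div_cancel₀ _ Real.pi_ne_zero]
    ring
  · have hbound : ∀ᶠ w in cocompact ℂ ⊓ 𝓟 closedUpperHalf,
        ‖angle m c w - ∫ t : ℝ, Complex.arg (-Complex.I * (w - t)) ∂μ‖ ≤
          3 / 2 * (D + N) / ‖w‖ := by
      have h1 : ∀ᶠ w in cocompact ℂ ⊓ 𝓟 closedUpperHalf, 2 * (D + N) ≤ ‖w‖ :=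
        ((tendsto_norm_cocompact_atTop (E := ℂ)).eventually_ge_atTop _).filter_mono inf_le_left
      have h2 : ∀ᶠ w in cocompact ℂ ⊓ 𝓟 closedUpperHalf, w ∈ closedUpperHalf :=
        mem_inf_of_right (mem_principal_self _)
      filter_upwards [h1, h2] with w hw hwc
      have hw0 : 0 < ‖w‖ := by linarith
      have hwne : w ≠ 0 := norm_pos_iff.1 hw0
      have h3 : angle m c w - ∫ t : ℝ, Complex.arg (-Complex.I * (w - t)) ∂μ =
          ∫ t : ℝ, (angle m c w - Complex.arg (-Complex.I * (w - t))) ∂μ := by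
        rw [integral_sub (integrable_const _) (integrable_arg_sub hwc)]; simp
      rw [h3]
      refine (norm_integral_le_of_norm_le_const (C := 3 / 2 * (D + N) / ‖w‖) ?_).trans (by simp)
      filter_upwards [ae_mem_of_measure_compl hNc] with t ht
      have hz := hND w hwc (by linarith)
      have h4 := abs_arg_sub_arg_le hwc hwne (hz.trans (by linarith))
      have hwt : ‖w - t - w‖ ≤ N := by
        rw [sub_sub_cancel_left, norm_neg, Complex.norm_real]; exact ht
      have h5 := abs_arg_sub_arg_le hwc hwne (hwt.trans (by linarith))
      have h6 : 3 / 2 * (‖z1Ext m c w - w‖ / ‖w‖) ≤ 3 / 2 * (D / ‖w‖) := by gcongr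
      have h7 : 3 / 2 * (‖w - t - w‖ / ‖w‖) ≤ 3 / 2 * (N / ‖w‖) := by gcongr
      rw [Real.norm_eq_abs]
      calc |angle m c w - Complex.arg (-Complex.I * (w - t))|
          ≤ |angle m c w - Complex.arg (-Complex.I * w)| +
            |Complex.arg (-Complex.I * w) - Complex.arg (-Complex.I * (w - t))| :=
              abs_sub_le _ _ _
        _ ≤ 3 / 2 * (D / ‖w‖) + 3 / 2 * (N / ‖w‖) := by
              rw [abs_sub_comm (Complex.arg (-Complex.I * w))]
              exact add_le_add (h4.trans h6) (h5.trans h7)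
        _ = 3 / 2 * (D + N) / ‖w‖ := by ring
    refine squeeze_zero_norm' hbound ?_
    exact Tendsto.div_atTop tendsto_const_nhds
      ((tendsto_norm_cocompact_atTop (E := ℂ)).mono_left inf_le_left)

end Stieltjes

/-! ### Weak convergence from Stieltjes transforms -/

section WeakConvergence

/-- The Cauchy kernel `t ↦ (x - t)⁻¹` as a bounded continuous function on the line. -/
noncomputable def cauchyKernel (x : ℂ) (hx : x ∈ upperHalf) : ℝ →ᵇ ℂ :=
  BoundedContinuousFunction.ofNormedAddCommGroup (fun t : ℝ => (x - t)⁻¹)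
    (Continuous.inv₀ (by fun_prop) fun t => ne_zero_of_mem_upperHalf (ofReal_sub_mem_upperHalf hx t))
    x.im⁻¹ fun t => norm_inv_sub_le hx t

@[simp] lemma cauchyKernel_apply {x : ℂ} (hx : x ∈ upperHalf) (t : ℝ) :
    cauchyKernel x hx t = (x - t)⁻¹ := rfl

variable {ν : ℕ → Measure ℝ} [∀ n, IsProbabilityMeasure (ν n)] {μ : Measure ℝ}
  [IsProbabilityMeasure μ]

variable (ν μ) in
/-- The bounded continuous functions whose integrals converge. -/
def convergenceSubmodule : Submodule ℂ (ℝ →ᵇ ℂ) where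
  carrier := {f | Tendsto (fun n => ∫ t, f t ∂(ν n)) atTop (𝓝 (∫ t, f t ∂μ))}
  add_mem' {f g} hf hg := by
    simp only [Set.mem_ofPred_eq, BoundedContinuousFunction.coe_add, Pi.add_apply] at *
    rw [integral_add (f.integrable μ) (g.integrable μ)]
    simp_rw [integral_add (f.integrable (ν _)) (g.integrable (ν _))]
    exact hf.add hg
  zero_mem' := by simp
  smul_mem' a f hf := by
    simp only [Set.mem_ofPred_eq, BoundedContinuousFunction.coe_smul, integral_smul] at *
    exact hf.const_smul a

lemma mem_convergenceSubmodule {f : ℝ →ᵇ ℂ} : f ∈ convergenceSubmodule ν μ ↔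
    Tendsto (fun n => ∫ t, f t ∂(ν n)) atTop (𝓝 (∫ t, f t ∂μ)) := Iff.rfl

lemma one_mem_convergenceSubmodule : (1 : ℝ →ᵇ ℂ) ∈ convergenceSubmodule ν μ := by
  rw [mem_convergenceSubmodule]; simp

lemma star_mem_convergenceSubmodule {f : ℝ →ᵇ ℂ} (hf : f ∈ convergenceSubmodule ν μ) :
    star f ∈ convergenceSubmodule ν μ := by
  rw [mem_convergenceSubmodule] at *
  have h := (Complex.continuous_conj.tendsto _).comp hf
  simpa only [Function.comp_def, ← integral_conj] using! h

lemma norm_integral_sub_le {ρ : Measure ℝ} [IsProbabilityMeasure ρ] {f g : ℝ →ᵇ ℂ} {ε : ℝ}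
    (h : ∀ t, ‖f t - g t‖ ≤ ε) : ‖∫ t, f t ∂ρ - ∫ t, g t ∂ρ‖ ≤ ε := by
  rw [← integral_sub (f.integrable ρ) (g.integrable ρ)]
  exact (norm_integral_le_of_norm_le_const (Eventually.of_forall h)).trans (by simp)

lemma mem_convergenceSubmodule_of_approx {f : ℝ →ᵇ ℂ}
    (h : ∀ ε > 0, ∃ g ∈ convergenceSubmodule ν μ, ∀ t, ‖f t - g t‖ ≤ ε) :
    f ∈ convergenceSubmodule ν μ := by
  rw [mem_convergenceSubmodule, Metric.tendsto_nhds]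
  intro ε hε
  obtain ⟨g, hg, hfg⟩ := h (ε / 4) (by linarith)
  filter_upwards [Metric.tendsto_nhds.1 (mem_convergenceSubmodule.1 hg) (ε / 4) (by linarith)]
    with n hn
  have h1 : dist (∫ t, f t ∂(ν n)) (∫ t, g t ∂(ν n)) ≤ ε / 4 := by
    rw [dist_eq_norm]; exact norm_integral_sub_le hfg
  have h2 : dist (∫ t, g t ∂μ) (∫ t, f t ∂μ) ≤ ε / 4 := by
    rw [dist_comm, dist_eq_norm]; exact norm_integral_sub_le hfg
  have := dist_triangle4 (∫ t, f t ∂(ν n)) (∫ t, g t ∂(ν n)) (∫ t, g t ∂μ) (∫ t, f t ∂μ)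
  linarith

/-- The iterated resolvent identity, with exact remainder. -/
lemma cauchyKernel_expansion {x y : ℂ} (hx : x ∈ upperHalf) (hy : y ∈ upperHalf) (k : ℕ) :
    cauchyKernel y hy = ∑ j ∈ Finset.range k, (x - y) ^ j • cauchyKernel x hx ^ (j + 1) +
      (x - y) ^ k • (cauchyKernel x hx ^ k * cauchyKernel y hy) := by
  induction k with
  | zero => simp
  | succ k ih =>
    conv_lhs => rw [ih]
    rw [Finset.sum_range_succ, add_assoc]
    congr 1
    ext t
    have h1 := ne_zero_of_mem_upperHalf (ofReal_sub_mem_upperHalf hx t)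
    have h2 := ne_zero_of_mem_upperHalf (ofReal_sub_mem_upperHalf hy t)
    have h3 : (y - t)⁻¹ = (x - t)⁻¹ + (x - y) * ((x - t)⁻¹ * (y - t)⁻¹) := by
      field_simp; ring
    simp only [BoundedContinuousFunction.coe_smul, BoundedContinuousFunction.coe_mul,
      BoundedContinuousFunction.coe_pow, BoundedContinuousFunction.coe_add, Pi.add_apply,
      Pi.mul_apply, Pi.pow_apply, cauchyKernel_apply, smul_eq_mul]
    conv_lhs => rw [h3]
    ring

/-- In the resolvent expansion at y = x - δ, everything but the remainder has convergent integrals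
by induction, so the remainder φ_x^k φ_y has too. It tends uniformly to φ_x^(k+1) as δ → 0. A
horizontal shift keeps y above height R. -/
lemma cauchyKernel_pow_mem {R : ℝ}
    (h : ∀ x (hx : x ∈ upperHalf), R < x.im → cauchyKernel x hx ∈ convergenceSubmodule ν μ)
    {x : ℂ} (hx : x ∈ upperHalf) (hxR : R < x.im) (k : ℕ) :
    cauchyKernel x hx ^ k ∈ convergenceSubmodule ν μ := by
  have hx0 : 0 < x.im := hx
  rcases k with _ | k
  · rw [pow_zero]; exact one_mem_convergenceSubmodule
  induction k using Nat.strong_induction_on with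
  | _ k ih =>
  refine mem_convergenceSubmodule_of_approx fun ε hε => ?_
  set M := x.im⁻¹ with hM
  have hMpos : 0 < M := inv_pos.2 hx0
  -- The approximation error is at most δ M^(k+2), since every kernel is bounded by M.
  set δ : ℝ := ε / M ^ (k + 2) with hδ
  have hδ0 : 0 < δ := by positivity
  have hδc : (δ : ℂ) ≠ 0 := by exact_mod_cast hδ0.ne'
  have him : (x - δ).im = x.im := by simp
  have hy : x - δ ∈ upperHalf := ofReal_sub_mem_upperHalf hx δ
  refine ⟨cauchyKernel x hx ^ k * cauchyKernel (x - δ) hy, ?_, fun t => ?_⟩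
  · have hexp := cauchyKernel_expansion hx hy k
    rw [sub_sub_cancel] at hexp
    have h2 : cauchyKernel x hx ^ k * cauchyKernel (x - δ) hy = ((δ : ℂ) ^ k)⁻¹ •
        (cauchyKernel (x - δ) hy -
          ∑ j ∈ Finset.range k, (δ : ℂ) ^ j • cauchyKernel x hx ^ (j + 1)) := by
      rw [eq_inv_smul_iff₀ (pow_ne_zero _ hδc), eq_sub_iff_add_eq, add_comm]
      exact hexp.symm
    rw [h2]
    refine Submodule.smul_mem _ _ (Submodule.sub_mem _ (h _ hy (by rw [him]; exact hxR)) ?_)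
    exact Submodule.sum_mem _ fun j hj =>
      Submodule.smul_mem _ _ (ih j (Finset.mem_range.1 hj))
  · simp only [BoundedContinuousFunction.coe_mul, BoundedContinuousFunction.coe_pow, Pi.mul_apply,
      Pi.pow_apply, cauchyKernel_apply]
    have h1 := ne_zero_of_mem_upperHalf (ofReal_sub_mem_upperHalf hx t)
    have h2 := ne_zero_of_mem_upperHalf (ofReal_sub_mem_upperHalf hy t)
    have h3 : (x - t)⁻¹ ^ (k + 1) - (x - t)⁻¹ ^ k * (x - δ - t)⁻¹ =
        -(δ * ((x - t)⁻¹ ^ (k + 1) * (x - δ - t)⁻¹)) := by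
      rw [pow_succ]; field_simp; ring
    have h4 := norm_inv_sub_le hx t
    have h5 := norm_inv_sub_le hy t
    rw [him] at h5
    rw [h3, norm_neg, norm_mul, norm_mul, norm_pow, Complex.norm_real, Real.norm_eq_abs,
      abs_of_pos hδ0]
    calc δ * (‖(x - t)⁻¹‖ ^ (k + 1) * ‖(x - δ - t)⁻¹‖) ≤ δ * (M ^ (k + 1) * M) := by gcongr
      _ = ε := by rw [← pow_succ, hδ]; field_simp

/-- Partial fractions write φ φ̄ as a multiple of φ - φ̄, which lowers mixed monomials step by step
to pure powers. -/
lemma cauchyKernel_pow_mul_star_pow_mem {R : ℝ}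
    (h : ∀ x (hx : x ∈ upperHalf), R < x.im → cauchyKernel x hx ∈ convergenceSubmodule ν μ)
    {x : ℂ} (hx : x ∈ upperHalf) (hxR : R < x.im) (k l : ℕ) :
    cauchyKernel x hx ^ k * star (cauchyKernel x hx) ^ l ∈ convergenceSubmodule ν μ := by
  have hx0 : 0 < x.im := hx
  have hne : conj x - x ≠ 0 := fun h0 => by
    have := congrArg Complex.im h0
    simp at this; linarith
  set φ := cauchyKernel x hx with hφ
  have hrel : φ * star φ = (conj x - x)⁻¹ • (φ - star φ) := by
    rw [eq_inv_smul_iff₀ hne]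
    ext t
    have h1 := ne_zero_of_mem_upperHalf (ofReal_sub_mem_upperHalf hx t)
    have h2 : conj x - t ≠ 0 := fun h0 => h1 (by
      have := congrArg conj h0
      simpa using this)
    have h3 : star φ t = (conj x - t)⁻¹ := by
      simp [hφ]
    simp only [BoundedContinuousFunction.coe_smul, BoundedContinuousFunction.coe_mul,
      BoundedContinuousFunction.coe_sub, Pi.sub_apply, Pi.mul_apply, h3, smul_eq_mul]
    simp only [hφ, cauchyKernel_apply]
    field_simp
    ring
  induction k generalizing l with
  | zero =>
    rw [pow_zero, one_mul, ← star_pow]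
    exact star_mem_convergenceSubmodule (cauchyKernel_pow_mem h hx hxR l)
  | succ k ihk =>
    induction l with
    | zero => rw [pow_zero, mul_one]; exact cauchyKernel_pow_mem h hx hxR _
    | succ l ihl =>
      have : φ ^ (k + 1) * star φ ^ (l + 1) = (conj x - x)⁻¹ •
          (φ ^ (k + 1) * star φ ^ l - φ ^ k * star φ ^ (l + 1)) := by
        calc φ ^ (k + 1) * star φ ^ (l + 1) = φ ^ k * star φ ^ l * (φ * star φ) := by ring
          _ = _ := by
            rw [hrel, mul_smul_comm]
            congr 1
            ring
      rw [this]
      exact Submodule.smul_mem _ _ (Submodule.sub_mem _ ihl (ihk _))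

lemma mem_convergenceSubmodule_of_mem_adjoin {R : ℝ}
    (h : ∀ x (hx : x ∈ upperHalf), R < x.im → cauchyKernel x hx ∈ convergenceSubmodule ν μ)
    {x : ℂ} (hx : x ∈ upperHalf) (hxR : R < x.im) {f : ℝ →ᵇ ℂ}
    (hf : f ∈ StarAlgebra.adjoin ℂ {cauchyKernel x hx}) : f ∈ convergenceSubmodule ν μ := by
  have h1 : f ∈ Submodule.span ℂ (Submonoid.closure
      ({cauchyKernel x hx} ∪ star {cauchyKernel x hx}) : Set (ℝ →ᵇ ℂ)) := by
    rw [← Algebra.adjoin_eq_span, ← StarAlgebra.adjoin_toSubalgebra]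
    exact hf
  refine Submodule.span_le.2 ?_ h1
  intro g hg
  rw [Set.star_singleton, ← Set.insert_eq, SetLike.mem_coe, Submonoid.mem_closure_pair] at hg
  obtain ⟨k, l, rfl⟩ := hg
  exact cauchyKernel_pow_mul_star_pow_mem h hx hxR k l

lemma re_mul_cauchyKernel (r t : ℝ) :
    ((r : ℂ) * Complex.I * ((r : ℂ) * Complex.I - t)⁻¹).re = r ^ 2 / (r ^ 2 + t ^ 2) := by
  rw [← div_eq_mul_inv, Complex.div_re]
  simp [Complex.normSq_apply]
  ring

lemma ofReal_mul_I_mem_upperHalf {r : ℝ} (hr : 0 < r) : (r : ℂ) * Complex.I ∈ upperHalf := by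
  simpa [upperHalf] using hr

lemma re_mul_integral_cauchyKernel (ρ : Measure ℝ) [IsProbabilityMeasure ρ] {r : ℝ} (hr : 0 < r) :
    ((r : ℂ) * Complex.I * ∫ t : ℝ, ((r : ℂ) * Complex.I - t)⁻¹ ∂ρ).re =
      ∫ t : ℝ, r ^ 2 / (r ^ 2 + t ^ 2) ∂ρ := by
  have hi : Integrable (fun t : ℝ => ((r : ℂ) * Complex.I - t)⁻¹) ρ :=
    (cauchyKernel _ (ofReal_mul_I_mem_upperHalf hr)).integrable ρ
  rw [← integral_const_mul]
  have h : ∫ t : ℝ, ((r : ℂ) * Complex.I * ((r : ℂ) * Complex.I - t)⁻¹).re ∂ρ = _ :=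
    integral_re (hi.const_mul _)
  simp_rw [re_mul_cauchyKernel r] at h
  exact h.symm

lemma integrable_sq_div (ρ : Measure ℝ) [IsProbabilityMeasure ρ] (r : ℝ) :
    Integrable (fun t : ℝ => r ^ 2 / (r ^ 2 + t ^ 2)) ρ := by
  refine Integrable.of_bound (Measurable.aestronglyMeasurable (by fun_prop)) 1
    (Eventually.of_forall fun t => ?_)
  rw [Real.norm_eq_abs, abs_of_nonneg (by positivity)]
  exact div_le_one_of_le₀ (by nlinarith [sq_nonneg t]) (by positivity)

/-- Where |t| > r one has 1 - r²/(r² + t²) ≥ 1/2, so the tail is controlled by the Stieltjes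
transform at the single point ir. -/
lemma measure_norm_gt_le (ρ : Measure ℝ) [IsProbabilityMeasure ρ] {r : ℝ} (hr : 0 < r) :
    ρ {t | r < ‖t‖} ≤ ENNReal.ofReal (2 * (1 - ∫ t : ℝ, r ^ 2 / (r ^ 2 + t ^ 2) ∂ρ)) := by
  have hi := integrable_sq_div ρ r
  have hms : MeasurableSet {t : ℝ | r < ‖t‖} := measurableSet_lt measurable_const measurable_norm
  have h1 : 2 * (1 - ∫ t : ℝ, r ^ 2 / (r ^ 2 + t ^ 2) ∂ρ) =
      ∫ t : ℝ, 2 * (1 - r ^ 2 / (r ^ 2 + t ^ 2)) ∂ρ := by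
    rw [integral_const_mul, integral_sub (integrable_const _) hi]; simp
  have h2 : ρ.real {t | r < ‖t‖} ≤ ∫ t : ℝ, 2 * (1 - r ^ 2 / (r ^ 2 + t ^ 2)) ∂ρ := by
    rw [← integral_indicator_one hms]
    refine integral_mono ((integrable_const (1 : ℝ)).indicator hms)
      (((integrable_const _).sub hi).const_mul _) fun t => ?_
    have hle : r ^ 2 / (r ^ 2 + t ^ 2) ≤ 1 :=
      div_le_one_of_le₀ (by nlinarith [sq_nonneg t]) (by positivity)
    by_cases ht : r < ‖t‖
    · rw [Set.indicator_of_mem (by exact ht)]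
      have h3 : r ^ 2 ≤ t ^ 2 := by
        rw [← sq_abs t]; exact pow_le_pow_left₀ hr.le (le_of_lt ht) 2
      have h4 : r ^ 2 / (r ^ 2 + t ^ 2) ≤ 1 / 2 := by
        rw [div_le_div_iff₀ (by positivity) (by norm_num)]; linarith
      simp only [Pi.one_apply]
      linarith
    · rw [Set.indicator_of_notMem (by exact ht)]
      simp only []
      linarith
  rw [h1, ← ofReal_measureReal (measure_ne_top _ _)]
  exact ENNReal.ofReal_le_ofReal h2

lemma tendsto_integral_sq_div (ρ : Measure ℝ) [IsProbabilityMeasure ρ] :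
    Tendsto (fun r : ℝ => ∫ t : ℝ, r ^ 2 / (r ^ 2 + t ^ 2) ∂ρ) atTop (𝓝 1) := by
  have h1 : (1 : ℝ) = ∫ _ : ℝ, (1 : ℝ) ∂ρ := by simp
  rw [h1]
  refine tendsto_integral_filter_of_dominated_convergence (fun _ => 1)
    (Eventually.of_forall fun r => (integrable_sq_div ρ r).aestronglyMeasurable)
    (Eventually.of_forall fun r => Eventually.of_forall fun t => ?_) (integrable_const _)
    (Eventually.of_forall fun t => ?_)
  · rw [Real.norm_eq_abs, abs_of_nonneg (by positivity)]
    exact div_le_one_of_le₀ (by nlinarith [sq_nonneg t]) (by positivity)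
  · have h2 : Tendsto (fun r : ℝ => 1 - t ^ 2 / (r ^ 2 + t ^ 2)) atTop (𝓝 (1 - 0)) := by
      refine Tendsto.const_sub _ (Tendsto.div_atTop tendsto_const_nhds ?_)
      exact tendsto_atTop_add_const_right _ _ (tendsto_pow_atTop (by norm_num))
    rw [sub_zero] at h2
    refine h2.congr' ?_
    filter_upwards [eventually_gt_atTop 0] with r hr
    field_simp
    ring

/-- Convergence of Stieltjes transforms on a half plane implies weak convergence of probability
measures. -/
theorem tendsto_integral_of_tendsto_stieltjes {R : ℝ}
    (h : ∀ x ∈ upperHalf, R < x.im →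
      Tendsto (fun n => ∫ t : ℝ, (x - t)⁻¹ ∂(ν n)) atTop (𝓝 (∫ t : ℝ, (x - t)⁻¹ ∂μ)))
    (f : ℝ →ᵇ ℝ) : Tendsto (fun n => ∫ t, f t ∂(ν n)) atTop (𝓝 (∫ t, f t ∂μ)) := by
  have hmem : ∀ x (hx : x ∈ upperHalf), R < x.im →
      cauchyKernel x hx ∈ convergenceSubmodule ν μ := fun x hx hxR => h x hx hxR
  have htight : IsTightMeasureSet (Set.range ν) := by
    refine isTightMeasureSet_range_of_tendsto_limsup_measure_norm_gt ?_
    have hlim : Tendsto (fun r : ℝ => ENNReal.ofReal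
        (2 * (1 - ∫ t : ℝ, r ^ 2 / (r ^ 2 + t ^ 2) ∂μ))) atTop (𝓝 0) := by
      have := ENNReal.tendsto_ofReal (((tendsto_integral_sq_div μ).const_sub 1).const_mul 2)
      simpa using this
    refine tendsto_of_tendsto_of_tendsto_of_le_of_le' tendsto_const_nhds hlim
      (Eventually.of_forall fun _ => zero_le) ?_
    filter_upwards [eventually_gt_atTop (max R 0)] with r hr
    have hr0 : 0 < r := (le_max_right _ _).trans_lt hr
    have hrR : R < r := (le_max_left _ _).trans_lt hr
    have h1 := h _ (ofReal_mul_I_mem_upperHalf hr0) (by simpa using hrR)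
    have h2 := (Complex.continuous_re.tendsto _).comp (h1.const_mul ((r : ℂ) * Complex.I))
    simp only [Function.comp_def, re_mul_integral_cauchyKernel _ hr0] at h2
    have h3 := ENNReal.tendsto_ofReal ((h2.const_sub 1).const_mul 2)
    rw [← h3.limsup_eq]
    exact limsup_le_limsup (Eventually.of_forall fun n => measure_norm_gt_le (ν n) hr0)
  set r := max R 0 + 1
  have hr0 : 0 < r := by have := le_max_right R 0; positivity
  have hrR : R < r := by have := le_max_left R 0; linarith
  have hx := ofReal_mul_I_mem_upperHalf hr0
  -- One kernel already separates points; given tightness, convergence on the star algebra it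
  -- generates is enough.
  have hconv := ProbabilityMeasure.tendsto_of_tight_of_separatesPoints ℂ (𝓕 := atTop)
    (μ := fun n => ⟨ν n, inferInstance⟩) (μ₀ := ⟨μ, inferInstance⟩)
    (A := StarAlgebra.adjoin ℂ {cauchyKernel _ hx}) htight ?_
    (fun g hg => mem_convergenceSubmodule_of_mem_adjoin hmem hx (by simpa using hrR) hg)
  · exact (ProbabilityMeasure.tendsto_iff_forall_integral_tendsto.1 hconv) f
  · intro s t hst
    refine ⟨_, ⟨_, ⟨cauchyKernel _ hx, StarAlgebra.self_mem_adjoin_singleton _ _, rfl⟩, rfl⟩, ?_⟩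
    intro heq
    have heq' : ((r : ℂ) * Complex.I - s)⁻¹ = ((r : ℂ) * Complex.I - t)⁻¹ := heq
    have := inv_injective heq'
    exact hst (by exact_mod_cast (sub_right_injective this))

end WeakConvergence

/-- Weak convergence from convergence of Stieltjes transforms along a countably generated
filter. -/
theorem weakLimit_of_tendsto_stieltjes {ι : Type*} {l : Filter ι} [l.IsCountablyGenerated]
    {ν : ι → Measure ℝ} (hν : ∀ᶠ i in l, IsProbabilityMeasure (ν i)) {μ : Measure ℝ}
    [IsProbabilityMeasure μ] {R : ℝ}
    (h : ∀ x ∈ upperHalf, R < x.im →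
      Tendsto (fun i => ∫ t : ℝ, (x - t)⁻¹ ∂(ν i)) l (𝓝 (∫ t : ℝ, (x - t)⁻¹ ∂μ))) :
    WeakLimit ν l μ := by
  classical
  intro f
  refine tendsto_of_seq_tendsto fun u hu => ?_
  -- The measures are probability measures only eventually; the exceptional ones become a Dirac mass
  -- without affecting the limit.
  let ν' : ℕ → Measure ℝ := fun n =>
    if IsProbabilityMeasure (ν (u n)) then ν (u n) else Measure.dirac 0
  have hν' : ∀ n, IsProbabilityMeasure (ν' n) := fun n => by
    by_cases hn : IsProbabilityMeasure (ν (u n))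
    · simpa only [ν', if_pos hn] using hn
    · simp only [ν', if_neg hn]; infer_instance
  have heq : ∀ᶠ n in atTop, ν' n = ν (u n) := by
    filter_upwards [hu.eventually hν] with n hn
    exact if_pos hn
  refine (tendsto_integral_of_tendsto_stieltjes (ν := ν') (R := R) (fun x hx hxR => ?_) f).congr' ?_
  · refine ((h x hx hxR).comp hu).congr' ?_
    filter_upwards [heq] with n hn
    simp only [Function.comp_apply, hn]
  · filter_upwards [heq] with n hn
    simp only [Function.comp_apply, hn]

/-! ### Contraction arguments for ratios and their logarithmic derivatives -/

section RatioAsymptotics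

/-- Taking δ = C/4 improves any eventual bound C to 3C/4, and this can be iterated. -/
lemma tendsto_zero_of_contraction {ι : Type*} {l : Filter ι} {u : ι → ℝ} (hu0 : ∀ i, 0 ≤ u i)
    {K : ℝ} (hb : ∀ᶠ i in l, u i ≤ K)
    (h : ∀ C ≥ 0, (∀ᶠ i in l, u i ≤ C) → ∀ δ > 0, ∀ᶠ i in l, u i ≤ C / 2 + δ) :
    Tendsto u l (𝓝 0) := by
  set K' := max K 1
  have hK' : 0 < K' := lt_of_lt_of_le one_pos (le_max_right _ _)
  have key : ∀ n : ℕ, ∀ᶠ i in l, u i ≤ K' * (3 / 4) ^ n := by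
    intro n
    induction n with
    | zero =>
      filter_upwards [hb] with i hi
      rw [pow_zero, mul_one]; exact hi.trans (le_max_left _ _)
    | succ n ih =>
      have hpos : 0 < K' * (3 / 4 : ℝ) ^ n := by positivity
      filter_upwards [h _ hpos.le ih (K' * (3 / 4) ^ n / 4) (by positivity)] with i hi
      refine hi.trans_eq ?_
      rw [pow_succ]; ring
  have hlim : Tendsto (fun n : ℕ => K' * (3 / 4 : ℝ) ^ n) atTop (𝓝 0) := by
    simpa using (tendsto_pow_atTop_nhds_zero_of_lt_one (r := (3 / 4 : ℝ)) (by norm_num)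
      (by norm_num)).const_mul K'
  rw [Metric.tendsto_nhds]
  intro ε hε
  obtain ⟨n, hn⟩ := (hlim.eventually_lt_const hε).exists
  filter_upwards [key n] with i hi
  rw [Real.dist_eq, sub_zero, abs_of_nonneg (hu0 i)]
  linarith

variable {ι : Type*} {l : Filter ι} {σ : ι → ι}

lemma eventually_iterate (hσ : Tendsto σ l l) {p : ι → Prop} (h : ∀ᶠ i in l, p i) (N : ℕ) :
    ∀ᶠ i in l, ∀ a < N, p (σ^[a + 1] i) := by
  rw [show (∀ᶠ i in l, ∀ a < N, p (σ^[a + 1] i)) ↔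
    ∀ᶠ i in l, ∀ a ∈ Finset.range N, p (σ^[a + 1] i) by simp only [Finset.mem_range]]
  rw [Filter.eventually_all_finset]
  exact fun a _ => (hσ.iterate (a + 1)).eventually h

/-- The product `S (σ i) ⋯ S (σ^j i)`. -/
def shiftProd (σ : ι → ι) (S : ι → ℂ) (j : ℕ) (i : ι) : ℂ :=
  ∏ a ∈ Finset.range j, S (σ^[a + 1] i)

lemma norm_shiftProd_le {S : ι → ℂ} {j : ℕ} {i : ι} (h : ∀ a < j, ‖S (σ^[a + 1] i)‖ ≤ 1) :
    ‖shiftProd σ S j i‖ ≤ 1 := by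
  rw [shiftProd, norm_prod]
  exact Finset.prod_le_one (fun _ _ => norm_nonneg _) fun a ha => h a (Finset.mem_range.1 ha)

lemma norm_shiftProd_sub_le {S : ι → ℂ} {j : ℕ} {i : ι} {ζ : ℂ} {C : ℝ} (hζ : ‖ζ‖ ≤ 1)
    (h : ∀ a < j, ‖S (σ^[a + 1] i)‖ ≤ 1) (hC : ∀ a < j, ‖S (σ^[a + 1] i) - ζ‖ ≤ C) :
    ‖shiftProd σ S j i - ζ ^ j‖ ≤ j * C := by
  induction j with
  | zero => simp [shiftProd]
  | succ k ih =>
    have ih' := ih (fun a ha => h a (by omega)) (fun a ha => hC a (by omega))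
    have hp := norm_shiftProd_le (σ := σ) (fun a (ha : a < k) => h a (by omega))
    have h1 : shiftProd σ S (k + 1) i - ζ ^ (k + 1) =
        shiftProd σ S k i * (S (σ^[k + 1] i) - ζ) + (shiftProd σ S k i - ζ ^ k) * ζ := by
      rw [shiftProd, Finset.prod_range_succ, ← shiftProd]; ring
    rw [h1]
    refine (norm_add_le _ _).trans ?_
    rw [norm_mul, norm_mul]
    have h2 := hC k (by omega)
    have h3 : ‖shiftProd σ S k i‖ * ‖S (σ^[k + 1] i) - ζ‖ ≤ C :=
      (mul_le_of_le_one_left (norm_nonneg _) hp).trans h2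
    have h4 : ‖shiftProd σ S k i - ζ ^ k‖ * ‖ζ‖ ≤ k * C :=
      (mul_le_of_le_one_right (norm_nonneg _) hζ).trans ih'
    push_cast
    linarith

variable {m : ℕ} {B ρ : ℝ} {b : ℕ → ι → ℝ} {β : ℕ → ℝ} {S q : ι → ℂ} {x ζ Q : ℂ}

/-- Contraction argument: approximate solutions of the fixed point equation for the ratios converge
to the fixed point. -/
lemma tendsto_ratio (hσ : Tendsto σ l l) (hB0 : 0 ≤ B) (hB : ∀ j < m - 1, |β j| ≤ B) (hρ1 : 1 ≤ ρ)
    (hρ : 2 * B * m ^ 2 ≤ ρ) (hb : ∀ j < m - 1, Tendsto (b j) l (𝓝 (β j)))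
    (hS : ∀ᶠ i in l, ‖S i‖ ≤ ρ⁻¹) (hζ : ‖ζ‖ ≤ ρ⁻¹)
    (hrec : ∀ᶠ i in l, S i * (x - ∑ j ∈ Finset.range (m - 1), b j i * shiftProd σ S j i) = 1)
    (hfix : ζ * (x - ∑ j ∈ Finset.range (m - 1), β j * ζ ^ j) = 1) :
    Tendsto S l (𝓝 ζ) := by
  have hρ0 : 0 < ρ := by linarith
  have hle1 : ρ⁻¹ ≤ 1 := inv_le_one_of_one_le₀ hρ1
  have hS1 : ∀ᶠ i in l, ‖S i‖ ≤ 1 := hS.mono fun i hi => hi.trans hle1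
  rw [tendsto_iff_norm_sub_tendsto_zero]
  refine tendsto_zero_of_contraction (K := 2) (fun _ => norm_nonneg _) ?_ ?_
  · filter_upwards [hS1] with i hi
    have := norm_sub_le (S i) ζ
    linarith
  intro C hC0 hC δ hδ
  have hsum : Tendsto (fun i => ∑ j ∈ Finset.range (m - 1), |b j i - β j|) l (𝓝 0) := by
    have : Tendsto (fun i => ∑ j ∈ Finset.range (m - 1), |b j i - β j|) l
        (𝓝 (∑ j ∈ Finset.range (m - 1), |β j - β j|)) :=
      tendsto_finsetSum _ fun j hj => ((hb j (Finset.mem_range.1 hj)).sub_const _).abs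
    simpa using this
  filter_upwards [hS, hrec, eventually_iterate hσ hS1 m, eventually_iterate hσ hC m,
    hsum.eventually_le_const hδ] with i h1 h2 h3 h4 h5
  -- Subtracting the two fixed point equations leaves the small prefactor S ζ, which yields the
  -- contraction factor m²B/ρ ≤ 1/2.
  have hkey : S i - ζ = S i * ζ *
      ∑ j ∈ Finset.range (m - 1), (b j i * shiftProd σ S j i - β j * ζ ^ j) := by
    rw [Finset.sum_sub_distrib]
    linear_combination ζ * h2 - S i * hfix
  have hterm : ∀ j ∈ Finset.range (m - 1), ‖(b j i * shiftProd σ S j i - β j * ζ ^ j : ℂ)‖ ≤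
      |b j i - β j| + B * (m * C) := by
    intro j hj
    have hj' := Finset.mem_range.1 hj
    have e1 : (b j i * shiftProd σ S j i - β j * ζ ^ j : ℂ) =
        ((b j i - β j : ℝ) : ℂ) * shiftProd σ S j i + β j * (shiftProd σ S j i - ζ ^ j) := by
      push_cast; ring
    rw [e1]
    refine (norm_add_le _ _).trans ?_
    rw [norm_mul, norm_mul, Complex.norm_real, Complex.norm_real, Real.norm_eq_abs,
      Real.norm_eq_abs]
    refine add_le_add ?_ ?_
    · exact mul_le_of_le_one_right (abs_nonneg _)
        (norm_shiftProd_le fun a ha => h3 a (by omega))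
    · refine mul_le_mul (hB j hj') ?_ (norm_nonneg _) hB0
      refine (norm_shiftProd_sub_le (hζ.trans hle1) (fun a ha => h3 a (by omega))
        (fun a ha => h4 a (by omega))).trans ?_
      refine mul_le_mul_of_nonneg_right ?_ hC0
      exact_mod_cast (by omega : j ≤ m)
  have hT : ‖∑ j ∈ Finset.range (m - 1), (b j i * shiftProd σ S j i - β j * ζ ^ j : ℂ)‖ ≤
      δ + m * (B * (m * C)) := by
    refine (norm_sum_le_of_le _ hterm).trans ?_
    rw [Finset.sum_add_distrib]
    exact add_le_add h5 (sum_range_pred_le (m := m) (by positivity) fun _ _ => le_rfl)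
  rw [hkey, norm_mul, norm_mul]
  calc ‖S i‖ * ‖ζ‖ * ‖∑ j ∈ Finset.range (m - 1), (b j i * shiftProd σ S j i - β j * ζ ^ j : ℂ)‖
      ≤ ρ⁻¹ * 1 * (δ + m * (B * (m * C))) := by
        gcongr
        exact hζ.trans hle1
    _ = ρ⁻¹ * δ + ρ⁻¹ * (2 * B * m ^ 2) * C / 2 := by ring
    _ ≤ 1 * δ + ρ⁻¹ * ρ * C / 2 := by gcongr
    _ = C / 2 + δ := by rw [inv_mul_cancel₀ hρ0.ne']; ring

/-- The linear recursion for the logarithmic derivatives of the ratios. -/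
lemma tendsto_logDeriv_ratio (hσ : Tendsto σ l l) (hB0 : 0 ≤ B) (hB : ∀ j < m - 1, |β j| ≤ B)
    (hρ1 : 1 ≤ ρ)
    (hρ : 2 * (B + 1) * m ^ 2 ≤ ρ) (hb : ∀ j < m - 1, Tendsto (b j) l (𝓝 (β j)))
    (hS : ∀ᶠ i in l, ‖S i‖ ≤ ρ⁻¹) (hSζ : Tendsto S l (𝓝 ζ)) {K : ℝ}
    (hq : ∀ᶠ i in l, ‖q i‖ ≤ K)
    (hrec : ∀ᶠ i in l, q i = S i * (1 + ∑ j ∈ Finset.range (m - 1), b j i * shiftProd σ S j i *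
      ∑ a ∈ Finset.range j, q (σ^[a + 1] i)))
    (hfix : Q = ζ * (1 + ∑ j ∈ Finset.range (m - 1), β j * ζ ^ j * (j * Q))) :
    Tendsto q l (𝓝 Q) := by
  have hρ0 : 0 < ρ := by linarith
  have hle1 : ρ⁻¹ ≤ 1 := inv_le_one_of_one_le₀ hρ1
  have hS1 : ∀ᶠ i in l, ‖S i‖ ≤ 1 := hS.mono fun i hi => hi.trans hle1
  have hprod : ∀ j, Tendsto (shiftProd σ S j) l (𝓝 (ζ ^ j)) := by
    intro j
    have : Tendsto (shiftProd σ S j) l (𝓝 (∏ a ∈ Finset.range j, ζ)) :=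
      tendsto_finsetProd _ fun a _ => hSζ.comp (hσ.iterate (a + 1))
    simpa using this
  -- With the unknown q frozen at Q, the right-hand side already converges to Q; what remains is a
  -- homogeneous contraction.
  have hmain : Tendsto (fun i => S i * (1 + ∑ j ∈ Finset.range (m - 1),
      b j i * shiftProd σ S j i * (j * Q))) l (𝓝 Q) := by
    conv => rhs; rw [hfix]
    refine hSζ.mul (Tendsto.const_add _ (tendsto_finsetSum _ fun j hj => ?_))
    exact ((((Complex.continuous_ofReal.tendsto _).comp
      (hb j (Finset.mem_range.1 hj))).mul (hprod j)).mul_const _)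
  rw [tendsto_iff_norm_sub_tendsto_zero] at hmain ⊢
  refine tendsto_zero_of_contraction (K := K + ‖Q‖) (fun _ => norm_nonneg _) ?_ ?_
  · filter_upwards [hq] with i hi
    have := norm_sub_le (q i) Q
    linarith
  intro C hC0 hC δ hδ
  -- Only the limits are bounded by B; the coefficients themselves need the slack B + 1 that enters
  -- the condition on ρ.
  have hbB : ∀ᶠ i in l, ∀ j ∈ Finset.range (m - 1), |b j i| ≤ B + 1 := by
    rw [Filter.eventually_all_finset]
    intro j hj
    have hj' := Finset.mem_range.1 hj
    exact (hb j hj').abs.eventually_le_const (lt_of_le_of_lt (hB j hj') (by linarith))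
  filter_upwards [hS, hrec, eventually_iterate hσ hS1 m, eventually_iterate hσ hC m,
    hmain.eventually_le_const hδ, hbB] with i h1 h2 h3 h4 h5 h6
  set E := S i * (1 + ∑ j ∈ Finset.range (m - 1), b j i * shiftProd σ S j i * (j * Q)) - Q with hE
  have hkey : q i - Q = E + S i * ∑ j ∈ Finset.range (m - 1), b j i * shiftProd σ S j i *
      ∑ a ∈ Finset.range j, (q (σ^[a + 1] i) - Q) := by
    conv_lhs => rw [h2]
    simp only [Finset.sum_sub_distrib, Finset.sum_const, Finset.card_range, nsmul_eq_mul, mul_sub]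
    rw [hE]; ring
  have hT : ‖∑ j ∈ Finset.range (m - 1), b j i * shiftProd σ S j i *
      ∑ a ∈ Finset.range j, (q (σ^[a + 1] i) - Q)‖ ≤ m * ((B + 1) * (m * C)) := by
    refine (norm_sum_le _ _).trans (sum_range_pred_le (by positivity) fun j hj => ?_)
    rw [norm_mul, norm_mul, Complex.norm_real, Real.norm_eq_abs]
    refine mul_le_mul ?_ ?_ (norm_nonneg _) (by linarith)
    · calc |b j i| * ‖shiftProd σ S j i‖ ≤ (B + 1) * 1 :=
            mul_le_mul (h6 j (Finset.mem_range.2 hj))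
              (norm_shiftProd_le fun a ha => h3 a (by omega)) (norm_nonneg _) (by linarith)
        _ = B + 1 := mul_one _
    · refine (norm_sum_le_of_le (f := fun a => q (σ^[a + 1] i) - Q) (n := fun _ => C)
        (Finset.range j) fun a ha => h4 a (by have := Finset.mem_range.1 ha; omega)).trans ?_
      rw [Finset.sum_const, Finset.card_range, nsmul_eq_mul]
      refine mul_le_mul_of_nonneg_right ?_ hC0
      exact_mod_cast (by omega : j ≤ m)
  rw [hkey]
  refine (norm_add_le _ _).trans ?_
  rw [norm_mul]
  have hfin : ‖S i‖ * ‖∑ j ∈ Finset.range (m - 1), b j i * shiftProd σ S j i *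
      ∑ a ∈ Finset.range j, (q (σ^[a + 1] i) - Q)‖ ≤ C / 2 := by
    calc _ ≤ ρ⁻¹ * (m * ((B + 1) * (m * C))) := by gcongr
      _ = ρ⁻¹ * (2 * (B + 1) * m ^ 2) * C / 2 := by ring
      _ ≤ ρ⁻¹ * ρ * C / 2 := by gcongr
      _ = C / 2 := by rw [inv_mul_cancel₀ hρ0.ne', one_mul]
  linarith

end RatioAsymptotics

/-! ### The limit k/n → s and index shifts -/

section RatioFilter

lemma tendsto_fst_ratioFilter (s : ℝ) : Tendsto Prod.fst (ratioFilter s) atTop :=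
  tendsto_fst.mono_left inf_le_left

lemma tendsto_snd_ratioFilter (s : ℝ) : Tendsto Prod.snd (ratioFilter s) atTop :=
  tendsto_snd.mono_left inf_le_left

lemma tendsto_div_ratioFilter (s : ℝ) :
    Tendsto (fun p : ℕ × ℕ => (p.1 : ℝ) / (p.2 : ℝ)) (ratioFilter s) (𝓝 s) :=
  tendsto_comap.mono_left inf_le_right

lemma tendsto_ratioFilter_iff {ι : Type*} {l : Filter ι} {f : ι → ℕ × ℕ} {s : ℝ} :
    Tendsto f l (ratioFilter s) ↔ Tendsto (fun i => (f i).1) l atTop ∧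
      Tendsto (fun i => (f i).2) l atTop ∧
      Tendsto (fun i => ((f i).1 : ℝ) / ((f i).2 : ℝ)) l (𝓝 s) := by
  rw [ratioFilter, tendsto_inf, tendsto_comap_iff, tendsto_prod_iff', and_assoc]
  rfl

instance isCountablyGenerated_ratioFilter (s : ℝ) : (ratioFilter s).IsCountablyGenerated := by
  unfold ratioFilter; infer_instance

/-- The index shift `(k, n) ↦ (k - 1, n)`. -/
def predShift (p : ℕ × ℕ) : ℕ × ℕ := (p.1 - 1, p.2)

lemma iterate_predShift (a : ℕ) (p : ℕ × ℕ) : predShift^[a] p = (p.1 - a, p.2) := by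
  induction a generalizing p with
  | zero => rfl
  | succ a ih => rw [Function.iterate_succ_apply, ih, predShift]; simp only [Nat.sub_sub, add_comm]

lemma tendsto_predShift (s : ℝ) : Tendsto predShift (ratioFilter s) (ratioFilter s) := by
  refine tendsto_ratioFilter_iff.2 ⟨(tendsto_sub_atTop_nat 1).comp (tendsto_fst_ratioFilter s),
    tendsto_snd_ratioFilter s, ?_⟩
  have h1 : Tendsto (fun p : ℕ × ℕ => (p.1 : ℝ) / (p.2 : ℝ) - 1 / (p.2 : ℝ)) (ratioFilter s)
      (𝓝 (s - 0)) := (tendsto_div_ratioFilter s).sub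
        (tendsto_one_div_atTop_nhds_zero_nat.comp (tendsto_snd_ratioFilter s))
  rw [sub_zero] at h1
  refine h1.congr' ?_
  filter_upwards [(tendsto_fst_ratioFilter s).eventually_ge_atTop 1] with p hp
  simp only [predShift, Nat.cast_sub hp, Nat.cast_one]
  rw [sub_div]

end RatioFilter

/-! ### Recurrences for ratios and increments of logarithmic derivatives -/

section Recurrence

variable {m : ℕ}

/-- A doubly indexed family of polynomials satisfies the banded recurrence. -/
def SatisfiesRecurrence (m : ℕ) (b : ℕ → ℕ → ℕ → ℝ) (P : ℕ → ℕ → ℂ[X]) : Prop :=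
  ∀ n, 0 < n → ∀ k, X * P k n = P (k + 1) n +
    ∑ j ∈ Finset.range (m - 1), if j ≤ k then C (b j k n : ℂ) * P (k - j) n else 0

/-- The ratio of consecutive polynomials. -/
noncomputable def stepRatio (P : ℕ → ℕ → ℂ[X]) (x : ℂ) (p : ℕ × ℕ) : ℂ :=
  (P p.1 p.2).eval x / (P (p.1 + 1) p.2).eval x

/-- The logarithmic derivative of the polynomials. -/
noncomputable def polyLogDeriv (P : ℕ → ℕ → ℂ[X]) (x : ℂ) (p : ℕ × ℕ) : ℂ :=
  (derivative (P p.1 p.2)).eval x / (P p.1 p.2).eval x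

/-- The increment of the logarithmic derivative. -/
noncomputable def stepLogDeriv (P : ℕ → ℕ → ℂ[X]) (x : ℂ) (p : ℕ × ℕ) : ℂ :=
  polyLogDeriv P x (p.1 + 1, p.2) - polyLogDeriv P x p

variable {b : ℕ → ℕ → ℕ → ℝ} {P : ℕ → ℕ → ℂ[X]} {x : ℂ}

/-- The product telescopes; j ≤ k keeps the truncated subtraction of indices from interfering. -/
lemma shiftProd_stepRatio {n : ℕ} (hne : ∀ k, (P k n).eval x ≠ 0) {j k : ℕ} (hj : j ≤ k) :
    shiftProd predShift (stepRatio P x) j (k, n) = (P (k - j) n).eval x / (P k n).eval x := by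
  induction j with
  | zero => simp [shiftProd, hne k]
  | succ j ih =>
    rw [shiftProd, Finset.prod_range_succ, ← shiftProd, ih (by omega), iterate_predShift,
      stepRatio]
    simp only []
    rw [(by omega : k - (j + 1) + 1 = k - j)]
    have := hne (k - j)
    have := hne k
    field_simp

lemma sum_stepLogDeriv {n : ℕ} {j k : ℕ} (hj : j ≤ k) :
    ∑ a ∈ Finset.range j, stepLogDeriv P x (predShift^[a + 1] (k, n)) =
      polyLogDeriv P x (k, n) - polyLogDeriv P x (k - j, n) := by
  induction j with
  | zero => simp
  | succ j ih =>
    rw [Finset.sum_range_succ, ih (by omega), iterate_predShift, stepLogDeriv]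
    simp only []
    rw [(by omega : k - (j + 1) + 1 = k - j)]
    ring

lemma eval_recurrence (hP : SatisfiesRecurrence m b P) {n k : ℕ} (hn : 0 < n) (hk : m ≤ k) :
    x * (P k n).eval x = (P (k + 1) n).eval x +
      ∑ j ∈ Finset.range (m - 1), (b j k n : ℂ) * (P (k - j) n).eval x := by
  have h := congrArg (eval x) (hP n hn k)
  rw [eval_mul, eval_X, eval_add, eval_finsetSum] at h
  rw [h]
  congr 1
  refine Finset.sum_congr rfl fun j hj => ?_
  rw [if_pos (by have := Finset.mem_range.1 hj; omega), eval_mul, eval_C]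

lemma eval_derivative_recurrence (hP : SatisfiesRecurrence m b P) {n k : ℕ} (hn : 0 < n)
    (hk : m ≤ k) :
    (P k n).eval x + x * (derivative (P k n)).eval x = (derivative (P (k + 1) n)).eval x +
      ∑ j ∈ Finset.range (m - 1), (b j k n : ℂ) * (derivative (P (k - j) n)).eval x := by
  have h := congrArg (fun p => eval x (derivative p)) (hP n hn k)
  simp only [derivative_mul, derivative_X, derivative_add, derivative_sum, eval_add, eval_mul,
    eval_X, one_mul, eval_finsetSum] at h
  rw [h]
  congr 1
  refine Finset.sum_congr rfl fun j hj => ?_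
  rw [if_pos (by have := Finset.mem_range.1 hj; omega)]
  simp

lemma stepRatio_recurrence (hP : SatisfiesRecurrence m b P) {n k : ℕ} (hn : 0 < n) (hk : m ≤ k)
    (hne : ∀ k, (P k n).eval x ≠ 0) :
    stepRatio P x (k, n) * (x - ∑ j ∈ Finset.range (m - 1),
      (b j k n : ℂ) * shiftProd predShift (stepRatio P x) j (k, n)) = 1 := by
  have h := eval_recurrence (x := x) hP hn hk
  have h1 : ∑ j ∈ Finset.range (m - 1),
      (b j k n : ℂ) * shiftProd predShift (stepRatio P x) j (k, n) =
      (∑ j ∈ Finset.range (m - 1), (b j k n : ℂ) * (P (k - j) n).eval x) / (P k n).eval x := by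
    rw [Finset.sum_div]
    refine Finset.sum_congr rfl fun j hj => ?_
    rw [shiftProd_stepRatio hne (by have := Finset.mem_range.1 hj; omega), mul_div_assoc]
  have h2 := hne k
  have h3 := hne (k + 1)
  rw [h1, stepRatio]
  field_simp
  linear_combination h

/-- The recurrence times P_k' minus the differentiated recurrence times P_k; the differences of
logarithmic derivatives that appear telescope into increments. -/
lemma stepLogDeriv_recurrence (hP : SatisfiesRecurrence m b P) {n k : ℕ} (hn : 0 < n)
    (hk : m ≤ k) (hne : ∀ k, (P k n).eval x ≠ 0) :
    stepLogDeriv P x (k, n) = stepRatio P x (k, n) * (1 + ∑ j ∈ Finset.range (m - 1),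
      (b j k n : ℂ) * shiftProd predShift (stepRatio P x) j (k, n) *
        ∑ a ∈ Finset.range j, stepLogDeriv P x (predShift^[a + 1] (k, n))) := by
  have h := eval_recurrence (x := x) hP hn hk
  have h' := eval_derivative_recurrence (x := x) hP hn hk
  have h1 : ∑ j ∈ Finset.range (m - 1),
      (b j k n : ℂ) * shiftProd predShift (stepRatio P x) j (k, n) *
        ∑ a ∈ Finset.range j, stepLogDeriv P x (predShift^[a + 1] (k, n)) =
      ((∑ j ∈ Finset.range (m - 1), (b j k n : ℂ) * (P (k - j) n).eval x) *
        polyLogDeriv P x (k, n) -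
      ∑ j ∈ Finset.range (m - 1), (b j k n : ℂ) * (derivative (P (k - j) n)).eval x) /
        (P k n).eval x := by
    rw [Finset.sum_mul, ← Finset.sum_sub_distrib, Finset.sum_div]
    refine Finset.sum_congr rfl fun j hj => ?_
    have hjk : j ≤ k := by have := Finset.mem_range.1 hj; omega
    rw [shiftProd_stepRatio hne hjk, sum_stepLogDeriv hjk]
    have h2 := hne (k - j)
    have h3 := hne k
    simp only [polyLogDeriv]
    field_simp
  have h2 := hne k
  have h3 := hne (k + 1)
  rw [h1, stepLogDeriv, stepRatio]
  simp only [polyLogDeriv]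
  field_simp
  linear_combination (derivative (P k n)).eval x * h - (P k n).eval x * h'

/-- Ratio asymptotics for the logarithmic derivatives. -/
theorem tendsto_stepLogDeriv (hm : 3 ≤ m) {c : ℕ → ℝ} (hc : c (m - 2) ≠ 0) {B ρ : ℝ} (hB0 : 0 ≤ B)
    (hB : ∀ j < m - 1, |c j| ≤ B) (hρ1 : 1 ≤ ρ) (hρ : 2 * (B + 1) * m ^ 2 ≤ ρ)
    (hP : SatisfiesRecurrence m b P) {s : ℝ}
    (hb : ∀ j < m - 1, Tendsto (fun p : ℕ × ℕ => b j p.1 p.2) (ratioFilter s) (𝓝 (c j)))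
    (hx : dominanceRadius m B ρ < ‖x‖) (hne : ∀ n, 0 < n → ∀ k, (P k n).eval x ≠ 0)
    (hS : ∀ᶠ p in ratioFilter s, ‖stepRatio P x p‖ ≤ ρ⁻¹) {K : ℝ}
    (hq : ∀ᶠ p in ratioFilter s, ‖stepLogDeriv P x p‖ ≤ K) :
    Tendsto (stepLogDeriv P x) (ratioFilter s)
      (𝓝 ((symbolDeriv m c (z1 m c x))⁻¹ / z1 m c x)) := by
  have hρ' : 2 * B * m ^ 2 ≤ ρ := by nlinarith [sq_nonneg (m : ℝ)]
  have hz := le_norm_z1_of_large hm hB0 hB hρ1 hx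
  have hΓ := notMem_Gamma1_of_large hm hc hB0 hB hρ1 hρ' hx
  have hz0 := z1_ne_zero hm hc x
  have hd := symbolDeriv_z1_ne_zero hm hc hΓ
  have hA := symbolA_z1 hm hc x
  set z := z1 m c x
  have hζ : ‖z⁻¹‖ ≤ ρ⁻¹ := by
    rw [norm_inv]; exact inv_anti₀ (by linarith) hz
  have hpos : ∀ᶠ p in ratioFilter s, 0 < p.2 :=
    (tendsto_snd_ratioFilter s).eventually_gt_atTop 0
  have hlarge : ∀ᶠ p in ratioFilter s, m ≤ p.1 :=
    (tendsto_fst_ratioFilter s).eventually_ge_atTop m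
  have hfix1 : z⁻¹ * (x - ∑ j ∈ Finset.range (m - 1), c j * z⁻¹ ^ j) = 1 := by
    have : x - ∑ j ∈ Finset.range (m - 1), c j * z⁻¹ ^ j = z := by
      rw [symbolA] at hA
      simp only [div_eq_mul_inv, ← inv_pow] at hA
      linear_combination -hA
    rw [this, inv_mul_cancel₀ hz0]
  have hlim := tendsto_ratio (l := ratioFilter s) (σ := predShift) (m := m)
    (b := fun j p => b j p.1 p.2) (β := c) (S := stepRatio P x) (x := x) (ζ := z⁻¹)
    (tendsto_predShift s) hB0 hB hρ1 hρ' hb hS hζ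
    (by filter_upwards [hpos, hlarge] with p h1 h2 using stepRatio_recurrence hP h1 h2 (hne _ h1))
    hfix1
  refine tendsto_logDeriv_ratio (l := ratioFilter s) (σ := predShift) (m := m)
    (b := fun j p => b j p.1 p.2) (β := c) (S := stepRatio P x) (ζ := z⁻¹)
    (tendsto_predShift s) hB0 hB hρ1 hρ hb hS hlim hq
    (by filter_upwards [hpos, hlarge] with p h1 h2 using
      stepLogDeriv_recurrence hP h1 h2 (hne _ h1)) ?_
  -- Since ∑ j c_j z^(-j-1) = 1 - A'(z), the value 1/(z A'(z)) solves the linear fixed point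
  -- equation.
  have hsd : ∑ j ∈ Finset.range (m - 1), (c j : ℂ) * z⁻¹ ^ j * (j * ((symbolDeriv m c z)⁻¹ / z)) =
      (1 - symbolDeriv m c z) * (symbolDeriv m c z)⁻¹ := by
    rw [symbolDeriv, sub_sub_cancel, ← symbolDeriv, Finset.sum_mul]
    refine Finset.sum_congr rfl fun j _ => ?_
    rw [inv_pow, pow_succ]
    field_simp
  rw [hsd]
  field_simp
  ring

end Recurrence

/-! ### Bounds from interlacing zeros -/

section Interlacing

/-- Positivity of the residues for interlacing points. -/
lemma interlacing_weight_pos {k : ℕ} {a b : ℕ → ℝ} (ha : StrictMonoOn a (Set.Icc 1 (k + 1)))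
    (hab : ∀ j ∈ Set.Icc 1 k, a j < b j ∧ b j < a (j + 1)) {j : ℕ} (hj : j ∈ Finset.Icc 1 (k + 1)) :
    0 < (∏ i ∈ Finset.Icc 1 k, (a j - b i)) / ∏ i ∈ (Finset.Icc 1 (k + 1)).erase j, (a j - a i) := by
  have hj' := Finset.mem_Icc.1 hj
  -- Each b_i is paired with its neighbour a_i or a_{i+1} on the side away from a_j, so every
  -- quotient is positive.
  have hsplit : ∏ i ∈ (Finset.Icc 1 (k + 1)).erase j, (a j - a i) =
      ∏ i ∈ Finset.Icc 1 k, (a j - a (if i < j then i else i + 1)) := by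
    symm
    refine Finset.prod_bij (fun i _ => if i < j then i else i + 1) ?_ ?_ ?_ ?_
    · intro i hi
      have := Finset.mem_Icc.1 hi
      simp only [Finset.mem_erase, Finset.mem_Icc]
      split_ifs <;> omega
    · intro i hi i' hi' h
      split_ifs at h <;> omega
    · intro i hi
      simp only [Finset.mem_erase, Finset.mem_Icc] at hi
      by_cases h : i < j
      · exact ⟨i, Finset.mem_Icc.2 ⟨by omega, by omega⟩, if_pos h⟩
      · refine ⟨i - 1, Finset.mem_Icc.2 ⟨by omega, by omega⟩, ?_⟩
        rw [if_neg (by omega)]; omega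
    · intro i _; rfl
  rw [hsplit, ← Finset.prod_div_distrib]
  refine Finset.prod_pos fun i hi => ?_
  have hi' := Finset.mem_Icc.1 hi
  obtain ⟨h1, h2⟩ := hab i ⟨hi'.1, hi'.2⟩
  by_cases h : i < j
  · rw [if_pos h]
    have h3 : a (i + 1) ≤ a j := ha.monotoneOn ⟨by omega, by omega⟩ ⟨hj'.1, hj'.2⟩ h
    exact div_pos (by linarith) (by linarith)
  · rw [if_neg h]
    have h3 : a j ≤ a i := ha.monotoneOn ⟨hj'.1, hj'.2⟩ ⟨hi'.1, by omega⟩ (by omega)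
    exact div_pos_of_neg_of_neg (by linarith) (by linarith)

end Interlacing

section InterlacingBounds

variable {k : ℕ} {a b : ℕ → ℝ}

lemma eval_prod_X_sub_C (a : ℕ → ℝ) (k : ℕ) (x : ℂ) :
    (∏ j ∈ Finset.Icc 1 k, (X - C (a j : ℂ))).eval x = ∏ j ∈ Finset.Icc 1 k, (x - a j) := by
  rw [eval_prod]; simp

lemma sub_ofReal_ne_zero {x : ℂ} (hx : x ∈ upperHalf) (t : ℝ) : x - t ≠ 0 :=
  ne_zero_of_mem_upperHalf (ofReal_sub_mem_upperHalf hx t)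

lemma eval_prod_ne_zero (a : ℕ → ℝ) (k : ℕ) {x : ℂ} (hx : x ∈ upperHalf) :
    (∏ j ∈ Finset.Icc 1 k, (X - C (a j : ℂ))).eval x ≠ 0 := by
  rw [eval_prod_X_sub_C]
  exact Finset.prod_ne_zero_iff.2 fun j _ => sub_ofReal_ne_zero hx _

/-- Partial fractions of the quotient of two polynomials with interlacing zeros. -/
lemma exists_partialFractions (ha : StrictMonoOn a (Set.Icc 1 (k + 1)))
    (hab : ∀ j ∈ Set.Icc 1 k, a j < b j ∧ b j < a (j + 1)) :
    ∃ w : ℕ → ℝ, (∀ j ∈ Finset.Icc 1 (k + 1), 0 < w j) ∧ ∑ j ∈ Finset.Icc 1 (k + 1), w j = 1 ∧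
      ∀ x ∈ upperHalf, (∏ j ∈ Finset.Icc 1 k, (X - C (b j : ℂ))).eval x /
        (∏ j ∈ Finset.Icc 1 (k + 1), (X - C (a j : ℂ))).eval x =
          ∑ j ∈ Finset.Icc 1 (k + 1), w j * (x - a j)⁻¹ := by
  classical
  set s := Finset.Icc 1 (k + 1) with hs
  set w : ℕ → ℝ := fun j => (∏ i ∈ Finset.Icc 1 k, (a j - b i)) / ∏ i ∈ s.erase j, (a j - a i)
  set p : ℂ[X] := ∏ j ∈ Finset.Icc 1 k, (X - C (b j : ℂ)) with hp
  have hinj : Set.InjOn (fun j => (a j : ℂ)) (s : Set ℕ) := fun i hi j hj h =>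
    ha.injOn (by simpa [hs] using hi) (by simpa [hs] using hj) (Complex.ofReal_injective h)
  have hdeg : p.degree = k := by
    rw [hp, degree_prod]; simp
  have hpm : p.Monic := monic_prod_of_monic _ _ fun j _ => monic_X_sub_C _
  have hcard : s.card = k + 1 := by simp [hs]
  have hev : ∀ j, p.eval (a j : ℂ) = ∏ i ∈ Finset.Icc 1 k, ((a j : ℂ) - b i) := fun j =>
    eval_prod_X_sub_C b k _
  refine ⟨w, fun j hj => interlacing_weight_pos ha hab hj, ?_, fun x hx => ?_⟩
  -- The weights sum to the leading coefficient of the interpolated monic polynomial.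
  · have h := Lagrange.leadingCoeff_eq_sum hinj (P := p) (by rw [hcard, hdeg]; norm_cast)
    rw [hpm.leadingCoeff] at h
    have h2 : (1 : ℂ) = ((∑ j ∈ s, w j : ℝ) : ℂ) := by
      rw [h]
      push_cast
      refine Finset.sum_congr rfl fun j _ => ?_
      rw [hev]
      simp only [w]
      push_cast
      rfl
    exact_mod_cast h2.symm
  · have hnode : Lagrange.nodal s (fun j => (a j : ℂ)) = ∏ j ∈ s, (X - C (a j : ℂ)) :=
      Lagrange.nodal_eq _ _
    have h := Lagrange.eval_interpolate_not_at_node (s := s) (v := fun j => (a j : ℂ)) (x := x)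
      (fun i => p.eval (a i : ℂ)) (fun i _ h => sub_ofReal_ne_zero hx (a i) (sub_eq_zero.2 h))
    rw [← Lagrange.eq_interpolate hinj (f := p)
      (by rw [hcard, hdeg]; exact_mod_cast Nat.lt_succ_self k), hnode] at h
    rw [h, mul_div_cancel_left₀ _ (eval_prod_ne_zero a (k + 1) hx)]
    refine Finset.sum_congr rfl fun j _ => ?_
    rw [hev, Lagrange.nodalWeight, Finset.prod_inv_distrib]
    simp only [w]
    push_cast
    ring

/-- Quantitative consequences of interlacing in the upper half plane. -/
lemma interlacing_bounds (ha : StrictMonoOn a (Set.Icc 1 (k + 1)))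
    (hab : ∀ j ∈ Set.Icc 1 k, a j < b j ∧ b j < a (j + 1)) {p r : ℂ[X]}
    (hp : p = ∏ j ∈ Finset.Icc 1 k, (X - C (b j : ℂ)))
    (hr : r = ∏ j ∈ Finset.Icc 1 (k + 1), (X - C (a j : ℂ))) {x : ℂ} (hx : x ∈ upperHalf) :
    ‖p.eval x / r.eval x‖ ≤ x.im⁻¹ ∧
      ‖(derivative r).eval x / r.eval x - (derivative p).eval x / p.eval x‖ ≤ x.im⁻¹ := by
  have hx0 : 0 < x.im := hx
  obtain ⟨w, hw, hw1, hsum⟩ := exists_partialFractions ha hab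
  rw [← hp, ← hr] at hsum
  have hp0 : p.eval x ≠ 0 := by rw [hp]; exact eval_prod_ne_zero b k hx
  have hr0 : r.eval x ≠ 0 := by rw [hr]; exact eval_prod_ne_zero a (k + 1) hx
  set s := Finset.Icc 1 (k + 1)
  set T : ℂ := ∑ j ∈ s, w j * (x - a j)⁻¹ with hT
  have hTx : p.eval x / r.eval x = T := hsum x hx
  have hT0 : T ≠ 0 := by rw [← hTx]; exact div_ne_zero hp0 hr0
  -- With positive weights, |T'| ≤ ∑ w_j/|x - a_j|² = -Im T/Im x ≤ |T|/Im x, which bounds T'/T, the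
  -- negative of the second quantity.
  have him : -T.im = x.im * ∑ j ∈ s, w j * (Complex.normSq (x - a j))⁻¹ := by
    rw [hT, Complex.im_sum, ← Finset.sum_neg_distrib, Finset.mul_sum]
    refine Finset.sum_congr rfl fun j _ => ?_
    rw [Complex.im_ofReal_mul, Complex.inv_im]
    simp only [Complex.sub_im, Complex.ofReal_im, sub_zero]
    ring
  have hd1 : HasDerivAt (fun y => p.eval y / r.eval y)
      (((derivative p).eval x * r.eval x - p.eval x * (derivative r).eval x) / r.eval x ^ 2) x :=
    (p.hasDerivAt x).div (r.hasDerivAt x) hr0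
  have hd2 : HasDerivAt (fun y : ℂ => ∑ j ∈ s, w j * (y - a j)⁻¹)
      (∑ j ∈ s, w j * (-1 / (x - a j) ^ 2)) x := by
    refine HasDerivAt.fun_sum fun j _ => HasDerivAt.const_mul _ ?_
    exact ((hasDerivAt_id x).sub_const (a j : ℂ)).fun_inv (sub_ofReal_ne_zero hx _)
  have hd3 := hd2.unique (hd1.congr_of_eventuallyEq (by
    filter_upwards [isOpen_upperHalf.mem_nhds hx] with y hy using (hsum y hy).symm))
  have hDnorm : ‖∑ j ∈ s, (w j : ℂ) * (-1 / (x - a j) ^ 2)‖ ≤ ‖T‖ * x.im⁻¹ := by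
    have h1 : ‖∑ j ∈ s, (w j : ℂ) * (-1 / (x - a j) ^ 2)‖ ≤
        ∑ j ∈ s, w j * (Complex.normSq (x - a j))⁻¹ := by
      refine norm_sum_le_of_le _ fun j hj => ?_
      rw [norm_mul, Complex.norm_real, Real.norm_eq_abs, abs_of_pos (hw j hj), norm_div, norm_neg,
        norm_one, norm_pow, Complex.normSq_eq_norm_sq, one_div]
    have h2 : ∑ j ∈ s, w j * (Complex.normSq (x - a j))⁻¹ = -T.im * x.im⁻¹ := by
      rw [him]; field_simp
    rw [h2] at h1
    refine h1.trans (mul_le_mul_of_nonneg_right ?_ (by positivity))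
    exact (neg_le_abs _).trans (Complex.abs_im_le_norm T)
  refine ⟨?_, ?_⟩
  · rw [hTx, hT]
    calc ‖∑ j ∈ s, (w j : ℂ) * (x - a j)⁻¹‖ ≤ ∑ j ∈ s, w j * x.im⁻¹ := by
          refine norm_sum_le_of_le _ fun j hj => ?_
          rw [norm_mul, Complex.norm_real, Real.norm_eq_abs, abs_of_pos (hw j hj)]
          exact mul_le_mul_of_nonneg_left (norm_inv_sub_le hx _) (hw j hj).le
      _ = x.im⁻¹ := by rw [← Finset.sum_mul, hw1, one_mul]
  · have h4 : (derivative r).eval x / r.eval x - (derivative p).eval x / p.eval x =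
        -((∑ j ∈ s, (w j : ℂ) * (-1 / (x - a j) ^ 2)) / T) := by
      rw [hd3, ← hTx]
      field_simp
      ring
    rw [h4, norm_neg, norm_div, div_le_iff₀ (norm_pos_iff.2 hT0), mul_comm]
    exact hDnorm

end InterlacingBounds

/-! ### Integration against counting measures -/

section CountingMeasure

lemma isProbabilityMeasure_normalizedCounting {E : Type*} [MeasurableSpace E] {S : Multiset E}
    (hS : S.card ≠ 0) : IsProbabilityMeasure (normalizedCounting S) := by
  constructor
  have h : ∀ T : Multiset E, (T.map Measure.dirac).sum Set.univ = T.card := by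
    intro T
    induction T using Multiset.induction_on with
    | empty => simp
    | cons a T ih => simp [ih, add_comm]
  rw [normalizedCounting, Measure.smul_apply, h, smul_eq_mul,
    ENNReal.inv_mul_cancel (by exact_mod_cast hS) (ENNReal.natCast_ne_top _)]

lemma integral_normalizedCounting {E F : Type*} [MeasurableSpace E] [MeasurableSingletonClass E]
    [NormedAddCommGroup F] [NormedSpace ℝ F] [CompleteSpace F] (S : Multiset E) (f : E → F) :
    ∫ x, f x ∂(normalizedCounting S) = (S.card : ℝ)⁻¹ • (S.map f).sum := by
  have h : ∀ T : Multiset E, Integrable f (T.map Measure.dirac).sum ∧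
      ∫ x, f x ∂(T.map Measure.dirac).sum = (T.map f).sum := by
    intro T
    induction T using Multiset.induction_on with
    | empty => simp
    | cons a T ih =>
      have hd : Integrable f (Measure.dirac a) := integrable_dirac (by simp)
      simp only [Multiset.map_cons, Multiset.sum_cons]
      exact ⟨hd.add_measure ih.1, by rw [integral_add_measure hd ih.1, integral_dirac, ih.2]⟩
  rw [normalizedCounting, integral_smul_measure, (h S).2]
  simp

end CountingMeasure

/-! ### Characteristic polynomials of Toeplitz matrices -/

section ToeplitzPoly

/-- The characteristic polynomials of the Toeplitz matrices, generated by their recurrence. -/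
noncomputable def toeplitzPoly (m : ℕ) (c : ℕ → ℝ) : ℕ → ℂ[X]
  | 0 => 1
  | k + 1 => X * toeplitzPoly m c k -
      ∑ j ∈ Finset.range (m - 1), if j ≤ k then C (c j : ℂ) * toeplitzPoly m c (k - j) else 0
  decreasing_by all_goals omega

variable {m : ℕ} {c : ℕ → ℝ}

lemma toeplitzPoly_zero : toeplitzPoly m c 0 = 1 := by rw [toeplitzPoly]

lemma toeplitzPoly_succ (k : ℕ) : toeplitzPoly m c (k + 1) = X * toeplitzPoly m c k -
    ∑ j ∈ Finset.range (m - 1), if j ≤ k then C (c j : ℂ) * toeplitzPoly m c (k - j) else 0 := by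
  rw [toeplitzPoly]

lemma satisfiesRecurrence_toeplitzPoly :
    SatisfiesRecurrence m (fun j _ _ => c j) (fun k _ => toeplitzPoly m c k) := by
  intro n _ k
  simp only [toeplitzPoly_succ, sub_add_cancel]

/-- By the recurrence the vector (D₀, …, D_k) is annihilated by every row except the last, where the
missing superdiagonal entry leaves D_{k+1}. -/
lemma sum_mul_charmatrix_toeplitz (hm : 3 ≤ m) (k : ℕ) (i : Fin (k + 1)) :
    ∑ j : Fin (k + 1), toeplitzPoly m c j • (toeplitz m c (k + 1)).charmatrix i j =
      if (i : ℕ) = k then toeplitzPoly m c (k + 1) else 0 := by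
  have hentry : ∀ j : Fin (k + 1), toeplitzPoly m c j • (toeplitz m c (k + 1)).charmatrix i j =
      (if j = i then X * toeplitzPoly m c i else 0) -
      (if (j : ℕ) = i + 1 then toeplitzPoly m c (i + 1) else 0) -
      (if (j : ℕ) ≤ i ∧ (i : ℕ) - j ≤ m - 2 then
        C (c ((i : ℕ) - j) : ℂ) * toeplitzPoly m c j else 0) := by
    intro j
    rw [Matrix.charmatrix_apply, toeplitz, Matrix.of_apply, Matrix.diagonal_apply, smul_eq_mul]
    by_cases h1 : j = i
    · subst h1
      simp
      ring
    · rw [if_neg (Ne.symm h1), if_neg h1]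
      by_cases h2 : (j : ℕ) = i + 1
      · simp [h2]
      · by_cases h3 : (j : ℕ) ≤ i ∧ (i : ℕ) - j ≤ m - 2
        · simp only [h2, h3, if_false, and_self, if_true]
          ring
        · simp only [h2, h3, if_false]
          simp
  rw [Finset.sum_congr rfl fun j _ => hentry j, Finset.sum_sub_distrib, Finset.sum_sub_distrib,
    Finset.sum_ite_eq' Finset.univ i, if_pos (Finset.mem_univ _)]
  have h1 : ∑ j : Fin (k + 1), (if (j : ℕ) = i + 1 then toeplitzPoly m c (i + 1) else 0) =
      if (i : ℕ) = k then 0 else toeplitzPoly m c (i + 1) := by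
    rw [Fin.sum_univ_eq_sum_range
      (fun j => if j = (i : ℕ) + 1 then toeplitzPoly m c (i + 1) else 0) (k + 1),
      Finset.sum_ite_eq']
    have := i.2
    by_cases h : (i : ℕ) = k
    · rw [if_neg (by simp [h]), if_pos h]
    · rw [if_pos (by simp; omega), if_neg h]
  have h2 : ∑ j : Fin (k + 1), (if (j : ℕ) ≤ i ∧ (i : ℕ) - j ≤ m - 2 then
        C (c ((i : ℕ) - j) : ℂ) * toeplitzPoly m c j else 0) =
      ∑ j ∈ Finset.range (m - 1), if j ≤ (i : ℕ) then
        C (c j : ℂ) * toeplitzPoly m c (i - j) else 0 := by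
    rw [Fin.sum_univ_eq_sum_range (fun j => if j ≤ (i : ℕ) ∧ (i : ℕ) - j ≤ m - 2 then
        C (c ((i : ℕ) - j) : ℂ) * toeplitzPoly m c j else 0) (k + 1),
      ← Finset.sum_filter, ← Finset.sum_filter]
    have := i.2
    refine Finset.sum_nbij' (fun j => (i : ℕ) - j) (fun j => (i : ℕ) - j) ?_ ?_ ?_ ?_ ?_
    · intro a ha; simp only [Finset.mem_filter, Finset.mem_range] at ha ⊢; omega
    · intro a ha; simp only [Finset.mem_filter, Finset.mem_range] at ha ⊢; omega
    · intro a ha; simp only [Finset.mem_filter, Finset.mem_range] at ha ⊢; omega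
    · intro a ha; simp only [Finset.mem_filter, Finset.mem_range] at ha ⊢; omega
    · intro a ha
      simp only [Finset.mem_filter, Finset.mem_range] at ha ⊢
      rw [(by omega : (i : ℕ) - (i - a) = a)]
  rw [h1, h2]
  have h3 := toeplitzPoly_succ (m := m) (c := c) i
  by_cases h : (i : ℕ) = k
  · have h4 : toeplitzPoly m c (k + 1) = toeplitzPoly m c (i + 1) := by rw [h]
    rw [if_pos h, if_pos h, h4, h3]
    ring
  · rw [if_neg h, if_neg h, h3]
    ring

/-- The first column is replaced by the combination of columns with weights D_j, which preserves the
determinant since D₀ = 1. Only the bottom entry D_{k+1} survives, and its minor is triangular with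
-1 on the diagonal; the signs cancel. -/
lemma charpoly_toeplitz (hm : 3 ≤ m) (n : ℕ) :
    (toeplitz m c n).charpoly = toeplitzPoly m c n := by
  cases n with
  | zero => rw [toeplitzPoly_zero, Matrix.charpoly, Matrix.det_fin_zero]
  | succ k =>
    have h := Matrix.det_updateCol_sum (toeplitz m c (k + 1)).charmatrix 0
      (fun j : Fin (k + 1) => toeplitzPoly m c j)
    rw [Fin.val_zero, toeplitzPoly_zero, one_smul] at h
    rw [Matrix.charpoly, ← h, Matrix.det_succ_column_zero, Finset.sum_eq_single (Fin.last k)]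
    · have hlow : ((((toeplitz m c (k + 1)).charmatrix.updateCol 0 fun i => ∑ j : Fin (k + 1),
          toeplitzPoly m c j • (toeplitz m c (k + 1)).charmatrix i j).submatrix
          (Fin.last k).succAbove Fin.succ)).det = (-1) ^ k := by
        have hent : ∀ i j : Fin k, (((toeplitz m c (k + 1)).charmatrix.updateCol 0 fun i =>
            ∑ j : Fin (k + 1), toeplitzPoly m c j •
              (toeplitz m c (k + 1)).charmatrix i j).submatrix
            (Fin.last k).succAbove Fin.succ) i j =
            (toeplitz m c (k + 1)).charmatrix i.castSucc j.succ := by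
          intro i j
          rw [Matrix.submatrix_apply, Matrix.updateCol_ne (Fin.succ_ne_zero j),
            Fin.succAbove_last]
        rw [Matrix.det_of_isLowerTriangular]
        · rw [Finset.prod_congr rfl (g := fun _ => (-1 : ℂ[X]))]
          · simp
          · intro i _
            rw [hent, Matrix.charmatrix_apply_ne _ _ _ (by
              intro h; have := congrArg Fin.val h; simp at this)]
            simp [toeplitz]
        · intro i j hij
          have hij' : i < j := hij
          have hij2 : (i : ℕ) < j := hij'
          rw [hent, Matrix.charmatrix_apply_ne _ _ _ (by
            intro h; have := congrArg Fin.val h; simp at this; omega)]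
          rw [toeplitz, Matrix.of_apply, if_neg (by simp; omega), if_neg (by simp; omega)]
          simp
      rw [hlow, Matrix.updateCol_self, sum_mul_charmatrix_toeplitz hm, if_pos (by simp)]
      rw [Fin.val_last, mul_right_comm, ← mul_pow]
      simp
    · intro i _ hi
      rw [Matrix.updateCol_self, sum_mul_charmatrix_toeplitz hm, if_neg]
      · simp
      · intro h
        exact hi (Fin.ext (by simpa using h))
    · simp

end ToeplitzPoly

/-! ### Stieltjes transforms of the eigenvalue distributions -/

section ToeplitzStieltjes

variable {m : ℕ} {c : ℕ → ℝ} {B ρ : ℝ} {x : ℂ}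

/-- As long as earlier values are no larger than the current one, the lower terms cost at most mB
times it, and the factor |x| - mB ≥ ρ remains. -/
lemma toeplitzPoly_growth (hB0 : 0 ≤ B) (hB : ∀ j < m - 1, |c j| ≤ B) (hρ : 1 ≤ ρ)
    (hx : ρ + m * B ≤ ‖x‖) (k : ℕ) :
    ρ * ‖(toeplitzPoly m c k).eval x‖ ≤ ‖(toeplitzPoly m c (k + 1)).eval x‖ := by
  induction k using Nat.strong_induction_on with
  | _ k ih =>
    have hmono : ∀ j ≤ k, ‖(toeplitzPoly m c (k - j)).eval x‖ ≤ ‖(toeplitzPoly m c k).eval x‖ := by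
      intro j
      induction j with
      | zero => intro _; simp
      | succ j ihj =>
        intro hj
        refine le_trans ?_ (ihj (by omega))
        have := ih (k - (j + 1)) (by omega)
        rw [(by omega : k - (j + 1) + 1 = k - j)] at this
        exact le_trans (le_mul_of_one_le_left (norm_nonneg _) hρ) this
    rw [toeplitzPoly_succ, eval_sub, eval_mul, eval_X, eval_finsetSum]
    set N := ‖(toeplitzPoly m c k).eval x‖ with hN
    have hN0 : 0 ≤ N := norm_nonneg _
    have h1 : ‖∑ j ∈ Finset.range (m - 1), eval x (if j ≤ k then
        C (c j : ℂ) * toeplitzPoly m c (k - j) else 0)‖ ≤ m * (B * N) := by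
      refine (norm_sum_le _ _).trans (sum_range_pred_le (by positivity) fun j hj => ?_)
      split_ifs with hjk
      · rw [eval_mul, eval_C, norm_mul, Complex.norm_real, Real.norm_eq_abs]
        exact mul_le_mul (hB j hj) (hmono j hjk) (norm_nonneg _) hB0
      · rw [eval_zero, norm_zero]; positivity
    have h2 := norm_sub_norm_le (x * (toeplitzPoly m c k).eval x) (∑ j ∈ Finset.range (m - 1),
      eval x (if j ≤ k then C (c j : ℂ) * toeplitzPoly m c (k - j) else 0))
    rw [norm_mul, ← hN] at h2
    nlinarith [mul_le_mul_of_nonneg_right hx hN0]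

lemma eval_toeplitzPoly_ne_zero (hB0 : 0 ≤ B) (hB : ∀ j < m - 1, |c j| ≤ B) (hρ : 1 ≤ ρ)
    (hx : ρ + m * B ≤ ‖x‖) (k : ℕ) : (toeplitzPoly m c k).eval x ≠ 0 := by
  induction k with
  | zero => simp [toeplitzPoly_zero]
  | succ k ih =>
    have h := toeplitzPoly_growth hB0 hB hρ hx k
    have : 0 < ρ * ‖(toeplitzPoly m c k).eval x‖ := mul_pos (by linarith) (norm_pos_iff.2 ih)
    exact norm_pos_iff.1 (this.trans_le h)

lemma norm_stepRatio_toeplitzPoly_le (hB0 : 0 ≤ B) (hB : ∀ j < m - 1, |c j| ≤ B) (hρ : 1 ≤ ρ)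
    (hx : ρ + m * B ≤ ‖x‖) (p : ℕ × ℕ) :
    ‖stepRatio (fun k _ => toeplitzPoly m c k) x p‖ ≤ ρ⁻¹ := by
  have h := toeplitzPoly_growth hB0 hB hρ hx p.1
  have h1 := norm_pos_iff.2 (eval_toeplitzPoly_ne_zero hB0 hB hρ hx (p.1 + 1))
  rw [stepRatio, norm_div, div_le_iff₀ h1, inv_mul_eq_div, le_div_iff₀' (by linarith)]
  exact h

lemma exists_norm_stepLogDeriv_toeplitzPoly_le (hB0 : 0 ≤ B) (hB : ∀ j < m - 1, |c j| ≤ B)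
    (hρ1 : 1 ≤ ρ) (hρ : 2 * (B + 1) * m ^ 2 ≤ ρ) (hm : 3 ≤ m) (hx : ρ + m * B ≤ ‖x‖) :
    ∃ K, ∀ p, ‖stepLogDeriv (fun k _ => toeplitzPoly m c k) x p‖ ≤ K := by
  set Q : ℕ → ℕ → ℂ[X] := fun k _ => toeplitzPoly m c k with hQ
  -- The sum covers the indices below m, where the full recurrence is not available; beyond them the
  -- bound reproduces itself because 1 + m²BK ≤ ρK for K ≥ 1.
  set K := 1 + ∑ k ∈ Finset.range m, ‖stepLogDeriv Q x (k, 1)‖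
  have hK : 1 ≤ K := le_add_of_nonneg_right (Finset.sum_nonneg fun _ _ => norm_nonneg _)
  refine ⟨K, fun p => ?_⟩
  have hp : stepLogDeriv Q x p = stepLogDeriv Q x (p.1, 1) := rfl
  rw [hp]
  generalize p.1 = k
  induction k using Nat.strong_induction_on with
  | _ k ih =>
    by_cases hk : k < m
    · have := Finset.single_le_sum (f := fun k => ‖stepLogDeriv Q x (k, 1)‖)
        (fun _ _ => norm_nonneg _) (Finset.mem_range.2 hk)
      exact this.trans (by simp only [K]; linarith)
    · push Not at hk
      have hne := fun k => eval_toeplitzPoly_ne_zero hB0 hB hρ1 hx k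
      have hS := norm_stepRatio_toeplitzPoly_le hB0 hB hρ1 hx
      have hS1 : ∀ p, ‖stepRatio Q x p‖ ≤ 1 := fun p => (hS p).trans (inv_le_one_of_one_le₀ hρ1)
      rw [stepLogDeriv_recurrence satisfiesRecurrence_toeplitzPoly one_pos hk hne]
      have h1 : ‖∑ j ∈ Finset.range (m - 1), ((c j : ℝ) : ℂ) *
          shiftProd predShift (stepRatio Q x) j (k, 1) *
          ∑ a ∈ Finset.range j, stepLogDeriv Q x (predShift^[a + 1] (k, 1))‖ ≤
          m * (B * (m * K)) := by
        refine (norm_sum_le _ _).trans (sum_range_pred_le (by positivity) fun j hj => ?_)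
        rw [norm_mul, norm_mul, Complex.norm_real, Real.norm_eq_abs]
        have h2 : ‖∑ a ∈ Finset.range j, stepLogDeriv Q x (predShift^[a + 1] (k, 1))‖ ≤ m * K := by
          refine (norm_sum_le_of_le (f := fun a => stepLogDeriv Q x (predShift^[a + 1] (k, 1)))
            (n := fun _ => K) _ fun a ha => ?_).trans ?_
          · rw [iterate_predShift]
            exact ih _ (by have := Finset.mem_range.1 ha; simp only []; omega)
          · rw [Finset.sum_const, Finset.card_range, nsmul_eq_mul]
            have : (j : ℝ) ≤ m := by exact_mod_cast (by omega : j ≤ m)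
            exact mul_le_mul_of_nonneg_right this (by linarith)
        have h3 := norm_shiftProd_le (σ := predShift) (S := stepRatio Q x) (j := j) (i := (k, 1))
          fun a _ => hS1 _
        refine mul_le_mul ?_ h2 (norm_nonneg _) hB0
        calc |c j| * _ ≤ B * 1 := mul_le_mul (hB j hj) h3 (norm_nonneg _) hB0
          _ = B := mul_one B
      rw [norm_mul]
      calc _ ≤ ρ⁻¹ * (1 + m * (B * (m * K))) := by
            refine mul_le_mul (hS _) ?_ (norm_nonneg _) (by positivity)
            exact (norm_add_le _ _).trans (by rw [norm_one]; exact add_le_add_right h1 _)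
        _ ≤ K := by
            rw [inv_mul_le_iff₀ (by linarith)]
            have hm1 : (1 : ℝ) ≤ (m : ℝ) ^ 2 := one_le_pow₀ (by exact_mod_cast (by omega : 1 ≤ m))
            have : 1 + B * m ^ 2 ≤ ρ := by nlinarith
            nlinarith

/-- The Toeplitz polynomials ignore the second index, so the diagonal converts the two-index limit
into an ordinary one. -/
lemma tendsto_of_limit_eq_self : Tendsto (fun k : ℕ => (k, k)) atTop (ratioFilter 1) := by
  rw [tendsto_ratioFilter_iff]
  refine ⟨tendsto_id, tendsto_id, tendsto_const_nhds.congr' ?_⟩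
  filter_upwards [eventually_gt_atTop 0] with k hk
  rw [div_self (by exact_mod_cast hk.ne')]

lemma polyLogDeriv_eq_sum {P : ℕ → ℕ → ℂ[X]} {n : ℕ} (h0 : P 0 n = 1) (k : ℕ) :
    polyLogDeriv P x (k, n) = ∑ i ∈ Finset.range k, stepLogDeriv P x (i, n) := by
  simp only [stepLogDeriv]
  rw [Finset.sum_range_sub (fun i => polyLogDeriv P x (i, n)), polyLogDeriv]
  simp [polyLogDeriv, h0]

lemma card_roots_toeplitzPoly (hm : 3 ≤ m) (n : ℕ) : (toeplitzPoly m c n).roots.card = n := by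
  rw [← charpoly_toeplitz hm, Polynomial.splits_iff_card_roots.1 (IsAlgClosed.splits _),
    Matrix.charpoly_natDegree_eq_dim, Fintype.card_fin]

lemma integral_inv_sub_roots {p : ℂ[X]} (hx : p.eval x ≠ 0) :
    ∫ t : ℂ, (x - t)⁻¹ ∂(normalizedCounting p.roots) =
      (p.roots.card : ℝ)⁻¹ • ((derivative p).eval x / p.eval x) := by
  rw [integral_normalizedCounting,
    (IsAlgClosed.splits p).eval_derivative_div_eval_of_ne_zero hx]
  simp only [one_div]

/-- The Stieltjes transforms of the eigenvalue distributions converge near infinity, and the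
eigenvalues are bounded. -/
lemma exists_tendsto_stieltjes_toeplitz (hm : 3 ≤ m) (hc : c (m - 2) ≠ 0) : ∃ R : ℝ, 0 ≤ R ∧
    (∀ n, ∀ z ∈ (toeplitzPoly m c n).roots, ‖z‖ ≤ R) ∧
    ∀ x : ℂ, R < ‖x‖ → Tendsto (fun n : ℕ =>
      ∫ t : ℂ, (x - t)⁻¹ ∂(normalizedCounting (toeplitzPoly m c n).roots)) atTop
      (𝓝 ((symbolDeriv m c (z1 m c x))⁻¹ / z1 m c x)) := by
  obtain ⟨B, -, hB0, hB, -, -⟩ := exists_coeff_bound m c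
  set ρ : ℝ := 2 * (B + 1) * m ^ 2 with hρ
  have hm1 : (1 : ℝ) ≤ (m : ℝ) ^ 2 := one_le_pow₀ (by exact_mod_cast (by omega : 1 ≤ m))
  have hρ1 : 1 ≤ ρ := by nlinarith
  refine ⟨max (ρ + m * B) (dominanceRadius m B ρ), le_max_of_le_left (by positivity), ?_, ?_⟩
  · intro n z hz
    by_contra! hlt
    exact eval_toeplitzPoly_ne_zero hB0 hB hρ1 ((le_max_left _ _).trans hlt.le) n
      (isRoot_of_mem_roots hz)
  · intro x hx
    have hx1 := (le_max_left _ _).trans hx.le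
    have hx2 := (le_max_right _ _).trans_lt hx
    have hne := eval_toeplitzPoly_ne_zero hB0 hB hρ1 hx1
    obtain ⟨K, hK⟩ := exists_norm_stepLogDeriv_toeplitzPoly_le hB0 hB hρ1 le_rfl hm hx1
    have h := tendsto_stepLogDeriv hm hc hB0 hB hρ1 le_rfl satisfiesRecurrence_toeplitzPoly
      (s := 1) (fun j _ => tendsto_const_nhds) hx2 (fun n _ k => hne k)
      (Eventually.of_forall (norm_stepRatio_toeplitzPoly_le hB0 hB hρ1 hx1))
      (Eventually.of_forall hK)
    refine ((h.comp tendsto_of_limit_eq_self).cesaro_smul).congr fun n => ?_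
    rw [integral_inv_sub_roots (hne n), card_roots_toeplitzPoly hm]
    congr 1
    exact (polyLogDeriv_eq_sum (P := fun k _ => toeplitzPoly m c k) (n := n)
      toeplitzPoly_zero n).symm

end ToeplitzStieltjes

/-! ### Products of geometric series -/

section GeometricProducts

variable {κ : Type*} {s : Finset κ} {a : κ → ℂ}

/-- The formal power series of `1 / (1 - a t)`. -/
noncomputable def geomSeries (a : ℂ) : PowerSeries ℂ := PowerSeries.mk fun n => a ^ n

lemma geomSeries_mul (a : ℂ) :
    geomSeries a * (1 - PowerSeries.C a * PowerSeries.X) = 1 := by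
  ext n
  rw [mul_sub, mul_one, mul_comm (PowerSeries.C a), ← mul_assoc, map_sub,
    PowerSeries.coeff_mul_C]
  cases n with
  | zero => simp [geomSeries]
  | succ n => simp [geomSeries, PowerSeries.coeff_succ_mul_X, PowerSeries.coeff_one, pow_succ]

lemma rescale_geomSeries (a w : ℂ) : PowerSeries.rescale w (geomSeries a) = geomSeries (a * w) := by
  ext n
  rw [PowerSeries.coeff_rescale, geomSeries, geomSeries, PowerSeries.coeff_mk,
    PowerSeries.coeff_mk, mul_pow, mul_comm]

lemma norm_coeff_prod_geomSeries_le {r : ℝ} (ha : ∀ j ∈ s, ‖a j‖ ≤ r) (hr : 0 ≤ r) (i : ℕ) :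
    ‖PowerSeries.coeff i (∏ j ∈ s, geomSeries (a j))‖ ≤ ((i : ℝ) + 1) ^ s.card * r ^ i := by
  classical
  induction s using Finset.induction_on generalizing i with
  | empty =>
    cases i with
    | zero => simp
    | succ i => simp [PowerSeries.coeff_one]; positivity
  | insert j s hj ih =>
    rw [Finset.prod_insert hj, PowerSeries.coeff_mul, Finset.card_insert_of_notMem hj]
    calc ‖∑ p ∈ Finset.HasAntidiagonal.antidiagonal i, PowerSeries.coeff p.1 (geomSeries (a j)) *
          PowerSeries.coeff p.2 (∏ j ∈ s, geomSeries (a j))‖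
        ≤ ∑ p ∈ Finset.HasAntidiagonal.antidiagonal i, ((i : ℝ) + 1) ^ s.card * r ^ i := by
          refine norm_sum_le_of_le _ fun p hp => ?_
          have hp' := Finset.HasAntidiagonal.mem_antidiagonal.1 hp
          have h1 := ih (fun j hj => ha j (Finset.mem_insert_of_mem hj)) p.2
          have h2 : (p.2 : ℝ) ≤ i := by exact_mod_cast (by omega : p.2 ≤ i)
          rw [norm_mul, geomSeries, PowerSeries.coeff_mk, norm_pow]
          calc ‖a j‖ ^ p.1 * _ ≤ r ^ p.1 * (((i : ℝ) + 1) ^ s.card * r ^ p.2) := by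
                refine mul_le_mul (pow_le_pow_left₀ (norm_nonneg _)
                  (ha j (Finset.mem_insert_self _ _)) _) (h1.trans ?_) (norm_nonneg _)
                  (by positivity)
                gcongr
            _ = ((i : ℝ) + 1) ^ s.card * r ^ i := by rw [← hp', pow_add]; ring
      _ = ((i : ℝ) + 1) ^ (s.card + 1) * r ^ i := by
          rw [Finset.sum_const, Finset.Nat.card_antidiagonal, nsmul_eq_mul]
          push_cast
          ring

lemma hasSum_coeff_prod_geomSeries (ha : ∀ j ∈ s, ‖a j‖ < 1) :
    Summable (fun i => ‖PowerSeries.coeff i (∏ j ∈ s, geomSeries (a j))‖) ∧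
      ∑' i, PowerSeries.coeff i (∏ j ∈ s, geomSeries (a j)) = ∏ j ∈ s, (1 - a j)⁻¹ := by
  classical
  induction s using Finset.induction_on with
  | empty =>
    have h : ∀ i ≠ 0, PowerSeries.coeff i (1 : PowerSeries ℂ) = 0 := fun i hi => by
      rw [PowerSeries.coeff_one, if_neg hi]
    simp only [Finset.prod_empty]
    refine ⟨(hasSum_single 0 fun i hi => by rw [h i hi, norm_zero]).summable, ?_⟩
    rw [tsum_eq_single 0 h]
    simp
  | insert j s hj ih =>
    obtain ⟨h1, h2⟩ := ih fun j hj => ha j (Finset.mem_insert_of_mem hj)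
    have hj1 := ha j (Finset.mem_insert_self _ _)
    have h3 : Summable fun i => ‖PowerSeries.coeff i (geomSeries (a j))‖ := by
      simp only [geomSeries, PowerSeries.coeff_mk, norm_pow]
      exact summable_geometric_of_lt_one (norm_nonneg _) hj1
    have h4 : ∑' i, PowerSeries.coeff i (geomSeries (a j)) = (1 - a j)⁻¹ := by
      simp only [geomSeries, PowerSeries.coeff_mk]
      exact tsum_geometric_of_norm_lt_one hj1
    simp only [Finset.prod_insert hj, PowerSeries.coeff_mul]
    generalize ∏ j ∈ s, geomSeries (a j) = G at h1 h2 ⊢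
    generalize geomSeries (a j) = H at h3 h4 ⊢
    have h5 := summable_norm_sum_mul_antidiagonal_of_summable_norm (R := ℂ)
      (f := fun i => PowerSeries.coeff i H) (g := fun i => PowerSeries.coeff i G) h3 h1
    have h6 := tsum_mul_tsum_eq_tsum_sum_antidiagonal_of_summable_norm (R := ℂ)
      (f := fun i => PowerSeries.coeff i H) (g := fun i => PowerSeries.coeff i G) h3 h1
    rw [h2, h4] at h6
    exact ⟨h5, h6.symm⟩

lemma summable_succ_pow_mul_geometric (N : ℕ) {θ : ℝ} (h0 : 0 ≤ θ) (h1 : θ < 1) :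
    Summable fun i : ℕ => ((i : ℝ) + 1) ^ N * θ ^ i := by
  have hθ : 0 < (θ + 1) / 2 := by linarith
  have h := (summable_nat_add_iff 1).2 (summable_pow_mul_geometric_of_norm_lt_one N
    (r := (θ + 1) / 2) (by rw [Real.norm_eq_abs, abs_of_pos hθ]; linarith))
  have h' := h.mul_right ((θ + 1) / 2)⁻¹
  refine Summable.of_nonneg_of_le (fun i => by positivity) (fun i => ?_) h'
  rw [pow_succ, ← mul_assoc, mul_inv_cancel_right₀ hθ.ne']
  push_cast
  gcongr
  linarith

/-- The partial sums of a product of geometric series are bounded away from zero. -/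
lemma exists_sum_coeff_prod_geomSeries_ne_zero (N : ℕ) {θ : ℝ} (h0 : 0 ≤ θ) (h1 : θ < 1) :
    ∃ n₀ : ℕ, ∀ n ≥ n₀, ∀ (s : Finset κ) (a : κ → ℂ), s.card = N → (∀ j ∈ s, ‖a j‖ ≤ θ) →
      ∑ i ∈ Finset.range (n + 1), PowerSeries.coeff i (∏ j ∈ s, geomSeries (a j)) ≠ 0 := by
  set e : ℕ → ℝ := fun i => ((i : ℝ) + 1) ^ N * θ ^ i with he
  have hes : Summable e := summable_succ_pow_mul_geometric N h0 h1
  have htail := (tendsto_sum_nat_add e).eventually_lt_const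
    (show (0 : ℝ) < (2 ^ N)⁻¹ by positivity)
  obtain ⟨n₀, hn₀⟩ := eventually_atTop.1 htail
  refine ⟨n₀, fun n hn s a hs ha h => ?_⟩
  obtain ⟨hsum, htot⟩ := hasSum_coeff_prod_geomSeries fun j hj => (ha j hj).trans_lt h1
  have hsplit := hsum.of_norm.sum_add_tsum_nat_add (n + 1)
  rw [h, zero_add, htot] at hsplit
  have hle : ‖∏ j ∈ s, (1 - a j)⁻¹‖ ≤ ∑' i, e (i + (n + 1)) := by
    rw [← hsplit]
    refine tsum_of_norm_bounded ((summable_nat_add_iff (n + 1)).2 hes).hasSum fun i => ?_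
    have := norm_coeff_prod_geomSeries_le ha h0 (i + (n + 1))
    rwa [hs] at this
  -- If a partial sum vanished, the tail would equal the full product, which is at least 2^(-N) in
  -- modulus, while the uniform tail bound is smaller.
  have hge : (2 ^ N)⁻¹ ≤ ‖∏ j ∈ s, (1 - a j)⁻¹‖ := by
    rw [Finset.prod_inv_distrib, norm_inv, norm_prod]
    have hpos : 0 < ∏ j ∈ s, ‖1 - a j‖ := Finset.prod_pos fun j hj => by
      rw [norm_pos_iff, sub_ne_zero]
      intro h2
      have := ha j hj
      rw [← h2, norm_one] at this
      linarith
    refine inv_anti₀ hpos ?_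
    rw [← hs, ← Finset.prod_const]
    refine Finset.prod_le_prod (fun _ _ => norm_nonneg _) fun j hj => ?_
    have := norm_sub_le 1 (a j)
    rw [norm_one] at this
    linarith [ha j hj]
  linarith [hn₀ (n + 1) (by omega)]

end GeometricProducts

/-! ### Eigenvalue-free compact sets off Γ₁ -/

section ZeroFree

variable {m : ℕ} {c : ℕ → ℝ} {x : ℂ} {z : ℕ → ℂ}

lemma IsOrderedSolutions.reversed_eq (hm : 3 ≤ m) (hz : IsOrderedSolutions m c x z) :
    (1 : ℂ[X]) - C x * X + ∑ j ∈ Finset.range (m - 1), C (c j : ℂ) * X ^ (j + 1) =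
      ∏ j ∈ Finset.Icc 1 (m - 1), (1 - C (z j) * X) := by
  refine Polynomial.eq_of_infinite_eval_eq _ _ (Set.Infinite.mono (s := {0}ᶜ) ?_
    (Set.finite_singleton (0 : ℂ)).infinite_compl)
  intro t ht
  have ht0 : t ≠ 0 := ht
  have h := hz.1 t⁻¹ (inv_ne_zero ht0)
  rw [symbolA] at h
  have h2 : ∏ j ∈ Finset.Icc 1 (m - 1), (1 - z j * t) =
      t ^ (m - 1) * ∏ j ∈ Finset.Icc 1 (m - 1), (t⁻¹ - z j) := by
    have : t ^ (m - 1) = ∏ j ∈ Finset.Icc 1 (m - 1), t := by simp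
    rw [this, ← Finset.prod_mul_distrib]
    refine Finset.prod_congr rfl fun j _ => ?_
    field_simp
  change eval t _ = eval t _
  rw [eval_prod]
  simp only [eval_add, eval_sub, eval_mul, eval_one, eval_C, eval_X, eval_finsetSum, eval_pow]
  rw [h2, ← h, (by omega : m - 1 = m - 2 + 1), ← mul_assoc, pow_succ t,
    mul_right_comm (t ^ (m - 2)) t, ← mul_pow, mul_inv_cancel₀ ht0, one_pow, one_mul, mul_sub, mul_add, mul_inv_cancel₀ ht0,
    Finset.mul_sum]
  have : ∀ j ∈ Finset.range (m - 2 + 1), (c j : ℂ) * t ^ (j + 1) = t * (c j / t⁻¹ ^ j) := by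
    intro j _
    rw [inv_pow, div_inv_eq_mul]
    ring
  rw [Finset.sum_congr rfl this]
  ring

/-- The recurrence says that the generating function times the reversed polynomial is 1, and the
reversed polynomial factors as ∏ (1 - z_j t). -/
lemma mk_toeplitzPoly_eq (hm : 3 ≤ m) (hz : IsOrderedSolutions m c x z) :
    (PowerSeries.mk fun n => (toeplitzPoly m c n).eval x) =
      ∏ j ∈ Finset.Icc 1 (m - 1), geomSeries (z j) := by
  set F : PowerSeries ℂ := PowerSeries.mk fun n => (toeplitzPoly m c n).eval x with hF
  have hD := congrArg (Polynomial.coeToPowerSeries.ringHom (R := ℂ)) (hz.reversed_eq hm)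
  simp only [map_add, map_sub, map_mul, map_one, map_sum, map_prod, map_pow,
    Polynomial.coeToPowerSeries.ringHom_apply, Polynomial.coe_C, Polynomial.coe_X] at hD
  have h1 : F * ∏ j ∈ Finset.Icc 1 (m - 1), (1 - PowerSeries.C (z j) * PowerSeries.X) = 1 := by
    rw [← hD]
    ext n
    rw [mul_add, mul_sub, mul_one, Finset.mul_sum, map_add, map_sub, map_sum]
    simp only [mul_left_comm F (PowerSeries.C _), PowerSeries.coeff_C_mul,
      PowerSeries.coeff_mul_X_pow']
    cases n with
    | zero => simp [hF, toeplitzPoly_zero]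
    | succ n =>
      simp only [PowerSeries.coeff_succ_mul_X, hF, PowerSeries.coeff_mk, toeplitzPoly_succ,
        eval_sub, eval_mul, eval_X, eval_finsetSum, PowerSeries.coeff_one,
        Nat.succ_ne_zero, if_false, Nat.add_le_add_iff_right, Nat.add_sub_add_right]
      have : ∀ j ∈ Finset.range (m - 1), (c j : ℂ) * (if j ≤ n then
          (toeplitzPoly m c (n - j)).eval x else 0) = eval x (if j ≤ n then
          C (c j : ℂ) * toeplitzPoly m c (n - j) else 0) := by
        intro j _
        split_ifs <;> simp
      rw [Finset.sum_congr rfl this]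
      ring
  have h2 : (∏ j ∈ Finset.Icc 1 (m - 1), geomSeries (z j)) *
      ∏ j ∈ Finset.Icc 1 (m - 1), (1 - PowerSeries.C (z j) * PowerSeries.X) = 1 := by
    rw [← Finset.prod_mul_distrib]
    exact Finset.prod_eq_one fun j _ => geomSeries_mul _
  calc F = F * ((∏ j ∈ Finset.Icc 1 (m - 1), geomSeries (z j)) *
        ∏ j ∈ Finset.Icc 1 (m - 1), (1 - PowerSeries.C (z j) * PowerSeries.X)) := by
          rw [h2, mul_one]
    _ = (F * ∏ j ∈ Finset.Icc 1 (m - 1), (1 - PowerSeries.C (z j) * PowerSeries.X)) *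
        ∏ j ∈ Finset.Icc 1 (m - 1), geomSeries (z j) := by ring
    _ = _ := by rw [h1, one_mul]

/-- Rescaling t by 1/z₁ turns the dominant factor into ∑ tⁿ, and multiplication by that series forms
partial sums of coefficients. -/
lemma eval_toeplitzPoly_eq (hm : 3 ≤ m) (hz : IsOrderedSolutions m c x z) (h1 : z 1 ≠ 0) (n : ℕ) :
    (z 1)⁻¹ ^ n * (toeplitzPoly m c n).eval x = ∑ i ∈ Finset.range (n + 1),
      PowerSeries.coeff i (∏ j ∈ Finset.Icc 2 (m - 1), geomSeries (z j * (z 1)⁻¹)) := by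
  have h := congrArg (fun F => PowerSeries.coeff n (PowerSeries.rescale (z 1)⁻¹ F))
    (mk_toeplitzPoly_eq hm hz)
  simp only [PowerSeries.coeff_rescale, PowerSeries.coeff_mk, map_prod, rescale_geomSeries] at h
  rw [h, ← Finset.insert_Icc_add_one_left_eq_Icc (by omega : 1 ≤ m - 1),
    Finset.prod_insert (by simp), mul_inv_cancel₀ h1, mul_comm, PowerSeries.coeff_mul,
    Finset.Nat.sum_antidiagonal_eq_sum_range_succ_mk]
  simp [geomSeries]

/-- Away from `Γ₁` the Toeplitz matrices have no eigenvalues eventually. -/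
lemma eventually_eval_toeplitzPoly_ne_zero (hm : 3 ≤ m) (hc : c (m - 2) ≠ 0) {K : Set ℂ}
    (hK : IsCompact K) (hd : ∀ x ∈ K, x ∉ Gamma1 m c) :
    ∀ᶠ n in atTop, ∀ x ∈ K, (toeplitzPoly m c n).eval x ≠ 0 := by
  obtain ⟨θ, hθ0, hθ1, hθ⟩ := exists_uniform_ratio hm hc hK hd
  obtain ⟨n₀, hn₀⟩ := exists_sum_coeff_prod_geomSeries_ne_zero (κ := ℕ) (Finset.Icc 2 (m - 1)).card
    hθ0 hθ1
  filter_upwards [eventually_ge_atTop n₀] with n hn x hx h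
  obtain ⟨z, hz, -⟩ := z1_spec hm c x
  have hz1 : z 1 ≠ 0 := hz.ne_zero hm hc (Finset.mem_Icc.2 ⟨le_rfl, by omega⟩)
  refine hn₀ n hn (Finset.Icc 2 (m - 1)) (fun j => z j * (z 1)⁻¹) rfl (fun j hj => ?_) ?_
  · have hj' := Finset.mem_Icc.1 hj
    have h2 : ‖z j‖ ≤ ‖z 2‖ := hz.2 (Set.mem_Icc.2 ⟨by omega, by omega⟩)
      (Set.mem_Icc.2 ⟨by omega, by omega⟩) hj'.1
    rw [norm_mul, norm_inv, ← div_eq_mul_inv, div_le_iff₀ (norm_pos_iff.2 hz1)]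
    exact h2.trans (hθ x hx z hz)
  · rw [← eval_toeplitzPoly_eq hm hz hz1, h, mul_zero]

end ZeroFree

/-! ### Weak limit of the eigenvalue distributions -/

section ToeplitzLimit

/-- Moving points close to the real axis to their real parts does not change the limit of the
integrals of continuous functions. -/
lemma tendsto_integral_sub_integral_re {ι F : Type*} [NormedAddCommGroup F] [NormedSpace ℝ F]
    [CompleteSpace F] {l : Filter ι} {S : ι → Multiset ℂ} {R : ℝ} (hR : ∀ᶠ i in l, ∀ z ∈ S i, ‖z‖ ≤ R)
    (him : ∀ δ > 0, ∀ᶠ i in l, ∀ z ∈ S i, |z.im| < δ) {h : ℂ → F}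
    (hh : ContinuousOn h (Metric.closedBall 0 R)) :
    Tendsto (fun i => ∫ z, h z ∂(normalizedCounting (S i)) -
      ∫ t : ℝ, h t ∂(normalizedCounting ((S i).map Complex.re))) l (𝓝 0) := by
  have huc := (isCompact_closedBall (0 : ℂ) R).uniformContinuousOn_of_continuous hh
  rw [Metric.uniformContinuousOn_iff] at huc
  rw [Metric.tendsto_nhds]
  intro ε hε
  obtain ⟨δ, hδ, hδε⟩ := huc (ε / 2) (by linarith)
  filter_upwards [hR, him δ hδ] with i h1 h2
  rw [dist_zero_right, integral_normalizedCounting, integral_normalizedCounting,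
    Multiset.card_map, Multiset.map_map, ← smul_sub, ← Multiset.sum_map_sub, norm_smul, norm_inv,
    Real.norm_natCast]
  have h3 : ‖((S i).map fun z => h z - (fun t : ℝ => h t) z.re).sum‖ ≤
      (S i).card * (ε / 2) := by
    refine (norm_multiset_sum_le _).trans ?_
    rw [Multiset.map_map]
    refine (Multiset.sum_le_card_nsmul _ (ε / 2) ?_).trans (by
      rw [Multiset.card_map, nsmul_eq_mul])
    intro r hr
    obtain ⟨z, hz, rfl⟩ := Multiset.mem_map.1 hr
    have h4 : ‖(z.re : ℂ)‖ ≤ R := by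
      rw [Complex.norm_real]
      exact (Complex.abs_re_le_norm z).trans (h1 z hz)
    have h5 : dist z (z.re : ℂ) < δ := by
      have : z - z.re = z.im * Complex.I := by
        apply Complex.ext <;> simp
      rw [dist_eq_norm, this, norm_mul, Complex.norm_I, mul_one, Complex.norm_real]
      exact h2 z hz
    have := hδε z (by simpa using h1 z hz) z.re (by simpa using h4) h5
    rw [dist_eq_norm] at this
    exact this.le
  calc _ ≤ ((S i).card : ℝ)⁻¹ * ((S i).card * (ε / 2)) :=
        mul_le_mul_of_nonneg_left h3 (by positivity)
    _ ≤ ε / 2 := by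
        rw [← mul_assoc]
        exact mul_le_of_le_one_left (by linarith) inv_mul_le_one
    _ < ε := by linarith

/-- The eigenvalue distributions of the Toeplitz matrices converge weakly to `μ₁`. -/
theorem weakLimit_toeplitz {m : ℕ} {c : ℕ → ℝ} (hm : 3 ≤ m) (hc : c (m - 2) ≠ 0)
    (hΓ : ∀ w ∈ Gamma1 m c, w.im = 0) :
    WeakLimit (fun n => normalizedCounting (toeplitz m c n).charpoly.roots) atTop
      ((mu1 m c).map (fun y : ℝ => (y : ℂ))) := by
  simp only [charpoly_toeplitz hm]
  obtain ⟨R, hR0, hroots, hst⟩ := exists_tendsto_stieltjes_toeplitz hm hc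
  have hprob := isProbabilityMeasure_mu1 hm hc hΓ
  set S : ℕ → Multiset ℂ := fun n => (toeplitzPoly m c n).roots
  have hR : ∀ᶠ n in atTop, ∀ z ∈ S n, ‖z‖ ≤ R := Eventually.of_forall hroots
  -- The part of the disc with |Im z| ≥ δ is compact and misses the real set Γ₁.
  have him : ∀ δ > 0, ∀ᶠ n in atTop, ∀ z ∈ S n, |z.im| < δ := by
    intro δ hδ
    have hK : IsCompact (Metric.closedBall (0 : ℂ) R ∩ {z | δ ≤ |z.im|}) :=
      (isCompact_closedBall _ _).inter_right
        (isClosed_le continuous_const Complex.continuous_im.abs)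
    filter_upwards [eventually_eval_toeplitzPoly_ne_zero hm hc hK fun x hx =>
      notMem_Gamma1_of_im_ne_zero hΓ fun h0 => by
        have : δ ≤ |x.im| := hx.2
        rw [h0, abs_zero] at this
        linarith] with n hn z hz
    by_contra! hlt
    exact hn z ⟨by simpa using hroots n z hz, hlt⟩ (isRoot_of_mem_roots hz)
  have hweak : WeakLimit (fun n => normalizedCounting ((S n).map Complex.re)) atTop (mu1 m c) := by
    refine weakLimit_of_tendsto_stieltjes (R := R) ?_ fun x hx hxR => ?_
    · filter_upwards [eventually_gt_atTop 0] with n hn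
      refine isProbabilityMeasure_normalizedCounting ?_
      rw [Multiset.card_map, card_roots_toeplitzPoly hm]
      exact hn.ne'
    · have hxn : R < ‖x‖ := hxR.trans_le ((le_abs_self _).trans (Complex.abs_im_le_norm x))
      have h1 := tendsto_integral_sub_integral_re hR him (h := fun t => (x - t)⁻¹)
        ((continuousOn_const.sub continuousOn_id).inv₀ fun t ht h0 => by
          have : ‖t‖ ≤ R := by simpa using ht
          have h0 := sub_eq_zero.1 (show x - t = 0 from h0)
          rw [h0] at hxn
          exact absurd hxn (not_lt.2 this))
      have h2 := (hst x hxn).sub h1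
      rw [sub_zero] at h2
      rw [integral_inv_sub_mu1 hm hc hΓ hx]
      exact h2.congr fun n => sub_sub_cancel _ _
  intro f
  have h1 := tendsto_integral_sub_integral_re hR him (h := f) f.continuous.continuousOn
  have h2 := hweak (f.compContinuous ⟨fun y : ℝ => (y : ℂ), Complex.continuous_ofReal⟩)
  have h3 := h1.add h2
  rw [zero_add] at h3
  rw [integral_map Complex.continuous_ofReal.measurable.aemeasurable
    f.continuous.aestronglyMeasurable]
  exact h3.congr fun n => sub_add_cancel _ _

end ToeplitzLimit

/-! ### Measurable dependence of μ₁ on s -/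

section Measurability

variable {m : ℕ} {β : ℕ → ℝ → ℝ}

lemma continuousOn_z1_param (hm : 3 ≤ m) (hβ : ∀ j < m - 1, ContinuousOn (β j) (Set.Ioi 0))
    (hne : ∀ s : ℝ, 0 < s → β (m - 2) s ≠ 0)
    (hΓ : ∀ s : ℝ, 0 < s → ∀ w ∈ Gamma1 m (fun j => β j s), w.im = 0) {x : ℂ}
    (hx : x ∈ upperHalf) :
    ContinuousOn (fun s => z1 m (fun j => β j s) x) (Set.Ioi 0) := fun s hs =>
  tendsto_z1 hm (c := fun j => β j s) (hne s hs) (notMem_Gamma1_of_mem_upperHalf (hΓ s hs) hx)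
    (fun j hj => hβ j hj s hs) tendsto_const_nhds

open Classical in
/-- The family `μ₁^s` for `s > 0`, extended by a Dirac measure. -/
noncomputable def mu1Family (m : ℕ) (β : ℕ → ℝ → ℝ) (s : ℝ) : Measure ℝ :=
  if 0 < s then mu1 m (fun j => β j s) else Measure.dirac 0

lemma mu1Family_of_pos {s : ℝ} (hs : 0 < s) : mu1Family m β s = mu1 m (fun j => β j s) :=
  if_pos hs

lemma isProbabilityMeasure_mu1Family (hm : 3 ≤ m) (hne : ∀ s : ℝ, 0 < s → β (m - 2) s ≠ 0)
    (hΓ : ∀ s : ℝ, 0 < s → ∀ w ∈ Gamma1 m (fun j => β j s), w.im = 0) (s : ℝ) :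
    IsProbabilityMeasure (mu1Family m β s) := by
  rw [mu1Family]
  split_ifs with hs
  · exact isProbabilityMeasure_mu1 hm (hne s hs) (hΓ s hs)
  · infer_instance

lemma add_mul_I_mem_upperHalf (a : ℝ) {r : ℝ} (hr : 0 < r) :
    (a : ℂ) + (r : ℂ) * Complex.I ∈ upperHalf := by
  change 0 < ((a : ℂ) + (r : ℂ) * Complex.I).im
  rw [Complex.add_im, Complex.im_ofReal_mul]
  simpa using hr

lemma tendsto_angle_shift {c : ℕ → ℝ} (hm : 3 ≤ m) (hc : c (m - 2) ≠ 0)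
    (hΓ : ∀ w ∈ Gamma1 m c, w.im = 0) (a : ℝ) :
    Tendsto (fun n : ℕ => Complex.arg (-Complex.I *
      z1 m c (a + ((1 / ((n : ℝ) + 1) : ℝ) : ℂ) * Complex.I))) atTop (𝓝 (angle m c a)) := by
  have hcont := continuousOn_angle hm hc hΓ a (ofReal_mem_closedUpperHalf a)
  have hmem : ∀ n : ℕ, (a + ((1 / ((n : ℝ) + 1) : ℝ) : ℂ) * Complex.I) ∈ upperHalf := by
    intro n
    exact add_mul_I_mem_upperHalf a (by positivity)
  have hlim : Tendsto (fun n : ℕ => (a + ((1 / ((n : ℝ) + 1) : ℝ) : ℂ) * Complex.I)) atTop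
      (𝓝[closedUpperHalf] (a : ℂ)) := by
    refine tendsto_nhdsWithin_iff.2 ⟨?_, Eventually.of_forall fun n => upperHalf_subset (hmem n)⟩
    have h1 := (Complex.continuous_ofReal.tendsto 0).comp
      (tendsto_one_div_add_atTop_nhds_zero_nat (𝕜 := ℝ))
    have h2 := (h1.mul_const Complex.I).const_add (a : ℂ)
    simpa using! h2
  refine (hcont.tendsto.comp hlim).congr fun n => ?_
  rw [Function.comp_apply, angle, z1Ext_of_mem_upperHalf hm hc hΓ (hmem n)]

/-- It suffices to treat half-lines, whose masses are given by the angle; the latter is a pointwise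
limit of arguments of z₁ at height 1/(n+1), which depend continuously on s > 0. -/
lemma measurable_mu1Family (hm : 3 ≤ m) (hβ : ∀ j < m - 1, ContinuousOn (β j) (Set.Ioi 0))
    (hne : ∀ s : ℝ, 0 < s → β (m - 2) s ≠ 0)
    (hΓ : ∀ s : ℝ, 0 < s → ∀ w ∈ Gamma1 m (fun j => β j s), w.im = 0) :
    Measurable (mu1Family m β) := by
  classical
  have hp := isProbabilityMeasure_mu1Family hm hne hΓ
  refine Measurable.measure_of_isPiSystem_of_isProbabilityMeasure (borel_eq_generateFrom_Ioi ℝ ▸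
    BorelSpace.measurable_eq) isPiSystem_Ioi ?_
  rintro _ ⟨a, rfl⟩
  set A : ℝ → ℝ := fun s => if 0 < s then angle m (fun j => β j s) a else 0 with hA
  have hAm : Measurable A := by
    set Z : ℕ → ℝ → ℂ := fun n => (Set.Ioi (0 : ℝ)).piecewise
      (fun s => z1 m (fun j => β j s) (a + ((1 / ((n : ℝ) + 1) : ℝ) : ℂ) * Complex.I))
      (fun _ => 0) with hZ
    have hZm : ∀ n, Measurable (Z n) := fun n =>
      (continuousOn_z1_param hm hβ hne hΓ (add_mul_I_mem_upperHalf a (by positivity))).measurable_piecewise continuousOn_const measurableSet_Ioi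
    refine measurable_of_tendsto_metrizable (f := fun n s => Complex.arg (-Complex.I * Z n s))
      (fun n => Complex.measurable_arg.comp ((hZm n).const_mul _)) ?_
    refine tendsto_pi_nhds.2 fun s => ?_
    by_cases hs : 0 < s
    · simp only [hA, hZ, if_pos hs, Set.piecewise_eq_of_mem _ _ _ (Set.mem_Ioi.2 hs)]
      exact tendsto_angle_shift hm (hne s hs) (hΓ s hs) a
    · simp only [hA, hZ, if_neg hs, Set.piecewise_eq_of_notMem _ _ _ (Set.notMem_Ioi.2 (not_lt.1 hs)),
        mul_zero, Complex.arg_zero]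
      exact tendsto_const_nhds
  have heq : (fun s => mu1Family m β s (Set.Ioi a)) = fun s => if s ∈ Set.Ioi (0 : ℝ) then
      ENNReal.ofReal ((A s + Real.pi / 2) / Real.pi) else Measure.dirac 0 (Set.Ioi a) := by
    funext s
    by_cases hs : 0 < s
    · rw [mu1Family_of_pos hs, if_pos (Set.mem_Ioi.2 hs), mu1_Ioi hm (hne s hs) (hΓ s hs)]
      simp only [hA, if_pos hs]
    · rw [mu1Family, if_neg hs, if_neg (Set.notMem_Ioi.2 (not_lt.1 hs))]
  rw [heq]
  exact Measurable.ite measurableSet_Ioi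
    ((hAm.add_const _).div_const _).ennreal_ofReal measurable_const

lemma mu1_ae_eq_mu1Family (ξ : ℝ) : (fun s => mu1 m (fun j => β j s)) =ᵐ[volume.restrict
    (Set.Ioc 0 ξ)] mu1Family m β := by
  filter_upwards [ae_restrict_mem measurableSet_Ioc] with s hs using (mu1Family_of_pos hs.1).symm

end Measurability

/-! ### Integration against the averaged measure -/

section Average

lemma isProbabilityMeasure_averageMeasure {μ : ℝ → Measure ℝ} (hμ : Measurable μ)
    [∀ s, IsProbabilityMeasure (μ s)] {ξ : ℝ} (hξ : 0 < ξ) :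
    IsProbabilityMeasure (averageMeasure μ ξ) := by
  constructor
  rw [averageMeasure, Measure.smul_apply, Measure.bind_apply .univ hμ.aemeasurable]
  simp only [measure_univ, lintegral_const, Measure.restrict_apply_univ, Real.volume_Ioc, sub_zero,
    one_mul, smul_eq_mul]
  exact ENNReal.inv_mul_cancel (by simpa using hξ) ENNReal.ofReal_ne_top

lemma integral_averageMeasure {μ : ℝ → Measure ℝ} (hμ : Measurable μ)
    [hp : ∀ s, IsProbabilityMeasure (μ s)] {ξ : ℝ} (hξ : 0 < ξ) {f : ℝ → ℂ}
    (hf : Integrable f (averageMeasure μ ξ)) :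
    ∫ t, f t ∂(averageMeasure μ ξ) = ξ⁻¹ • ∫ s in (0 : ℝ)..ξ, ∫ t, f t ∂(μ s) := by
  have h0 : (ENNReal.ofReal ξ)⁻¹ ≠ 0 := ENNReal.inv_ne_zero.2 ENNReal.ofReal_ne_top
  have h1 : (ENNReal.ofReal ξ)⁻¹ ≠ ⊤ := ENNReal.inv_ne_top.2 (by simpa using hξ)
  rw [averageMeasure, integrable_smul_measure h0 h1] at hf
  set κ : ProbabilityTheory.Kernel ℝ ℝ := ⟨μ, hμ⟩ with hκ
  have hbind : (volume.restrict (Set.Ioc 0 ξ)).bind μ = (κ.comp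
      (ProbabilityTheory.Kernel.const Unit (volume.restrict (Set.Ioc 0 ξ)))) () :=
    Measure.comp_eq_comp_const_apply (κ := κ)
  have hκp : ProbabilityTheory.IsMarkovKernel κ := ⟨hp⟩
  have h2 := ProbabilityTheory.Kernel.integral_comp (hbind ▸ hf)
  rw [← hbind, ProbabilityTheory.Kernel.const_apply] at h2
  rw [averageMeasure, integral_smul_measure, intervalIntegral.integral_of_le hξ.le,
    ENNReal.toReal_inv, ENNReal.toReal_ofReal hξ.le, h2]
  rfl

end Average

/-! ### Averages as integrals of step functions -/

section FloorIntegrals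

lemma integral_comp_floor (u : ℕ → ℂ) (N : ℕ) :
    IntervalIntegrable (fun y : ℝ => u ⌊y⌋₊) volume 0 N ∧
      ∫ y in (0 : ℝ)..N, u ⌊y⌋₊ = ∑ i ∈ Finset.range N, u i := by
  induction N with
  | zero => simp
  | succ N ih =>
    have hle : (N : ℝ) ≤ (N + 1 : ℕ) := by push_cast; linarith
    have hfl : Set.EqOn (fun _ : ℝ => u N) (fun y : ℝ => u ⌊y⌋₊)
        (Set.Ioo (N : ℝ) ((N + 1 : ℕ) : ℝ)) := by
      intro y hy
      have : ⌊y⌋₊ = N := (Nat.floor_eq_iff (by linarith [hy.1, N.cast_nonneg (α := ℝ)])).2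
        ⟨hy.1.le, by have := hy.2; push_cast at this; exact this⟩
      simp only [this]
    have h1 : IntervalIntegrable (fun y : ℝ => u ⌊y⌋₊) volume N (N + 1 : ℕ) := by
      rw [intervalIntegrable_iff_integrableOn_Ioo_of_le hle]
      exact (integrableOn_const (by simp)).congr_fun hfl measurableSet_Ioo
    refine ⟨ih.1.trans h1, ?_⟩
    rw [← intervalIntegral.integral_add_adjacent_intervals ih.1 h1, ih.2, Finset.sum_range_succ,
      intervalIntegral.integral_of_le hle, integral_Ioc_eq_integral_Ioo,
      ← setIntegral_congr_fun measurableSet_Ioo hfl]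
    simp

lemma average_eq_integral_floor (u : ℕ → ℂ) {k : ℕ} (hk : 0 < k) :
    (k : ℝ)⁻¹ • ∑ i ∈ Finset.range k, u i = ∫ t in (0 : ℝ)..1, u ⌊(k : ℝ) * t⌋₊ := by
  rw [intervalIntegral.integral_comp_mul_left (fun y => u ⌊y⌋₊) (by exact_mod_cast hk.ne'),
    mul_zero, mul_one, (integral_comp_floor u k).2]

lemma tendsto_floor_mul_ratioFilter {ξ t : ℝ} (ht : 0 < t) :
    Tendsto (fun p : ℕ × ℕ => (⌊(p.1 : ℝ) * t⌋₊, p.2)) (ratioFilter ξ) (ratioFilter (t * ξ)) := by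
  have hk := tendsto_natCast_atTop_atTop (R := ℝ).comp (tendsto_fst_ratioFilter ξ)
  refine tendsto_ratioFilter_iff.2 ⟨tendsto_nat_floor_atTop.comp (hk.atTop_mul_const ht),
    tendsto_snd_ratioFilter ξ, ?_⟩
  have h1 := ((tendsto_nat_floor_mul_div_atTop ht.le).comp hk).mul (tendsto_div_ratioFilter ξ)
  refine h1.congr' ?_
  filter_upwards [(tendsto_fst_ratioFilter ξ).eventually_gt_atTop 0] with p hp
  have : (p.1 : ℝ) ≠ 0 := by exact_mod_cast hp.ne'
  simp only [Function.comp_apply]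
  rw [mul_comm t]
  field_simp

/-- Averages along a doubly indexed sequence with local limits converge to the integral of the
local limits. -/
lemma tendsto_average_of_tendsto_ratioFilter {u : ℕ × ℕ → ℂ} {q : ℝ → ℂ} {ξ K : ℝ} (hξ : 0 < ξ)
    (hK : ∀ k n, 0 < n → ‖u (k, n)‖ ≤ K)
    (hq : ∀ s, 0 < s → s ≤ ξ → Tendsto u (ratioFilter s) (𝓝 (q s))) :
    Tendsto (fun p : ℕ × ℕ => (p.1 : ℝ)⁻¹ • ∑ i ∈ Finset.range p.1, u (i, p.2)) (ratioFilter ξ)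
      (𝓝 (ξ⁻¹ • ∫ s in (0 : ℝ)..ξ, q s)) := by
  have hlim : ∫ t in (0 : ℝ)..1, q (t * ξ) = ξ⁻¹ • ∫ s in (0 : ℝ)..ξ, q s := by
    rw [intervalIntegral.integral_comp_mul_right q hξ.ne', zero_mul, one_mul]
  rw [← hlim]
  -- The average over i < k is the integral over t in [0, 1] of u at (⌊kt⌋, n); for fixed t > 0 this
  -- pair has limiting ratio tξ, and K dominates.
  have h := intervalIntegral.tendsto_integral_filter_of_dominated_convergence (μ := volume)
    (a := 0) (b := 1) (l := ratioFilter ξ)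
    (F := fun p t => u (⌊(p.1 : ℝ) * t⌋₊, p.2)) (f := fun t => q (t * ξ)) (fun _ => K) ?_ ?_ ?_ ?_
  · refine h.congr' ?_
    filter_upwards [(tendsto_fst_ratioFilter ξ).eventually_gt_atTop 0] with p hp
    exact (average_eq_integral_floor (fun i => u (i, p.2)) hp).symm
  · refine Eventually.of_forall fun p => Measurable.aestronglyMeasurable ?_
    exact (measurable_from_nat (f := fun i => u (i, p.2))).comp
      (Nat.measurable_floor.comp (measurable_const_mul _))
  · filter_upwards [(tendsto_snd_ratioFilter ξ).eventually_gt_atTop 0] with p hp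
    exact Eventually.of_forall fun t _ => hK _ _ hp
  · exact intervalIntegrable_const
  · refine Eventually.of_forall fun t ht => ?_
    rw [Set.uIoc_of_le zero_le_one] at ht
    exact (hq (t * ξ) (mul_pos ht.1 hξ) (mul_le_of_le_one_left hξ.le ht.2)).comp
      (tendsto_floor_mul_ratioFilter ht.1)

end FloorIntegrals

/-! ### Zero distribution of the polynomials P -/

section ZeroDistribution

variable {m : ℕ} {b : ℕ → ℕ → ℕ → ℝ} {P : ℕ → ℕ → ℝ[X]} {x : ℕ → ℕ → ℕ → ℝ}

lemma satisfiesRecurrence_map (hP : ∀ n, 0 < n → ∀ k, X * P k n = P (k + 1) n +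
      ∑ j ∈ Finset.range (m - 1), if j ≤ k then C (b j k n) * P (k - j) n else 0) :
    SatisfiesRecurrence m b (fun k n => (P k n).map Complex.ofRealHom) := by
  intro n hn k
  have h := congrArg (Polynomial.map Complex.ofRealHom) (hP n hn k)
  rw [Polynomial.map_mul, map_X, Polynomial.map_add, Polynomial.map_sum] at h
  rw [h]
  congr 1
  refine Finset.sum_congr rfl fun j _ => ?_
  split_ifs <;> simp

lemma map_prod_X_sub_C (a : ℕ → ℝ) (k : ℕ) :
    (∏ j ∈ Finset.Icc 1 k, (X - C (a j))).map Complex.ofRealHom =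
      ∏ j ∈ Finset.Icc 1 k, (X - C (a j : ℂ)) := by
  rw [Polynomial.map_prod]
  simp

lemma roots_prod_Icc {R : Type*} [CommRing R] [IsDomain R] (a : ℕ → R) (k : ℕ) :
    (∏ j ∈ Finset.Icc 1 k, (X - C (a j))).roots = (Finset.Icc 1 k).val.map a := by
  rw [← roots_multiset_prod_X_sub_C ((Finset.Icc 1 k).val.map a), Multiset.map_map]
  rfl

lemma integral_inv_sub_real_roots {p : ℝ[X]} {a : ℕ → ℝ} {k : ℕ}
    (hp : p = ∏ j ∈ Finset.Icc 1 k, (X - C (a j))) {w : ℂ} (hw : w ∈ upperHalf) :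
    ∫ t : ℝ, (w - t)⁻¹ ∂(normalizedCounting p.roots) =
      (k : ℝ)⁻¹ • ((derivative (p.map Complex.ofRealHom)).eval w /
        (p.map Complex.ofRealHom).eval w) := by
  have h0 := eval_prod_ne_zero a k hw
  rw [integral_normalizedCounting, hp, map_prod_X_sub_C,
    (IsAlgClosed.splits _).eval_derivative_div_eval_of_ne_zero h0, roots_prod_Icc,
    roots_prod_Icc (fun j => (a j : ℂ)), Multiset.card_map, Multiset.map_map, Multiset.map_map]
  simp

/-- A bound common to all s in [0, ξ] makes the region of contraction independent of s; continuity
at 0 provides compactness. -/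
lemma exists_uniform_bound {β : ℕ → ℝ → ℝ} (hβ : ∀ j < m - 1, ContinuousOn (β j) (Set.Ici 0))
    (ξ : ℝ) : ∃ B : ℝ, 0 ≤ B ∧ ∀ s ∈ Set.Icc 0 ξ, ∀ j < m - 1, |β j s| ≤ B := by
  have h : ∀ j, ∃ D : ℝ, 0 ≤ D ∧ (j < m - 1 → ∀ s ∈ Set.Icc 0 ξ, |β j s| ≤ D) := by
    intro j
    by_cases hj : j < m - 1
    · obtain ⟨D, hD⟩ := isCompact_Icc.exists_bound_of_continuousOn
        ((hβ j hj).mono fun s (hs : s ∈ Set.Icc 0 ξ) => hs.1)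
      exact ⟨|D|, abs_nonneg _, fun _ s hs => (hD s hs).trans (le_abs_self D)⟩
    · exact ⟨0, le_rfl, fun h => absurd h hj⟩
  choose D hD0 hD using h
  refine ⟨∑ j ∈ Finset.range (m - 1), D j, Finset.sum_nonneg fun j _ => hD0 j, fun s hs j hj => ?_⟩
  exact (hD j hj s hs).trans
    (Finset.single_le_sum (fun j _ => hD0 j) (Finset.mem_range.2 hj))

/-- The zero distributions converge weakly to the average of the measures `μ₁`. -/
theorem weakLimit_zeros (hm : 3 ≤ m) {β : ℕ → ℝ → ℝ}
    (hβ : ∀ j < m - 1, ContinuousOn (β j) (Set.Ici 0))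
    (hlim : ∀ j < m - 1, ∀ s : ℝ, 0 ≤ s →
      Tendsto (fun p : ℕ × ℕ => b j p.1 p.2) (ratioFilter s) (𝓝 (β j s)))
    (hne : ∀ s : ℝ, 0 < s → β (m - 2) s ≠ 0)
    (hP : ∀ n, 0 < n → ∀ k, X * P k n = P (k + 1) n +
      ∑ j ∈ Finset.range (m - 1), if j ≤ k then C (b j k n) * P (k - j) n else 0)
    (hzeros : ∀ n, 0 < n → ∀ k, P k n = ∏ j ∈ Finset.Icc 1 k, (X - C (x k n j)))
    (hsimple : ∀ n, 0 < n → ∀ k, StrictMonoOn (x k n) (Set.Icc 1 k))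
    (hinter : ∀ n, 0 < n → ∀ k, ∀ j ∈ Set.Icc 1 k,
      x (k + 1) n j < x k n j ∧ x k n j < x (k + 1) n (j + 1))
    (hΓ : ∀ s : ℝ, 0 < s → ∀ w ∈ Gamma1 m (fun j => β j s), w.im = 0) {ξ : ℝ} (hξ : 0 < ξ) :
    IsProbabilityMeasure (averageMeasure (mu1Family m β) ξ) ∧
    WeakLimit (fun p : ℕ × ℕ => normalizedCounting (P p.1 p.2).roots) (ratioFilter ξ)
      (averageMeasure (mu1Family m β) ξ) := by
  have hmeas := measurable_mu1Family hm
    (fun j hj => (hβ j hj).mono Set.Ioi_subset_Ici_self) hne hΓ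
  have hprob := isProbabilityMeasure_mu1Family hm hne hΓ
  have havg := isProbabilityMeasure_averageMeasure hmeas hξ
  refine ⟨havg, ?_⟩
  obtain ⟨B, hB0, hB⟩ := exists_uniform_bound hβ ξ
  set ρ : ℝ := 2 * (B + 1) * m ^ 2 with hρ
  have hm1 : (1 : ℝ) ≤ (m : ℝ) ^ 2 := one_le_pow₀ (by exact_mod_cast (by omega : 1 ≤ m))
  have hρ1 : 1 ≤ ρ := by nlinarith
  set Q : ℕ → ℕ → ℂ[X] := fun k n => (P k n).map Complex.ofRealHom with hQ
  have hQprod : ∀ n, 0 < n → ∀ k, Q k n = ∏ j ∈ Finset.Icc 1 k, (X - C (x k n j : ℂ)) := by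
    intro n hn k
    rw [← map_prod_X_sub_C, ← hzeros n hn k]
  -- Height above ρ turns the interlacing bound 1/Im w into 1/ρ, and height above the dominance
  -- radius makes z₁ large for every s in (0, ξ].
  refine weakLimit_of_tendsto_stieltjes (R := max ρ (dominanceRadius m B ρ)) ?_ fun w hw hwR => ?_
  · filter_upwards [(tendsto_fst_ratioFilter ξ).eventually_gt_atTop 0,
      (tendsto_snd_ratioFilter ξ).eventually_gt_atTop 0] with p h1 h2
    refine isProbabilityMeasure_normalizedCounting ?_
    rw [hzeros p.2 h2, roots_prod_Icc, Multiset.card_map]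
    simpa using h1.ne'
  · have hwn : ‖w‖ > dominanceRadius m B ρ := ((le_max_right _ _).trans_lt hwR).trans_le
      ((le_abs_self _).trans (Complex.abs_im_le_norm w))
    have hbounds : ∀ k n, 0 < n → ‖stepRatio Q w (k, n)‖ ≤ w.im⁻¹ ∧
        ‖stepLogDeriv Q w (k, n)‖ ≤ w.im⁻¹ := fun k n hn =>
      interlacing_bounds (hsimple n hn (k + 1)) (hinter n hn k) (hQprod n hn k)
        (hQprod n hn (k + 1)) hw
    have hq : ∀ s, 0 < s → s ≤ ξ → Tendsto (stepLogDeriv Q w) (ratioFilter s)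
        (𝓝 (∫ t : ℝ, (w - t)⁻¹ ∂(mu1Family m β s))) := by
      intro s hs hsξ
      rw [mu1Family_of_pos hs, integral_inv_sub_mu1 hm (hne s hs) (hΓ s hs) hw]
      have hev := (tendsto_snd_ratioFilter s).eventually_gt_atTop 0
      refine tendsto_stepLogDeriv hm (hne s hs) hB0 (hB s ⟨hs.le, hsξ⟩) hρ1 le_rfl
        (satisfiesRecurrence_map hP) (fun j hj => hlim j hj s hs.le) hwn
        (fun n hn k => by
          rw [show (P k n).map Complex.ofRealHom = _ from hQprod n hn k]
          exact eval_prod_ne_zero _ _ hw) ?_ (K := w.im⁻¹) ?_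
      · filter_upwards [hev] with p hp
        exact (hbounds p.1 p.2 hp).1.trans
          (inv_anti₀ (by linarith) ((le_max_left _ _).trans hwR.le))
      · filter_upwards [hev] with p hp using (hbounds p.1 p.2 hp).2
    have h := tendsto_average_of_tendsto_ratioFilter hξ (fun k n hn => (hbounds k n hn).2) hq
    rw [integral_averageMeasure hmeas hξ (f := fun t => (w - t)⁻¹)
      ((cauchyKernel w hw).integrable _)]
    refine h.congr' ?_
    filter_upwards [(tendsto_snd_ratioFilter ξ).eventually_gt_atTop 0] with p hp
    rw [integral_inv_sub_real_roots (hzeros p.2 hp p.1) hw,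
      ← polyLogDeriv_eq_sum (P := Q) (by rw [hQprod p.2 hp 0]; simp)]
    rfl

end ZeroDistribution

theorem mainTheorem2 (m : ℕ) (hm : 3 ≤ m)
    -- `b j k n` is the recurrence coefficient with upper index `j` and lower indices `k, n`
    (b : ℕ → ℕ → ℕ → ℝ) (β : ℕ → ℝ → ℝ)
    (hβ : ∀ j ≤ m - 2, ContinuousOn (β j) (Set.Ici 0))
    (hlim : ∀ j ≤ m - 2, ∀ s : ℝ, 0 ≤ s →
      Tendsto (fun p : ℕ × ℕ => b j p.1 p.2) (ratioFilter s) (𝓝 (β j s)))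
    (hne : ∀ s : ℝ, 0 < s → β (m - 2) s ≠ 0)
    -- `P k n` are generated by the `m`-term recurrence, with `P` of negative index equal to `0`
    (P : ℕ → ℕ → ℝ[X])
    (hP0 : ∀ n, 0 < n → P 0 n = 1)
    (hP : ∀ n, 0 < n → ∀ k, X * P k n = P (k + 1) n +
      ∑ j ∈ Finset.range (m - 1), if j ≤ k then C (b j k n) * P (k - j) n else 0)
    -- the zeros `x k n 1 < ⋯ < x k n k` of `P k n` are real, simple and interlacing
    (x : ℕ → ℕ → ℕ → ℝ)
    (hzeros : ∀ n, 0 < n → ∀ k, P k n = ∏ j ∈ Finset.Icc 1 k, (X - C (x k n j)))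
    (hsimple : ∀ n, 0 < n → ∀ k, StrictMonoOn (x k n) (Set.Icc 1 k))
    (hinter : ∀ n, 0 < n → ∀ k, ∀ j ∈ Set.Icc 1 k,
      x (k + 1) n j < x k n j ∧ x k n j < x (k + 1) n (j + 1))
    (hΓ : ∀ s : ℝ, 0 < s → ∀ w ∈ Gamma1 m (fun j => β j s), w.im = 0) :
    (∀ s : ℝ, 0 < s →
      IsProbabilityMeasure (mu1 m (fun j => β j s)) ∧
      WeakLimit (fun n => normalizedCounting (toeplitz m (fun j => β j s) n).charpoly.roots)
        atTop ((mu1 m (fun j => β j s)).map (fun y : ℝ => (y : ℂ)))) ∧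
    (∀ ξ : ℝ, 0 < ξ →
      AEMeasurable (fun s => mu1 m (fun j => β j s)) (volume.restrict (Set.Ioc 0 ξ)) ∧
      IsProbabilityMeasure (averageMeasure (fun s => mu1 m (fun j => β j s)) ξ) ∧
      WeakLimit (fun p : ℕ × ℕ => normalizedCounting (P p.1 p.2).roots) (ratioFilter ξ)
        (averageMeasure (fun s => mu1 m (fun j => β j s)) ξ)) := by
  have hj : ∀ j, j < m - 1 ↔ j ≤ m - 2 := fun j => by omega
  refine ⟨fun s hs => ⟨isProbabilityMeasure_mu1 hm (hne s hs) (hΓ s hs),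
    weakLimit_toeplitz hm (hne s hs) (hΓ s hs)⟩, fun ξ hξ => ?_⟩
  -- The extended family, measurable on the whole line, agrees with μ₁ on (0, ξ], so the averages
  -- coincide.
  have hae := mu1_ae_eq_mu1Family (m := m) (β := β) ξ
  have havg : averageMeasure (fun s => mu1 m (fun j => β j s)) ξ =
      averageMeasure (mu1Family m β) ξ := by
    rw [averageMeasure, averageMeasure, Measure.bind_congr_right hae]
  rw [havg]
  exact ⟨⟨mu1Family m β, measurable_mu1Family hm
    (fun j h => (hβ j ((hj j).1 h)).mono Set.Ioi_subset_Ici_self) hne hΓ, hae⟩,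
    weakLimit_zeros hm (fun j h => hβ j ((hj j).1 h)) (fun j h => hlim j ((hj j).1 h)) hne hP
      hzeros hsimple hinter hΓ hξ⟩
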